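/- Let $N,n\ge 0$ be integers. The Yangian $Y(\mathfrak{gl}_N)$ is the unital associative $\mathbb C$-algebra with generators $T_{i,j}^{\{s\}}$ ($1\le i,j\le N$, $s\ge1$) and relations $$(u-v)[T_{i,j}(u),T_{k,l}(v)]=T_{k,j}(v)T_{i,l}(u)-T_{k,j}(u)T_{i,l}(v),\qquad T_{i,j}(u)=\delta_{ij}+\sum_{s\ge1}T_{i,j}^{\{s\}}u^{-s},$$ with coproduct $\Delta(T_{i,j}(u))=\sum_{k}T_{k,j}(u)\otimes T_{i,k}(u)$. For $b\in\mathbb C$, the evaluation module $\mathbb C^N(b)$ is the vector representation of $\mathfrak{gl}_N$ pulled back along the composition of the automorphism $T_{i,j}(u)\mapsto T_{i,j}(u-b)$ of $Y(\mathfrak{gl}_N)$ and the evaluation homomorphism $Y(\mathfrak{gl}_N)\to U(\mathfrak{gl}_N)$, $T^{\{1\}}_{i,j}\mapsto e_{j,i}$, $T^{\{s\}}_{i,j}\mapsto0$ for $s>1$. Here $(u-b)^{-1}$ is expanded in powers of $u^{-1}$. Let $V=(\mathbb C^N)^{\otimes n}$ and $\mathcal V=V\otimes\mathbb C[z_1,\dots,z_n]$,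 and let $P^{(i,j)}$ be the permutation of the $i$-th and $j$-th tensor factors. The symmetric group $S_n$ acts on $\mathcal V$ by $$s_i f(z_1,\dots,z_n)=\frac{(z_i-z_{i+1})P^{(i,i+1)}-1}{z_i-z_{i+1}}\,f(z_1,\dots,z_{i+1},z_i,\dots,z_n)+\frac{1}{z_i-z_{i+1}}\,f(z_1,\dots,z_n);$$ let $\mathcal V^S$ be the space of invariants. The formula $T_{i,j}(u)\mapsto L_{i,j}(u)\prod_{a=1}^n(u-z_a)^{-1}$, where $L_{i,j}(u)$ are the matrix entries, with respect to the factor number $0$ of $\mathbb C^N\otimes V$, of $L(u)=(u-z_n+P^{(0,n)})\cdots(u-z_1+P^{(0,1)})$, makes $\mathcal V$ a $Y(\mathfrak{gl}_N)$-module. The action commutes with $S_n$ and with multiplication by polynomials in $z_1,\dots,z_n$, so $\mathcal V^S$ is a $Y(\mathfrak{gl}_N)$-module. For $\boldsymbol a=(a_1,\dots,a_n)\in\mathbb C^n$ let $I_{\boldsymbol a}\subset\mathbb C[z_1,\dots,z_n]^S$ be the ideal generated by $\sigma_i(\boldsymbol z)-a_i$, $i=1,\dots,n$, where $\sigma_i$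 is the $i$-th elementary symmetric polynomial. Then $I_{\boldsymbol a}\mathcal V^S$ is a submodule of $\mathcal V^S$. Let $b_1,\dots,b_n\in\mathbb C$ satisfy $\prod_{s=1}^n(u-b_s)=u^n+\sum_{j=1}^n(-1)^ja_ju^{n-j}$, and assume that they are ordered so that $b_i\neq b_j+1$ for all $i>j$. Then the map sending $f\in\mathcal V^S$ to its value at $\boldsymbol z=(b_1,\dots,b_n)$ induces an isomorphism of $Y(\mathfrak{gl}_N)$-modules $$\mathcal V^S/I_{\boldsymbol a}\mathcal V^S\;\cong\;\mathbb C^N(b_1)\otimes\dots\otimes\mathbb C^N(b_n).$$ -/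

import Mathlib

open scoped TensorProduct

/-! ### The defining relations of the Yangian

A matrix `T` of power series over a ring `A` stands for the series
`T i j = T_{ij}(u) = ∑ s, T_{ij}^{(s)} u ^ (-s)`; the power series variable is `u⁻¹`. -/

/-- The defining relations of the Yangian of `gl_N` for the matrix `T` of series in `u⁻¹`:
the constant term of `T_{ij}(u)` is `δ_{ij}`, and
`(u - v) [T_{ij}(u), T_{kl}(v)] = T_{kj}(v) T_{il}(u) - T_{kj}(u) T_{il}(v)`.
The second relation is written coefficientwise: the coefficients of `u ^ (-r) v ^ (-s)` on the two
sides are compared, for all `r, s ≥ 0` (the remaining coefficients vanish on both sides because the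
constant terms are scalars; see `IsRTT.iff_series` for the form with generating series). -/
structure IsRTT {N : ℕ} {A : Type*} [Ring A] (T : Matrix (Fin N) (Fin N) (PowerSeries A)) :
    Prop where
  coeff_zero : ∀ i j, PowerSeries.coeff 0 (T i j) = if i = j then 1 else 0
  comm : ∀ i j k l : Fin N, ∀ r s : ℕ,
    (PowerSeries.coeff (r + 1) (T i j) * PowerSeries.coeff s (T k l)
        - PowerSeries.coeff s (T k l) * PowerSeries.coeff (r + 1) (T i j))
      - (PowerSeries.coeff r (T i j) * PowerSeries.coeff (s + 1) (T k l)
        - PowerSeries.coeff (s + 1) (T k l) * PowerSeries.coeff r (T i j))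
      = PowerSeries.coeff s (T k j) * PowerSeries.coeff r (T i l)
        - PowerSeries.coeff r (T k j) * PowerSeries.coeff s (T i l)

namespace IsRTT

variable {N : ℕ} {A : Type*} [Ring A]

/-- `f(u)` as a series in `u⁻¹` (inner variable) and `v⁻¹` (outer variable). -/
noncomputable abbrev inU : PowerSeries A →+* PowerSeries (PowerSeries A) := PowerSeries.C
/-- `f(v)` as a series in `u⁻¹` (inner variable) and `v⁻¹` (outer variable). -/
noncomputable abbrev inV : PowerSeries A →+* PowerSeries (PowerSeries A) :=
  PowerSeries.map PowerSeries.C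

theorem coeff_UV (f g : PowerSeries A) (r s : ℕ) :
    PowerSeries.coeff r (PowerSeries.coeff s (inU f * inV g))
      = PowerSeries.coeff r f * PowerSeries.coeff s g := by
  simp [inU, inV]

theorem coeff_VU (f g : PowerSeries A) (r s : ℕ) :
    PowerSeries.coeff r (PowerSeries.coeff s (inV g * inU f))
      = PowerSeries.coeff s g * PowerSeries.coeff r f := by
  simp [inU, inV]

theorem commute_of_coeff {B : Type*} [Ring B] {f g : PowerSeries B}
    (h : ∀ r s, Commute (PowerSeries.coeff r f) (PowerSeries.coeff s g)) : Commute f g := by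
  ext n
  rw [PowerSeries.coeff_mul, PowerSeries.coeff_mul, ← Finset.Nat.sum_antidiagonal_swap]
  exact Finset.sum_congr rfl fun p _ => h _ _

theorem commute_UV {f g : PowerSeries A}
    (h : ∀ r s, Commute (PowerSeries.coeff r f) (PowerSeries.coeff s g)) :
    Commute (inU f) (inV g) := by
  refine PowerSeries.ext fun s => PowerSeries.ext fun r => ?_
  rw [coeff_UV, coeff_VU]; exact h _ _

theorem xy_comm_left (w : PowerSeries (PowerSeries A)) :
    Commute (PowerSeries.C (PowerSeries.X : PowerSeries A)) w := by
  refine commute_of_coeff fun r s => ?_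
  rw [PowerSeries.coeff_C]
  split_ifs
  · exact (PowerSeries.commute_X _).symm
  · exact Commute.zero_left _

/-- The relations in terms of generating series: with `x = u⁻¹` and `y = v⁻¹`, the relation
`(u - v) [T_{ij}(u), T_{kl}(v)] = T_{kj}(v) T_{il}(u) - T_{kj}(u) T_{il}(v)`, multiplied by `x y`. -/
theorem iff_series (T : Matrix (Fin N) (Fin N) (PowerSeries A)) :
    IsRTT T ↔ (∀ i j, PowerSeries.coeff 0 (T i j) = if i = j then 1 else 0) ∧
      ∀ i j k l,
        (PowerSeries.X - PowerSeries.C PowerSeries.X) *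
            (inU (T i j) * inV (T k l) - inV (T k l) * inU (T i j))
          = (PowerSeries.X * PowerSeries.C PowerSeries.X) *
            (inV (T k j) * inU (T i l) - inU (T k j) * inV (T i l)) := by
  constructor
  · intro h
    refine ⟨h.coeff_zero, fun i j k l => ?_⟩
    refine PowerSeries.ext fun s => PowerSeries.ext fun r => ?_
    set G := inU (T i j) * inV (T k l) - inV (T k l) * inU (T i j) with hG
    set H := inV (T k j) * inU (T i l) - inU (T k j) * inV (T i l) with hH
    have eG : ∀ r s, PowerSeries.coeff r (PowerSeries.coeff s G) = 
        PowerSeries.coeff r (T i j) * PowerSeries.coeff s (T k l)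
        - PowerSeries.coeff s (T k l) * PowerSeries.coeff r (T i j) := fun r s => by
      rw [hG, map_sub, map_sub, coeff_UV, coeff_VU]
    have eH : ∀ r s, PowerSeries.coeff r (PowerSeries.coeff s H) = 
        PowerSeries.coeff s (T k j) * PowerSeries.coeff r (T i l)
        - PowerSeries.coeff r (T k j) * PowerSeries.coeff s (T i l) := fun r s => by
      rw [hH, map_sub, map_sub, coeff_UV, coeff_VU]
    have hc : ∀ (p q : Fin N) (w : A), PowerSeries.coeff 0 (T p q) * w = w * PowerSeries.coeff 0 (T p q) := by
      intro p q w; rw [h.coeff_zero]; split_ifs <;> simp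
    rw [sub_mul, map_sub, mul_assoc]
    rcases s with _ | s
    · rw [PowerSeries.coeff_zero_X_mul, PowerSeries.coeff_C_mul, PowerSeries.coeff_zero_X_mul]
      rcases r with _ | r
      · simp
      · simp only [map_sub, map_zero, PowerSeries.coeff_succ_X_mul, eG, hc]
        simp
    · rw [PowerSeries.coeff_succ_X_mul, PowerSeries.coeff_C_mul, PowerSeries.coeff_succ_X_mul,
        PowerSeries.coeff_C_mul]
      rcases r with _ | r
      · simp only [map_sub, PowerSeries.coeff_zero_X_mul, eG, hc]
        simp
      · simp only [map_sub, PowerSeries.coeff_succ_X_mul, eG, eH]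
        exact h.comm i j k l r s
  · rintro ⟨h0, h⟩
    refine ⟨h0, fun i j k l r s => ?_⟩
    have := congrArg (fun w => PowerSeries.coeff (r + 1) (PowerSeries.coeff (s + 1) w)) (h i j k l)
    beta_reduce at this
    rw [sub_mul, map_sub, mul_assoc, PowerSeries.coeff_succ_X_mul, PowerSeries.coeff_C_mul,
      PowerSeries.coeff_succ_X_mul, PowerSeries.coeff_C_mul, map_sub,
      PowerSeries.coeff_succ_X_mul, PowerSeries.coeff_succ_X_mul] at this
    simpa only [map_sub, coeff_UV, coeff_VU] using this

theorem mul_aux {W : Type*} [Ring W] (z w : W) (zc : ∀ p, Commute z p) (wc : ∀ p, Commute w p)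
    (b b' a a' : Matrix (Fin N) (Fin N) W)
    (hb : ∀ i j k l, z * (b i j * b' k l - b' k l * b i j)
      = w * (b' k j * b i l - b k j * b' i l))
    (ha : ∀ i j k l, z * (a i j * a' k l - a' k l * a i j)
      = w * (a' k j * a i l - a k j * a' i l))
    (h1 : ∀ i j k l, Commute (a i j) (b' k l)) (h2 : ∀ i j k l, Commute (a' i j) (b k l))
    (i j k l : Fin N) :
    z * ((b * a) i j * (b' * a') k l - (b' * a') k l * (b * a) i j)
      = w * ((b' * a') k j * (b * a) i l - (b * a) k j * (b' * a') i l) := by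
  have e1 : ∀ i j k l, (b * a) i j * (b' * a') k l
      = ∑ p, ∑ q, b i p * b' k q * (a p j * a' q l) := fun i j k l => by
    rw [Matrix.mul_apply, Matrix.mul_apply, Finset.sum_mul_sum]
    refine Finset.sum_congr rfl fun p _ => Finset.sum_congr rfl fun q _ => ?_
    rw [mul_assoc, ← mul_assoc (a p j), (h1 p j k q).eq]; simp only [mul_assoc]
  have e2 : ∀ i j k l, (b' * a') k l * (b * a) i j
      = ∑ p, ∑ q, b' k q * b i p * (a' q l * a p j) := fun i j k l => by
    rw [Matrix.mul_apply, Matrix.mul_apply, Finset.sum_mul_sum, Finset.sum_comm]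
    refine Finset.sum_congr rfl fun p _ => Finset.sum_congr rfl fun q _ => ?_
    rw [mul_assoc, ← mul_assoc (a' q l), (h2 q l i p).eq]; simp only [mul_assoc]
  have hb' : ∀ i j k l, z * (b i j * b' k l) + w * (b k j * b' i l)
      = z * (b' k l * b i j) + w * (b' k j * b i l) := fun i j k l => by
    have := hb i j k l
    rw [mul_sub, mul_sub, sub_eq_sub_iff_add_eq_add] at this
    rw [this, add_comm]
  have ha' : ∀ i j k l, z * (a i j * a' k l) + w * (a k j * a' i l)
      = z * (a' k l * a i j) + w * (a' k j * a i l) := fun i j k l => by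
    have := ha i j k l
    rw [mul_sub, mul_sub, sub_eq_sub_iff_add_eq_add] at this
    rw [this, add_comm]
  rw [mul_sub, mul_sub, sub_eq_sub_iff_add_eq_add]
  rw [add_comm (w * ((b' * a') k j * (b * a) i l))]
  have c1 : z * ((b * a) i j * (b' * a') k l) + w * ((b * a) k j * (b' * a') i l)
      = ∑ p, ∑ q, (z * (b i p * b' k q) + w * (b k p * b' i q)) * (a p j * a' q l) := by
    rw [e1, e1]
    simp only [Finset.mul_sum, add_mul, Finset.sum_add_distrib, mul_assoc]
  have c2 : ∑ p, ∑ q, (z * (b i p * b' k q) + w * (b k p * b' i q)) * (a p j * a' q l)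
      = ∑ p, ∑ q, b' k q * b i p * (z * (a p j * a' q l) + w * (a q j * a' p l)) := by
    have : ∀ p q, b' k q * b i p * (z * (a p j * a' q l) + w * (a q j * a' p l))
        = z * (b' k q * b i p) * (a p j * a' q l) + w * (b' k q * b i p) * (a q j * a' p l) := by
      intro p q
      rw [mul_add, ← mul_assoc, ← (zc (b' k q * b i p)).eq, ← mul_assoc (b' k q * b i p) w,
        ← (wc (b' k q * b i p)).eq]
    simp only [this, hb', add_mul, Finset.sum_add_distrib]
    congr 1
    rw [Finset.sum_comm]
  have c3 : z * ((b' * a') k l * (b * a) i j) + w * ((b' * a') k j * (b * a) i l)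
      = ∑ p, ∑ q, b' k q * b i p * (z * (a' q l * a p j) + w * (a' q j * a p l)) := by
    rw [e2, e2]
    simp only [Finset.mul_sum, mul_add, Finset.sum_add_distrib]
    congr 1 <;> refine Finset.sum_congr rfl fun p _ => Finset.sum_congr rfl fun q _ => ?_
    · rw [← mul_assoc, (zc (b' k q * b i p)).eq, mul_assoc]
    · rw [← mul_assoc, (wc (b' k q * b i p)).eq, mul_assoc]
  rw [c1, c2, c3]
  simp only [ha']

/-- The product of two matrices satisfying the relations, whose entries commute with each other,
satisfies the relations. -/
theorem mul {S T : Matrix (Fin N) (Fin N) (PowerSeries A)} (hS : IsRTT S) (hT : IsRTT T)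
    (hc : ∀ i j k l r s,
      Commute (PowerSeries.coeff r (S i j)) (PowerSeries.coeff s (T k l))) :
    IsRTT (S * T) := by
  obtain ⟨S0, S1⟩ := (iff_series S).1 hS
  obtain ⟨T0, T1⟩ := (iff_series T).1 hT
  refine (iff_series _).2 ⟨fun i j => ?_, fun i j k l => ?_⟩
  · rw [Matrix.mul_apply, map_sum]
    simp only [PowerSeries.coeff_mul, Finset.Nat.antidiagonal_zero, Finset.sum_singleton, S0, T0]
    simp
  · have e : ∀ f : PowerSeries A →+* PowerSeries (PowerSeries A), ∀ i j,
        f ((S * T) i j) = (S.map f * T.map f) i j := fun f i j => by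
      rw [← Matrix.map_mul]; rfl
    simp only [e]
    refine mul_aux _ _ (fun p => ?_) (fun p => ?_) _ _ _ _ S1 T1 (fun i j k l => ?_)
      (fun i j k l => ?_) i j k l
    · exact ((PowerSeries.commute_X p).symm).sub_left (xy_comm_left p)
    · exact ((PowerSeries.commute_X p).symm).mul_left (xy_comm_left p)
    · exact commute_UV fun r s => (hc k l i j s r).symm
    · exact (commute_UV fun r s => hc k l i j r s).symm

theorem scalar (g : PowerSeries A) (g0 : PowerSeries.coeff 0 g = 1)
    (hg : ∀ r s, Commute (PowerSeries.coeff r g) (PowerSeries.coeff s g)) :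
    IsRTT (Matrix.scalar (Fin N) g) := by
  constructor
  · intro i j
    by_cases h : i = j
    · subst h; simpa using g0
    · simp [h]
  · intro i j k l r s
    have e : ∀ (i j : Fin N) r, PowerSeries.coeff r (Matrix.scalar (Fin N) g i j)
        = if i = j then PowerSeries.coeff r g else 0 := by
      intro i j r
      by_cases h : i = j
      · subst h; simp
      · simp [h]
    simp only [e]
    split_ifs <;> simp [(hg _ _).eq]

theorem one : IsRTT (1 : Matrix (Fin N) (Fin N) (PowerSeries A)) := by
  rw [← map_one (Matrix.scalar (Fin N))]
  refine scalar 1 (by simp) fun r s => ?_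
  rw [PowerSeries.coeff_one, PowerSeries.coeff_one]
  split_ifs <;> simp [Commute, SemiconjBy]

theorem scalar_mul {T : Matrix (Fin N) (Fin N) (PowerSeries A)} (hT : IsRTT T)
    (g : PowerSeries A) (g0 : PowerSeries.coeff 0 g = 1)
    (hg : ∀ r s, Commute (PowerSeries.coeff r g) (PowerSeries.coeff s g))
    (hc : ∀ k l r s, Commute (PowerSeries.coeff r g) (PowerSeries.coeff s (T k l))) :
    IsRTT (Matrix.of fun i j => g * T i j) := by
  have h := scalar (N := N) g g0 hg
  have h2 := h.mul hT (fun i j k l r s => by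
    by_cases h : i = j
    · subst h; simpa using hc k l r s
    · simp [h])
  convert h2 using 1
  ext i j : 2
  simp

/-- `T_{ij}(u) = δ_{ij} + u⁻¹ (e_{ji} - δ_{ij} z)` satisfies the relations if the `e_{ij}` satisfy the
commutation relations of `gl_N` and `z` commutes with them. -/
theorem linear (e : Fin N → Fin N → A) (z : A)
    (he : ∀ i j k l, e i j * e k l - e k l * e i j
      = (if j = k then e i l else 0) - (if l = i then e k j else 0))
    (hz : ∀ i j, Commute z (e i j)) :
    IsRTT (Matrix.of fun i j => (if i = j then 1 else 0)
      + PowerSeries.X * PowerSeries.C (e j i - if i = j then z else 0)) := by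
  set T : Matrix (Fin N) (Fin N) (PowerSeries A) := Matrix.of fun i j => (if i = j then 1 else 0)
      + PowerSeries.X * PowerSeries.C (e j i - if i = j then z else 0) with hT
  have c0 : ∀ i j, PowerSeries.coeff 0 (T i j) = if i = j then 1 else 0 := fun i j => by
    simp only [hT, Matrix.of_apply]; split_ifs <;> simp
  have c1 : ∀ i j, PowerSeries.coeff 1 (T i j) = e j i - if i = j then z else 0 := fun i j => by
    simp only [hT, Matrix.of_apply, map_add, PowerSeries.coeff_succ_X_mul (n := 0)]
    split_ifs <;> simp [PowerSeries.coeff_one]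
  have c2 : ∀ i j r, PowerSeries.coeff (r + 2) (T i j) = 0 := fun i j r => by
    simp only [hT, Matrix.of_apply, map_add, PowerSeries.coeff_succ_X_mul]
    split_ifs <;> simp [PowerSeries.coeff_one]
  refine ⟨c0, fun i j k l r s => ?_⟩
  have key : ∀ i j k l : Fin N, (e j i - if i = j then z else 0) * (e l k - if k = l then z else 0)
      - (e l k - if k = l then z else 0) * (e j i - if i = j then z else 0)
      = (e j k - if k = j then z else 0) * (if i = l then 1 else 0)
        - (if k = j then 1 else 0) * (e l i - if i = l then z else 0) := by
    intro i j k l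
    have h1 : (e j i - if i = j then z else 0) * (e l k - if k = l then z else 0)
      - (e l k - if k = l then z else 0) * (e j i - if i = j then z else 0)
      = e j i * e l k - e l k * e j i := by
      have a1 := (hz l k).eq
      have a2 := (hz j i).eq
      split_ifs <;> simp only [mul_sub, sub_mul, a1, a2, mul_zero, zero_mul] <;> abel
    rw [h1, he]
    by_cases p : i = l <;> by_cases q : k = j <;> simp [p, q]
  have d0 : ∀ (i j : Fin N) (x : A), (if i = j then (1 : A) else 0) * x
      = x * (if i = j then 1 else 0) := fun i j x => by split_ifs <;> simp
  rcases r with _ | _ | r <;> rcases s with _ | _ | s <;>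
    simp only [c0, c1, c2, zero_add, mul_zero, zero_mul, sub_self]
  · simp only [d0, sub_self]
  · rw [← key]; simp
  · have := congrArg Neg.neg (key i j k l)
    rw [neg_sub, neg_sub] at this
    simpa using this

/-- The substitution `f(u) ↦ f(u - b)` on series in `u⁻¹`, with
`(u - b) ^ (-s) = ∑_{r ≥ s} ((r - 1).choose (r - s)) b ^ (r - s) u ^ (-r)`
(for `s = 0` only the term `r = 0` is nonzero). -/
noncomputable def shift {A : Type*} [Ring A] [Algebra ℂ A] (b : ℂ) (f : PowerSeries A) :
    PowerSeries A :=
  PowerSeries.mk fun r => ∑ s ∈ Finset.range (r + 1),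
    ((Nat.choose (r - 1) (r - s) : ℂ) * b ^ (r - s)) • PowerSeries.coeff s f

theorem coeff_shift_succ {A : Type*} [Ring A] [Algebra ℂ A] (b : ℂ) (f : PowerSeries A) (r : ℕ) :
    PowerSeries.coeff (r + 1) (shift b f)
      = PowerSeries.coeff r (shift b (PowerSeries.mk fun m => PowerSeries.coeff (m + 1) f))
        + b • PowerSeries.coeff r (shift b f) - if r = 0 then b • PowerSeries.coeff 0 f else 0 := by
  rcases r with _ | r
  · simp [shift, Finset.sum_range_succ]
  · simp only [shift, PowerSeries.coeff_mk, Nat.add_sub_cancel, if_neg (Nat.succ_ne_zero r),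
      sub_zero, Finset.smul_sum]
    rw [Finset.sum_range_succ' (n := r + 1 + 1), Finset.sum_range_succ' (n := r + 1) (fun x =>
      b • ((Nat.choose r (r + 1 - x) : ℂ) * b ^ (r + 1 - x)) • PowerSeries.coeff x f)]
    simp only [Nat.add_sub_add_right, Nat.sub_zero, Nat.choose_succ_self, Nat.cast_zero, zero_mul,
      zero_smul, smul_zero, add_zero]
    rw [Finset.sum_range_succ, Finset.sum_range_succ (n := r + 1), add_right_comm (Finset.sum _ _),
      ← Finset.sum_add_distrib]
    congr 1
    · refine Finset.sum_congr rfl fun p hp => ?_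
      have hp' : p ≤ r := by simpa [Nat.lt_succ_iff] using hp
      obtain ⟨d, rfl⟩ := Nat.exists_eq_add_of_le hp'
      rw [show p + d + 1 - p = d + 1 by omega, show p + d - p = d by omega, smul_smul, ← add_smul,
        Nat.choose_succ_succ]
      congr 1
      push_cast
      ring
    · simp

theorem isRTT_shift {A : Type*} [Ring A] [Algebra ℂ A] (b : ℂ)
    {T : Matrix (Fin N) (Fin N) (PowerSeries A)} (hT : IsRTT T) : IsRTT (T.map (shift b)) := by
  have e0 : ∀ f : PowerSeries A, PowerSeries.coeff 0 (shift b f) = PowerSeries.coeff 0 f := by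
    intro f; simp [shift]
  refine ⟨fun i j => by rw [Matrix.map_apply, e0, hT.coeff_zero], fun i j k l r s => ?_⟩
  simp only [Matrix.map_apply]
  set tl : PowerSeries A → PowerSeries A :=
    fun f => PowerSeries.mk fun m => PowerSeries.coeff (m + 1) f with htl
  have hc : ∀ (p q : Fin N) (w : A), PowerSeries.coeff 0 (T p q) * w
      = w * PowerSeries.coeff 0 (T p q) := by
    intro p q w; rw [hT.coeff_zero]; split_ifs <;> simp
  set c : ℕ → ℕ → ℂ := fun r p => (Nat.choose (r - 1) (r - p) : ℂ) * b ^ (r - p) with hcdef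
  have expand : ∀ (f g : PowerSeries A) (r s : ℕ),
      PowerSeries.coeff r (shift b f) * PowerSeries.coeff s (shift b g)
      = ∑ p ∈ Finset.range (r + 1), ∑ q ∈ Finset.range (s + 1),
        (c r p * c s q) • (PowerSeries.coeff p f * PowerSeries.coeff q g) := fun f g r s => by
    simp only [shift, PowerSeries.coeff_mk, Finset.sum_mul_sum, smul_mul_smul_comm, hcdef]
  have expand' : ∀ (f g : PowerSeries A) (r s : ℕ),
      PowerSeries.coeff s (shift b g) * PowerSeries.coeff r (shift b f)
      = ∑ p ∈ Finset.range (r + 1), ∑ q ∈ Finset.range (s + 1),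
        (c r p * c s q) • (PowerSeries.coeff q g * PowerSeries.coeff p f) := fun f g r s => by
    rw [expand, Finset.sum_comm]
    refine Finset.sum_congr rfl fun p _ => Finset.sum_congr rfl fun q _ => by rw [mul_comm]
  have step : PowerSeries.coeff (r + 1) (shift b (T i j)) * PowerSeries.coeff s (shift b (T k l))
        - PowerSeries.coeff s (shift b (T k l)) * PowerSeries.coeff (r + 1) (shift b (T i j))
      - (PowerSeries.coeff r (shift b (T i j)) * PowerSeries.coeff (s + 1) (shift b (T k l))
        - PowerSeries.coeff (s + 1) (shift b (T k l)) * PowerSeries.coeff r (shift b (T i j)))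
      = PowerSeries.coeff r (shift b (tl (T i j))) * PowerSeries.coeff s (shift b (T k l))
        - PowerSeries.coeff s (shift b (T k l)) * PowerSeries.coeff r (shift b (tl (T i j)))
      - (PowerSeries.coeff r (shift b (T i j)) * PowerSeries.coeff s (shift b (tl (T k l)))
        - PowerSeries.coeff s (shift b (tl (T k l))) * PowerSeries.coeff r (shift b (T i j))) := by
    have hd : ∀ (p q : Fin N) (r : ℕ) (w : A),
        (if r = 0 then b • PowerSeries.coeff 0 (T p q) else 0) * w
          = w * (if r = 0 then b • PowerSeries.coeff 0 (T p q) else 0) := by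
      intro p q r w; split_ifs
      · rw [smul_mul_assoc, hc, mul_smul_comm]
      · simp
    rw [coeff_shift_succ b (T i j), coeff_shift_succ b (T k l)]
    simp only [sub_mul, mul_sub, add_mul, mul_add, smul_mul_assoc, mul_smul_comm, hd]
    abel
  rw [step]
  rw [expand, expand', expand, expand', expand', expand]
  simp only [← Finset.sum_sub_distrib, ← smul_sub]
  refine Finset.sum_congr rfl fun p _ => Finset.sum_congr rfl fun q _ => ?_
  congr 1
  simpa [htl] using hT.comm i j k l p q

end IsRTT

/-! ### The Yangian -/

namespace Yangian

/-- `T_{ij}^{(s)}` in the free algebra: the generator number `(i, j, s - 1)` for `s ≥ 1`, and `δ_{ij}`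
for `s = 0`. -/
noncomputable def freeGen (N : ℕ) (i j : Fin N) :
    ℕ → FreeAlgebra ℂ (Fin N × Fin N × ℕ)
  | 0 => if i = j then 1 else 0
  | s + 1 => FreeAlgebra.ι ℂ (i, j, s)

/-- The defining relations, between elements of the free algebra (compare `IsRTT.comm`). -/
inductive Rel (N : ℕ) :
    FreeAlgebra ℂ (Fin N × Fin N × ℕ) → FreeAlgebra ℂ (Fin N × Fin N × ℕ) → Prop
  | rtt (i j k l : Fin N) (r s : ℕ) : Rel N
      ((freeGen N i j (r + 1) * freeGen N k l s - freeGen N k l s * freeGen N i j (r + 1))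
        - (freeGen N i j r * freeGen N k l (s + 1) - freeGen N k l (s + 1) * freeGen N i j r))
      (freeGen N k j s * freeGen N i l r - freeGen N k j r * freeGen N i l s)

end Yangian

/-- The Yangian `Y(gl_N)`: the unital associative algebra with generators `T_{ij}^{(s)}`, `s ≥ 1`, and
the relations `(u - v) [T_{ij}(u), T_{kl}(v)] = T_{kj}(v) T_{il}(u) - T_{kj}(u) T_{il}(v)`. -/
def Yangian (N : ℕ) : Type := RingQuot (Yangian.Rel N)

namespace Yangian

noncomputable instance (N : ℕ) : Ring (Yangian N) := inferInstanceAs (Ring (RingQuot (Rel N)))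

noncomputable instance (N : ℕ) : Algebra ℂ (Yangian N) :=
  inferInstanceAs (Algebra ℂ (RingQuot (Rel N)))

/-- The projection from the free algebra. -/
noncomputable def mk (N : ℕ) : FreeAlgebra ℂ (Fin N × Fin N × ℕ) →ₐ[ℂ] Yangian N :=
  RingQuot.mkAlgHom ℂ (Rel N)

/-- The matrix of the generating series `T_{ij}(u)` in `u⁻¹`. -/
noncomputable def T (N : ℕ) : Matrix (Fin N) (Fin N) (PowerSeries (Yangian N)) :=
  Matrix.of fun i j => PowerSeries.mk fun s => mk N (freeGen N i j s)

theorem isRTT_T (N : ℕ) : IsRTT (T N) := by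
  refine ⟨fun i j => ?_, fun i j k l r s => ?_⟩
  · simp only [T, Matrix.of_apply, PowerSeries.coeff_mk, freeGen]
    split_ifs <;> simp
  · have := RingQuot.mkAlgHom_rel ℂ (Rel.rtt i j k l r s)
    simp only [T, Matrix.of_apply, PowerSeries.coeff_mk]
    change mk N _ = mk N _ at this
    simpa only [map_sub, map_mul] using this

variable {N : ℕ} {A : Type*} [Ring A] [Algebra ℂ A]

/-- The map from the free algebra sending `T_{ij}^{(s)}` to the coefficients of `S`. -/
noncomputable def preLift (S : Matrix (Fin N) (Fin N) (PowerSeries A)) :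
    FreeAlgebra ℂ (Fin N × Fin N × ℕ) →ₐ[ℂ] A :=
  FreeAlgebra.lift ℂ fun p => PowerSeries.coeff (p.2.2 + 1) (S p.1 p.2.1)

theorem preLift_freeGen (S : Matrix (Fin N) (Fin N) (PowerSeries A)) (hS : IsRTT S)
    (i j : Fin N) (s : ℕ) : preLift S (freeGen N i j s) = PowerSeries.coeff s (S i j) := by
  rcases s with _ | s
  · rw [hS.coeff_zero, freeGen]; split_ifs <;> simp
  · simp [freeGen, preLift]

/-- The algebra homomorphism `T_{ij}(u) ↦ S_{ij}(u)`, if `S` satisfies the relations. -/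
noncomputable def lift (S : Matrix (Fin N) (Fin N) (PowerSeries A)) (hS : IsRTT S) :
    Yangian N →ₐ[ℂ] A :=
  RingQuot.liftAlgHom ℂ ⟨preLift S, by
    rintro _ _ ⟨i, j, k, l, r, s⟩
    simp only [map_sub, map_mul, preLift_freeGen S hS]
    exact hS.comm i j k l r s⟩

theorem lift_T (S : Matrix (Fin N) (Fin N) (PowerSeries A)) (hS : IsRTT S) (i j : Fin N) (s : ℕ) :
    lift S hS (PowerSeries.coeff s (T N i j)) = PowerSeries.coeff s (S i j) := by
  simp only [T, Matrix.of_apply, PowerSeries.coeff_mk]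
  rw [← preLift_freeGen S hS]
  exact RingQuot.liftAlgHom_mkAlgHom_apply ℂ _ _ _

theorem mem_of_coeff_mem (B : Subalgebra ℂ (Yangian N))
    (h : ∀ i j s, PowerSeries.coeff s (T N i j) ∈ B) (y : Yangian N) : y ∈ B := by
  obtain ⟨x, rfl⟩ := RingQuot.mkAlgHom_surjective ℂ (Rel N) y
  change mk N x ∈ B
  induction x using FreeAlgebra.induction with
  | grade0 r => rw [AlgHom.commutes]; exact B.algebraMap_mem r
  | grade1 p =>
    have := h p.1 p.2.1 (p.2.2 + 1)
    simpa only [T, Matrix.of_apply, PowerSeries.coeff_mk, freeGen] using this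
  | mul a b ha hb => rw [map_mul]; exact B.mul_mem ha hb
  | add a b ha hb => rw [map_add]; exact B.add_mem ha hb

end Yangian

theorem IsRTT.map {N : ℕ} {A B : Type*} [Ring A] [Ring B] (f : A →+* B)
    {S : Matrix (Fin N) (Fin N) (PowerSeries A)} (hS : IsRTT S) :
    IsRTT (S.map (PowerSeries.map f)) := by
  refine ⟨fun i j => ?_, fun i j k l r s => ?_⟩
  · rw [Matrix.map_apply, PowerSeries.coeff_map, hS.coeff_zero]; split_ifs <;> simp
  · simpa only [map_sub, map_mul, Matrix.map_apply, PowerSeries.coeff_map] using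
      congrArg f (hS.comm i j k l r s)

namespace Yangian

attribute [local instance] LieRing.ofAssociativeRing

/-- The coproduct `Δ : T_{ij}(u) ↦ ∑ k, T_{kj}(u) ⊗ T_{ik}(u)`; the matrix product below has the entries
`∑ k, (1 ⊗ T_{ik}(u)) (T_{kj}(u) ⊗ 1)`. -/
noncomputable def comul (N : ℕ) : Yangian N →ₐ[ℂ] Yangian N ⊗[ℂ] Yangian N :=
  lift (((T N).map (PowerSeries.map (Algebra.TensorProduct.includeRight :
      Yangian N →ₐ[ℂ] Yangian N ⊗[ℂ] Yangian N).toRingHom))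
    * ((T N).map (PowerSeries.map (Algebra.TensorProduct.includeLeft :
      Yangian N →ₐ[ℂ] Yangian N ⊗[ℂ] Yangian N).toRingHom)))
    (((isRTT_T N).map _).mul ((isRTT_T N).map _) fun i j k l r s => by
      simp [Commute, SemiconjBy])

theorem comul_T (N : ℕ) (i j : Fin N) (s : ℕ) :
    comul N (PowerSeries.coeff s (T N i j))
      = ∑ k, ∑ p ∈ Finset.HasAntidiagonal.antidiagonal s,
        PowerSeries.coeff p.1 (T N k j) ⊗ₜ[ℂ] PowerSeries.coeff p.2 (T N i k) := by
  rw [comul, lift_T, Matrix.mul_apply, map_sum]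
  refine Finset.sum_congr rfl fun k _ => ?_
  rw [PowerSeries.coeff_mul, ← Finset.Nat.sum_antidiagonal_swap]
  simp

/-- The counit `T_{ij}(u) ↦ δ_{ij}`. -/
noncomputable def counit (N : ℕ) : Yangian N →ₐ[ℂ] ℂ := lift 1 IsRTT.one

/-- `ρ_b : T_{ij}(u) ↦ T_{ij}(u - b)`. -/
noncomputable def translate (N : ℕ) (b : ℂ) : Yangian N →ₐ[ℂ] Yangian N :=
  lift ((T N).map (IsRTT.shift b)) (IsRTT.isRTT_shift b (isRTT_T N))

/-- The universal enveloping algebra `U(gl_N)`. -/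
abbrev UGL (N : ℕ) : Type := UniversalEnvelopingAlgebra ℂ (Matrix (Fin N) (Fin N) ℂ)

/-- The generator `e_{ij}` of `U(gl_N)`. -/
noncomputable def glGen (N : ℕ) (i j : Fin N) : UGL N :=
  UniversalEnvelopingAlgebra.ι ℂ (Matrix.single i j (1 : ℂ))

theorem glGen_comm (N : ℕ) (i j k l : Fin N) :
    glGen N i j * glGen N k l - glGen N k l * glGen N i j
      = (if j = k then glGen N i l else 0) - (if l = i then glGen N k j else 0) := by
  have : glGen N i j * glGen N k l - glGen N k l * glGen N i j
      = UniversalEnvelopingAlgebra.ι ℂ ⁅Matrix.single i j (1 : ℂ), Matrix.single k l (1 : ℂ)⁆ := by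
    rw [LieHom.map_lie]; rfl
  rw [this, Ring.lie_def, map_sub]
  congr 1
  · split_ifs with h
    · subst h; simp [glGen]
    · simp [Matrix.single_mul_single_of_ne, h]
  · split_ifs with h
    · subst h; simp [glGen]
    · simp [Matrix.single_mul_single_of_ne, h]

theorem isRTT_eval (N : ℕ) : IsRTT (Matrix.of fun i j : Fin N =>
    (if i = j then 1 else 0) + PowerSeries.X * PowerSeries.C (glGen N j i)) := by
  simpa only [ite_self, sub_zero] using
    IsRTT.linear (glGen N) 0 (glGen_comm N) fun _ _ => Commute.zero_left _

/-- The evaluation homomorphism `Y(gl_N) → U(gl_N)`: `T_{ij}^{(1)} ↦ e_{ji}` and `T_{ij}^{(s)} ↦ 0` for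
`s > 1`. -/
noncomputable def eval (N : ℕ) : Yangian N →ₐ[ℂ] UGL N :=
  lift (Matrix.of fun i j => (if i = j then 1 else 0)
    + PowerSeries.X * PowerSeries.C (glGen N j i)) (isRTT_eval N)

theorem eval_T_one (N : ℕ) (i j : Fin N) :
    eval N (PowerSeries.coeff 1 (T N i j)) = glGen N j i := by
  rw [eval, lift_T, Matrix.of_apply, map_add, PowerSeries.coeff_succ_X_mul (n := 0)]
  split_ifs <;> simp [PowerSeries.coeff_one]

theorem eval_T_ge (N : ℕ) (i j : Fin N) (s : ℕ) :
    eval N (PowerSeries.coeff (s + 2) (T N i j)) = 0 := by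
  rw [eval, lift_T, Matrix.of_apply, map_add, PowerSeries.coeff_succ_X_mul]
  split_ifs <;> simp [PowerSeries.coeff_one]

/-- The vector representation `ℂ^N` of `gl_N`. -/
noncomputable def vecRep (N : ℕ) : UGL N →ₐ[ℂ] Module.End ℂ (Fin N → ℂ) :=
  UniversalEnvelopingAlgebra.lift ℂ
    (AlgHom.toLieHom (Matrix.toLinAlgEquiv' : Matrix (Fin N) (Fin N) ℂ ≃ₐ[ℂ] _).toAlgHom)

theorem vecRep_glGen (N : ℕ) (i j k : Fin N) :
    vecRep N (glGen N i j) (Pi.single k 1) = if j = k then Pi.single i 1 else 0 := by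
  rw [vecRep, glGen, UniversalEnvelopingAlgebra.lift_ι_apply]
  change Matrix.toLin' (Matrix.single i j (1 : ℂ)) (Pi.single k 1) = _
  rw [Matrix.toLin'_apply, Matrix.mulVec_single_one]
  ext a
  simp only [Matrix.col_apply, Matrix.single_apply]
  split_ifs <;> simp_all

/-- The tensor product of two `Y(gl_N)`-modules, through the coproduct. -/
noncomputable def tensorRep {N : ℕ} {M M' : Type*} [AddCommGroup M] [Module ℂ M]
    [AddCommGroup M'] [Module ℂ M'] (ρ : Yangian N →ₐ[ℂ] Module.End ℂ M)
    (ρ' : Yangian N →ₐ[ℂ] Module.End ℂ M') : Yangian N →ₐ[ℂ] Module.End ℂ (M ⊗[ℂ] M') :=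
  (Module.endTensorEndAlgHom (R := ℂ) (S := ℂ) (A := ℂ)).comp
    ((Algebra.TensorProduct.map ρ ρ').comp (comul N))

/-- The evaluation module `ℂ^N(b)`: the vector representation pulled back by the evaluation
homomorphism composed with `ρ_b`. -/
noncomputable def evalRep (N : ℕ) (b : ℂ) : Yangian N →ₐ[ℂ] Module.End ℂ (Fin N → ℂ) :=
  (vecRep N).comp ((eval N).comp (translate N b))

/-- The trivial module `ℂ` (the empty tensor product), through the counit. -/
noncomputable def trivRep (N : ℕ) : Yangian N →ₐ[ℂ] Module.End ℂ ℂ :=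
  (Algebra.ofId ℂ (Module.End ℂ ℂ)).comp (counit N)

end Yangian

/-- `V = (ℂ^N)^{⊗ n}`. -/
abbrev TPow (N n : ℕ) : Type := ⨂[ℂ] _ : Fin n, (Fin N → ℂ)

/-- `(ℂ^N)^{⊗ n} ⊗ ℂ^N ≃ (ℂ^N)^{⊗ (n + 1)}`. -/
noncomputable def TPow.snocEquiv (N n : ℕ) : TPow N n ⊗[ℂ] (Fin N → ℂ) ≃ₗ[ℂ] TPow N (n + 1) :=
  (TensorProduct.congr (LinearEquiv.refl ℂ _)
    (PiTensorProduct.subsingletonEquiv (R := ℂ) (s := fun _ : Fin 1 => (Fin N → ℂ)) 0).symm).trans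
    (TensorPower.mulEquiv (R := ℂ) (M := Fin N → ℂ) (n := n) (m := 1))

theorem TPow.snocEquiv_tprod (N n : ℕ) (v : Fin n → Fin N → ℂ) (w : Fin N → ℂ) :
    TPow.snocEquiv N n (PiTensorProduct.tprod ℂ v ⊗ₜ[ℂ] w)
      = PiTensorProduct.tprod ℂ (Fin.snoc (α := fun _ => Fin N → ℂ) v w) := by
  simp only [TPow.snocEquiv, LinearEquiv.trans_apply, TensorProduct.congr_tmul,
    LinearEquiv.refl_apply, PiTensorProduct.subsingletonEquiv_symm_apply', TensorPower.mulEquiv,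
    PiTensorProduct.tmulEquiv_apply, PiTensorProduct.reindex_tprod]
  congr 1
  ext a : 1
  refine Fin.lastCases ?_ (fun a => ?_) a
  · rw [Fin.snoc_last, finSumFinEquiv_symm_last]; rfl
  · rw [Fin.snoc_castSucc, Fin.castSucc, finSumFinEquiv_symm_apply_castAdd]; rfl

/-- The `Y(gl_N)`-module `V(b) = ℂ^N(b_1) ⊗ ⋯ ⊗ ℂ^N(b_n)`, the tensor product of evaluation modules,
on the space `(ℂ^N)^{⊗ n}`. -/
noncomputable def Yangian.evalTensorRep (N : ℕ) :
    (n : ℕ) → (Fin n → ℂ) → (Yangian N →ₐ[ℂ] Module.End ℂ (TPow N n))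
  | 0, _ => ((PiTensorProduct.isEmptyEquiv (R := ℂ) (s := fun _ : Fin 0 => (Fin N → ℂ))
      (Fin 0)).symm.conjAlgEquiv ℂ).toAlgHom.comp (Yangian.trivRep N)
  | n + 1, b => ((TPow.snocEquiv N n).conjAlgEquiv ℂ).toAlgHom.comp
      (Yangian.tensorRep (Yangian.evalTensorRep N n fun a => b a.castSucc)
        (Yangian.evalRep N (b (Fin.last n))))

/-! ### The space `𝒱 = V ⊗ ℂ[z_1, …, z_n]` -/

/-- `ℂ[z_1, …, z_n]`. -/
abbrev Pol (n : ℕ) : Type := MvPolynomial (Fin n) ℂ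

/-- `𝒱`, the polynomials in `z_1, …, z_n` with coefficients in `V`. -/
def PolTPow (N n : ℕ) : Type := Pol n ⊗[ℂ] TPow N n

namespace PolTPow

noncomputable instance (N n : ℕ) : AddCommGroup (PolTPow N n) :=
  inferInstanceAs (AddCommGroup (Pol n ⊗[ℂ] TPow N n))

noncomputable instance (N n : ℕ) : Module (Pol n) (PolTPow N n) :=
  inferInstanceAs (Module (Pol n) (Pol n ⊗[ℂ] TPow N n))

noncomputable instance (N n : ℕ) : Module ℂ (PolTPow N n) :=
  inferInstanceAs (Module ℂ (Pol n ⊗[ℂ] TPow N n))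

instance (N n : ℕ) : IsScalarTower ℂ (Pol n) (PolTPow N n) :=
  inferInstanceAs (IsScalarTower ℂ (Pol n) (Pol n ⊗[ℂ] TPow N n))

instance (N n : ℕ) : Module.IsTorsionFree (Pol n) (PolTPow N n) :=
  inferInstanceAs (Module.IsTorsionFree (Pol n) (Pol n ⊗[ℂ] TPow N n))

/-- The identity map from the tensor product. -/
noncomputable def ofTensor (N n : ℕ) : Pol n ⊗[ℂ] TPow N n ≃ₗ[ℂ] PolTPow N n :=
  LinearEquiv.refl ℂ (Pol n ⊗[ℂ] TPow N n)

/-- The element `p v` of `𝒱` for a polynomial `p` and `v ∈ V`. -/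
noncomputable def tmul {N n : ℕ} (p : Pol n) (v : TPow N n) : PolTPow N n :=
  ofTensor N n (p ⊗ₜ[ℂ] v)

/-- Operators on the tensor product as operators on `𝒱`. -/
noncomputable def ofEnd (N n : ℕ) :
    Module.End ℂ (Pol n ⊗[ℂ] TPow N n) ≃ₐ[ℂ] Module.End ℂ (PolTPow N n) :=
  (ofTensor N n).conjAlgEquiv ℂ

theorem ofEnd_tmul {N n : ℕ} (F : Module.End ℂ (Pol n ⊗[ℂ] TPow N n)) (p : Pol n) (v : TPow N n) :
    ofEnd N n F (tmul p v) = ofTensor N n (F (p ⊗ₜ[ℂ] v)) := rfl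

theorem smul_tmul {N n : ℕ} (q p : Pol n) (v : TPow N n) :
    q • (tmul p v : PolTPow N n) = tmul (q * p) v := rfl

/-- `p ⊗ (v_1 ⊗ ⋯ ⊗ v_n)` -/
noncomputable abbrev pure {N n : ℕ} (p : Pol n) (v : Fin n → Fin N → ℂ) : PolTPow N n :=
  tmul p (PiTensorProduct.tprod ℂ v)

theorem induction_on {N n : ℕ} {C : PolTPow N n → Prop} (f : PolTPow N n)
    (h : ∀ p v, C (pure p v)) (hadd : ∀ f g, C f → C g → C (f + g)) : C f := by
  have h1 : ∀ (p : Pol n) (v : TPow N n), C (tmul p v) := fun p v => by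
    induction v using PiTensorProduct.induction_on with
    | smul_tprod r v =>
      have : (tmul p (r • PiTensorProduct.tprod ℂ v) : PolTPow N n) = pure (r • p) v :=
        congrArg (ofTensor N n) ((TensorProduct.smul_tmul r p _).symm)
      rw [this]; exact h _ _
    | add x y hx hy =>
      have : (tmul p (x + y) : PolTPow N n) = tmul p x + tmul p y :=
        congrArg (ofTensor N n) (TensorProduct.tmul_add p x y)
      rw [this]; exact hadd _ _ hx hy
  have h2 : ∀ t : Pol n ⊗[ℂ] TPow N n, C (ofTensor N n t) := fun t => by
    induction t using TensorProduct.induction_on with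
    | zero =>
      have := h1 0 0
      rwa [tmul, TensorProduct.tmul_zero] at this
    | tmul p v => exact h1 p v
    | add x y hx hy => rw [map_add]; exact hadd _ _ hx hy
  exact h2 f

theorem end_ext {N n : ℕ} {F G : Module.End ℂ (PolTPow N n)}
    (h : ∀ p v, F (pure p v) = G (pure p v)) : F = G :=
  LinearMap.ext fun f => by
    induction f using induction_on with
    | h p v => exact h p v
    | hadd f g hf hg => rw [map_add, map_add, hf, hg]

end PolTPow

theorem X_sub_X_dvd {n : ℕ} (i j : Fin n) (p : Pol n) :
    (MvPolynomial.X i - MvPolynomial.X j : Pol n) ∣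
      p - MvPolynomial.rename (Equiv.swap i j) p := by
  rw [← Ideal.mem_span_singleton, ← Ideal.Quotient.eq]
  set I : Ideal (Pol n) := Ideal.span {MvPolynomial.X i - MvPolynomial.X j}
  have hX : Ideal.Quotient.mkₐ ℂ I (MvPolynomial.X i) = Ideal.Quotient.mkₐ ℂ I (MvPolynomial.X j) :=
    Ideal.Quotient.eq.2 (Ideal.mem_span_singleton_self _)
  have : Ideal.Quotient.mkₐ ℂ I
      = (Ideal.Quotient.mkₐ ℂ I).comp (MvPolynomial.rename (Equiv.swap i j)) := by
    refine MvPolynomial.algHom_ext fun a => ?_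
    rw [AlgHom.comp_apply, MvPolynomial.rename_X]
    by_cases hi : a = i
    · subst hi; rw [Equiv.swap_apply_left, hX]
    · by_cases hj : a = j
      · subst hj; rw [Equiv.swap_apply_right, hX]
      · rw [Equiv.swap_apply_of_ne_of_ne hi hj]
  exact congrArg (fun f => f p) this

theorem X_sub_X_ne_zero {n : ℕ} {i j : Fin n} (h : i ≠ j) :
    (MvPolynomial.X i - MvPolynomial.X j : Pol n) ≠ 0 := by
  rw [sub_ne_zero]
  exact fun e => h (MvPolynomial.X_injective e)

/-- The divided difference `p ↦ (p - p(…, z_j, …, z_i, …)) / (z_i - z_j)`. -/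
noncomputable def dividedDiff {n : ℕ} {i j : Fin n} (h : i ≠ j) : Pol n →ₗ[ℂ] Pol n where
  toFun p := (X_sub_X_dvd i j p).choose
  map_add' p q := by
    refine mul_left_cancel₀ (X_sub_X_ne_zero h) ?_
    rw [mul_add, ← (X_sub_X_dvd i j _).choose_spec, ← (X_sub_X_dvd i j _).choose_spec,
      ← (X_sub_X_dvd i j _).choose_spec, map_add]
    ring
  map_smul' c p := by
    refine mul_left_cancel₀ (X_sub_X_ne_zero h) ?_
    rw [RingHom.id_apply, mul_smul_comm, ← (X_sub_X_dvd i j _).choose_spec,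
      ← (X_sub_X_dvd i j _).choose_spec, map_smul, smul_sub]

theorem mul_dividedDiff {n : ℕ} {i j : Fin n} (h : i ≠ j) (p : Pol n) :
    (MvPolynomial.X i - MvPolynomial.X j) * dividedDiff h p
      = p - MvPolynomial.rename (Equiv.swap i j) p :=
  (X_sub_X_dvd i j p).choose_spec.symm

namespace PolTPow

variable (N n : ℕ)

/-- Multiplication by a polynomial. -/
noncomputable def polOp : Pol n →ₐ[ℂ] Module.End ℂ (PolTPow N n) :=
  Algebra.lsmul ℂ ℂ (PolTPow N n)

/-- `f ↦ f(…, z_j, …, z_i, …)`, the exchange of the variables `z_i` and `z_j`. -/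
noncomputable def swapVars (i j : Fin n) : Module.End ℂ (PolTPow N n) :=
  ofEnd N n (LinearMap.rTensor (TPow N n) (MvPolynomial.rename (R := ℂ) (Equiv.swap i j)).toLinearMap)

/-- `P^{(i,j)}`, the permutation of the `i`-th and `j`-th factors of `V`. -/
noncomputable def flip (i j : Fin n) : Module.End ℂ (PolTPow N n) :=
  ofEnd N n (LinearMap.lTensor (Pol n)
    (PiTensorProduct.reindex ℂ (fun _ : Fin n => (Fin N → ℂ)) (Equiv.swap i j)).toLinearMap)

/-- The divided difference on `𝒱`. -/
noncomputable def divDiffOp {i j : Fin n} (h : i ≠ j) : Module.End ℂ (PolTPow N n) :=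
  ofEnd N n (LinearMap.rTensor (TPow N n) (dividedDiff h))

/-- With `f'` denoting `f` with `z_i` and `z_j` exchanged, the operator
`f ↦ ((z_i - z_j) P^{(i,j)} - 1) / (z_i - z_j) f' + 1 / (z_i - z_j) f`
`= P^{(i,j)} f' + (f - f') / (z_i - z_j)`; see `smul_sAct`. For `j = i + 1` it is the action of the
elementary transposition `s_i` of `S_n`. -/
noncomputable def sAct {i j : Fin n} (h : i ≠ j) : Module.End ℂ (PolTPow N n) :=
  flip N n i j * swapVars N n i j + divDiffOp N n h

theorem smul_sAct {i j : Fin n} (h : i ≠ j) (f : PolTPow N n) :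
    (MvPolynomial.X i - MvPolynomial.X j : Pol n) • sAct N n h f
      = ((MvPolynomial.X i - MvPolynomial.X j : Pol n) • flip N n i j (swapVars N n i j f)
          - swapVars N n i j f) + f := by
  have : (MvPolynomial.X i - MvPolynomial.X j : Pol n) • divDiffOp N n h f
      = f - swapVars N n i j f := by
    induction f using induction_on with
    | h p v =>
      rw [divDiffOp, ofEnd_tmul, LinearMap.rTensor_tmul]
      change tmul ((MvPolynomial.X i - MvPolynomial.X j) * dividedDiff h p) _ = _
      rw [mul_dividedDiff]
      exact congrArg (ofTensor N n) (TensorProduct.sub_tmul _ _ _)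
    | hadd f g hf hg => rw [map_add, map_add, smul_add, hf, hg]; abel
  rw [sAct, LinearMap.add_apply, smul_add, this, Module.End.mul_apply]
  abel

theorem smul_injective {p : Pol n} (hp : p ≠ 0) {f g : PolTPow N n} (h : p • f = p • g) :
    f = g :=
  smul_right_injective _ hp h

/-- The action of an operator on the `a`-th factor of `V`. -/
noncomputable def slotV (a : Fin n) : Module.End ℂ (Fin N → ℂ) →ₐ[ℂ] Module.End ℂ (TPow N n) :=
  AlgHom.ofLinearMap
    ((PiTensorProduct.mapMultilinear ℂ (fun _ : Fin n => Fin N → ℂ)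
      (fun _ => Fin N → ℂ)).toLinearMap (fun _ => LinearMap.id) a)
    (by
      rw [MultilinearMap.toLinearMap_apply, Module.End.one_eq_id, Function.update_eq_self]
      exact PiTensorProduct.map_id)
    (fun x y => by
      simp only [MultilinearMap.toLinearMap_apply, PiTensorProduct.mapMultilinear_apply]
      rw [Module.End.mul_eq_comp (PiTensorProduct.map _), ← PiTensorProduct.map_comp]
      congr 1
      funext c
      by_cases h : c = a
      · subst h; simp [Module.End.mul_eq_comp]
      · simp [h])

theorem slotV_tprod (a : Fin n) (g : Module.End ℂ (Fin N → ℂ)) (v : Fin n → Fin N → ℂ) :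
    slotV N n a g (PiTensorProduct.tprod ℂ v)
      = PiTensorProduct.tprod ℂ (Function.update v a (g (v a))) := by
  simp only [slotV, AlgHom.ofLinearMap_apply, MultilinearMap.toLinearMap_apply,
    PiTensorProduct.mapMultilinear_apply, PiTensorProduct.map_tprod]
  congr 1
  funext c
  by_cases h : c = a
  · subst h; simp
  · simp [h]

/-- The action of a matrix on the `a`-th factor of `V`, extended to `𝒱`. -/
noncomputable def slot (a : Fin n) : Matrix (Fin N) (Fin N) ℂ →ₐ[ℂ] Module.End ℂ (PolTPow N n) :=
  ((ofEnd N n).toAlgHom.comp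
    ((Module.End.lTensorAlgHom ℂ (TPow N n) (Pol n)).comp (slotV N n a))).comp
    (Matrix.toLinAlgEquiv' : Matrix (Fin N) (Fin N) ℂ ≃ₐ[ℂ] _).toAlgHom

theorem slot_pure (a : Fin n) (g : Matrix (Fin N) (Fin N) ℂ) (p : Pol n)
    (v : Fin n → Fin N → ℂ) :
    slot N n a g (pure p v) = pure p (Function.update v a (g.mulVec (v a))) := by
  rw [← Matrix.toLin'_apply]
  change tmul p (slotV N n a (Matrix.toLin' g) (PiTensorProduct.tprod ℂ v)) = _
  rw [slotV_tprod]

theorem pure_smul (a : Fin n) (p : Pol n) (v : Fin n → Fin N → ℂ) (c : ℂ) (w : Fin N → ℂ) :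
    (pure p (Function.update v a (c • w)) : PolTPow N n) = c • pure p (Function.update v a w) := by
  rw [pure, MultilinearMap.map_update_smul]
  exact congrArg (ofTensor N n) (TensorProduct.tmul_smul _ _ _)

/-- `P^{(0,a)}`, the permutation of the factors number `0` and `a` of `ℂ^N ⊗ V`, as an `N × N` matrix with
operator entries with respect to the factor number `0`: it sends `v_j ⊗ w` to
`∑ i, v_i ⊗ (P^{(0,a)})_{ij} w`, so its `(i, j)` entry is `e_{ji}` on the `a`-th factor
(`auxFlip_apply`). -/
noncomputable def auxFlip (a : Fin n) :
    Matrix (Fin N) (Fin N) (Module.End ℂ (PolTPow N n)) :=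
  Matrix.of fun i j => slot N n a (Matrix.single j i 1)

theorem auxFlip_apply (a : Fin n) (j : Fin N) (p : Pol n) (v : Fin n → Fin N → ℂ) (i : Fin N) :
    auxFlip N n a i j (pure p v) = v a i • pure p (Function.update v a (Pi.single j 1)) := by
  rw [auxFlip, Matrix.of_apply, slot_pure, ← pure_smul]
  congr 3
  ext k
  simp only [Matrix.mulVec, dotProduct, Matrix.single_apply, Pi.smul_apply, Pi.single_apply]
  by_cases h : k = j
  · subst h; simp
  · simp [h, Ne.symm h]

/-- `u⁻¹ (u - z_a + P^{(0,a)}) = 1 + u⁻¹ (P^{(0,a)} - z_a)`. -/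
noncomputable def factor (a : Fin n) :
    Matrix (Fin N) (Fin N) (PowerSeries (Module.End ℂ (PolTPow N n))) :=
  1 + Matrix.of fun i j => PowerSeries.X * PowerSeries.C
    (auxFlip N n a i j - if i = j then polOp N n (MvPolynomial.X a) else 0)

/-- `u ^ (-n) L(u)` with `L(u) = (u - z_n + P^{(0,n)}) ⋯ (u - z_1 + P^{(0,1)})`, as an `N × N` matrix of
series in `u⁻¹`. -/
noncomputable def lMatrix : Matrix (Fin N) (Fin N) (PowerSeries (Module.End ℂ (PolTPow N n))) :=
  (List.ofFn (factor N n)).reverse.prod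

/-- `u ^ n ∏_a (u - z_a)⁻¹ = ∏_a ∑_m z_a ^ m u ^ (-m)`. -/
noncomputable def invSeries : PowerSeries (Pol n) :=
  ∏ a : Fin n, PowerSeries.mk fun m => (MvPolynomial.X a : Pol n) ^ m

theorem invSeries_mul :
    invSeries n * ∏ a : Fin n, (1 - PowerSeries.X * PowerSeries.C (MvPolynomial.X a : Pol n))
      = 1 := by
  rw [invSeries, ← Finset.prod_mul_distrib]
  refine Finset.prod_eq_one fun a _ => ?_
  ext m : 1
  rw [mul_sub, mul_one, ← mul_assoc, map_sub]
  rcases m with _ | m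
  · simp
  · rw [PowerSeries.coeff_mul_C, PowerSeries.coeff_succ_mul_X]
    simp [PowerSeries.coeff_one, pow_succ]

/-- `L_{ij}(u) ∏_a (u - z_a)⁻¹`, as a series in `u⁻¹`. -/
noncomputable def tMatrix : Matrix (Fin N) (Fin N) (PowerSeries (Module.End ℂ (PolTPow N n))) :=
  Matrix.of fun i j => PowerSeries.map (polOp N n).toRingHom (invSeries n) * lMatrix N n i j

theorem polOp_pure (q p : Pol n) (v : Fin n → Fin N → ℂ) :
    polOp N n q (pure p v) = pure (q * p) v := rfl

theorem polOp_comm_slot (a : Fin n) (p : Pol n) (g : Matrix (Fin N) (Fin N) ℂ) :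
    Commute (polOp N n p) (slot N n a g) :=
  end_ext fun q v => by
    simp only [Module.End.mul_apply, slot_pure, polOp_pure]

theorem slot_comm_slot {a c : Fin n} (h : a ≠ c) (g g' : Matrix (Fin N) (Fin N) ℂ) :
    Commute (slot N n a g) (slot N n c g') :=
  end_ext fun q v => by
    simp only [Module.End.mul_apply, slot_pure]
    rw [Function.update_of_ne h, Function.update_of_ne h.symm, Function.update_comm h]

variable {N n}

theorem mul_sub_comm' {R : Type*} [Ring R] (x y z : R) (h : x * y = y * x) (h' : x * z = z * x) :
    x * (y - z) = (y - z) * x := by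
  rw [mul_sub, sub_mul, h, h']

/-- Elements of `A` as scalar matrices. -/
noncomputable abbrev kap {A : Type*} [Ring A] (N : ℕ) : A →+* Matrix (Fin N) (Fin N) (PowerSeries A) :=
  (Matrix.scalar (Fin N)).comp PowerSeries.C

theorem kap_mul_apply {A : Type*} [Ring A] (x : A) (M : Matrix (Fin N) (Fin N) (PowerSeries A))
    (i j : Fin N) (r : ℕ) :
    PowerSeries.coeff r ((kap N x * M) i j) = x * PowerSeries.coeff r (M i j) := by
  simp [kap]

theorem mul_kap_apply {A : Type*} [Ring A] (x : A) (M : Matrix (Fin N) (Fin N) (PowerSeries A))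
    (i j : Fin N) (r : ℕ) :
    PowerSeries.coeff r ((M * kap N x) i j) = PowerSeries.coeff r (M i j) * x := by
  simp [kap]

theorem kap_commute_iff {A : Type*} [Ring A] (x : A)
    (M : Matrix (Fin N) (Fin N) (PowerSeries A)) :
    Commute (kap N x) M ↔ ∀ i j r, Commute x (PowerSeries.coeff r (M i j)) := by
  constructor
  · intro h i j r
    have := congrArg (fun M : Matrix _ _ _ => PowerSeries.coeff r (M i j)) h.eq
    beta_reduce at this
    rwa [kap_mul_apply, mul_kap_apply] at this
  · intro h
    refine Matrix.ext fun i j => PowerSeries.ext fun r => ?_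
    rw [kap_mul_apply, mul_kap_apply]; exact h i j r

theorem coeff_factor_zero (a : Fin n) (i j : Fin N) :
    PowerSeries.coeff 0 (factor N n a i j) = if i = j then 1 else 0 := by
  rw [factor, Matrix.add_apply, map_add, Matrix.of_apply, PowerSeries.coeff_zero_X_mul,
    Matrix.one_apply]
  split_ifs <;> simp

theorem coeff_factor_one (a : Fin n) (i j : Fin N) :
    PowerSeries.coeff 1 (factor N n a i j)
      = auxFlip N n a i j - if i = j then polOp N n (MvPolynomial.X a) else 0 := by
  rw [factor, Matrix.add_apply, map_add, Matrix.of_apply, PowerSeries.coeff_succ_X_mul (n := 0),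
    Matrix.one_apply, PowerSeries.coeff_zero_C]
  split_ifs <;> simp [PowerSeries.coeff_one]

theorem coeff_factor_ge (a : Fin n) (i j : Fin N) (r : ℕ) :
    PowerSeries.coeff (r + 2) (factor N n a i j) = 0 := by
  rw [factor, Matrix.add_apply, map_add, Matrix.of_apply, PowerSeries.coeff_succ_X_mul,
    Matrix.one_apply, PowerSeries.coeff_C]
  split_ifs <;> simp_all [PowerSeries.coeff_one]

theorem kap_commute_factor (x : Module.End ℂ (PolTPow N n)) (a : Fin n)
    (h1 : ∀ g, Commute x (slot N n a g)) (h2 : Commute x (polOp N n (MvPolynomial.X a))) :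
    Commute (kap N x) (factor N n a) := by
  rw [kap_commute_iff]
  rintro i j (_ | _ | r)
  · rw [coeff_factor_zero]; split_ifs
    · exact Commute.one_right _
    · exact Commute.zero_right _
  · rw [coeff_factor_one]
    have h3 : Commute x (if i = j then polOp N n (MvPolynomial.X a) else 0) := by
      split_ifs
      · exact h2
      · exact Commute.zero_right _
    have h4 : Commute x (auxFlip N n a i j) := h1 _
    generalize auxFlip N n a i j = y at h4 ⊢
    change x * (y - _) = (y - _) * x
    exact mul_sub_comm' x y _ h4 h3
  · rw [coeff_factor_ge]; exact Commute.zero_right _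

theorem isRTT_factor (a : Fin n) : IsRTT (factor N n a) := by
  have h := IsRTT.linear (fun i j : Fin N => slot N n a (Matrix.single i j 1))
    (polOp N n (MvPolynomial.X a)) (fun i j k l => by
      rw [← map_mul, ← map_mul]
      congr 1
      · split_ifs with h
        · subst h; simp
        · simp [Matrix.single_mul_single_of_ne, h]
      · split_ifs with h
        · subst h; simp
        · simp [Matrix.single_mul_single_of_ne, h]) (fun i j => polOp_comm_slot N n a _ _)
  convert h using 1
  refine Matrix.ext fun i j => ?_
  rw [factor, Matrix.add_apply, Matrix.one_apply]
  rfl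

theorem isRTT_list (l : List (Fin n)) (hl : l.Nodup) : IsRTT (l.map (factor N n)).prod := by
  induction l with
  | nil => exact IsRTT.one
  | cons a l ih =>
    rw [List.map_cons, List.prod_cons]
    refine (isRTT_factor a).mul (ih hl.of_cons) fun i j k l' r s => ?_
    have : Commute (kap N (PowerSeries.coeff r (factor N n a i j))) (l.map (factor N n)).prod := by
      refine Commute.list_prod_right _ _ fun M hM => ?_
      obtain ⟨c, hc, rfl⟩ := List.mem_map.1 hM
      have hac : a ≠ c := fun e => (List.nodup_cons.1 hl).1 (e ▸ hc)
      refine kap_commute_factor _ _ (fun g => ?_) ?_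
      · exact ((kap_commute_iff _ _).1 (kap_commute_factor (slot N n c g) a
          (fun g' => (slot_comm_slot N n hac.symm _ _)) (polOp_comm_slot N n c _ _).symm) i j r).symm
      · exact ((kap_commute_iff _ _).1 (kap_commute_factor (polOp N n (MvPolynomial.X c)) a
          (fun g' => polOp_comm_slot N n a _ _)
          (by rw [Commute, SemiconjBy, ← map_mul, mul_comm, map_mul])) i j r).symm
    exact (kap_commute_iff _ _).1 this k l' s

theorem lMatrix_eq : lMatrix N n = ((List.finRange n).reverse.map (factor N n)).prod := by
  rw [lMatrix, List.ofFn_eq_map, List.map_reverse]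

theorem isRTT_lMatrix : IsRTT (lMatrix N n) := by
  rw [lMatrix_eq]
  exact isRTT_list _ (List.nodup_reverse.2 (List.nodup_finRange n))

theorem kap_polOp_commute_lMatrix (p : Pol n) : Commute (kap N (polOp N n p)) (lMatrix N n) := by
  refine Commute.list_prod_right _ _ fun M hM => ?_
  rw [List.mem_reverse, List.mem_ofFn] at hM
  obtain ⟨c, rfl⟩ := hM
  exact kap_commute_factor _ _ (polOp_comm_slot N n c p)
    (by rw [Commute, SemiconjBy, ← map_mul, mul_comm, map_mul])

theorem coeff_invSeries_zero : PowerSeries.coeff 0 (invSeries n) = 1 := by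
  rw [PowerSeries.coeff_zero_eq_constantCoeff_apply, invSeries, map_prod]
  refine Finset.prod_eq_one fun a _ => ?_
  rw [← PowerSeries.coeff_zero_eq_constantCoeff_apply]; simp

theorem isRTT_tMatrix : IsRTT (tMatrix N n) := by
  refine isRTT_lMatrix.scalar_mul _ ?_ ?_ ?_
  · rw [PowerSeries.coeff_map, coeff_invSeries_zero, map_one]
  · intro r s
    rw [PowerSeries.coeff_map, PowerSeries.coeff_map, Commute, SemiconjBy, ← map_mul, mul_comm,
      map_mul]
  · intro k l r s
    rw [PowerSeries.coeff_map]
    exact (kap_commute_iff _ _).1 (kap_polOp_commute_lMatrix _) k l s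

theorem commute_tMatrix (x : Module.End ℂ (PolTPow N n))
    (h1 : ∀ r, Commute x (polOp N n (PowerSeries.coeff r (invSeries n))))
    (h2 : Commute (kap N x) (lMatrix N n)) (i j : Fin N) (r : ℕ) :
    Commute x (PowerSeries.coeff r (tMatrix N n i j)) := by
  rw [tMatrix, Matrix.of_apply, PowerSeries.coeff_mul]
  refine Commute.sum_right _ _ _ fun p _ => ?_
  refine Commute.mul_right ?_ ((kap_commute_iff _ _).1 h2 i j _)
  rw [PowerSeries.coeff_map]; exact h1 _

end PolTPow

theorem List.commute_reverse_prod_ofFn {M : Type*} [Monoid M] (x : M) :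
    ∀ {n : ℕ} (F : Fin n → M) (i j : Fin n), (i : ℕ) + 1 = j →
      (∀ c, c ≠ i → c ≠ j → Commute x (F c)) → Commute x (F j * F i) →
      Commute x (List.ofFn F).reverse.prod
  | 0, _, i, _, _, _, _ => i.elim0
  | n + 1, F, i, j, hij, h, hp => by
    have hne : i ≠ Fin.last n := fun e => by
      have := j.isLt
      rw [← hij, e] at this; simp at this
    obtain ⟨i, rfl⟩ := Fin.exists_castSucc_eq.2 hne
    rw [List.ofFn_succ', List.concat_eq_append, List.reverse_append, List.reverse_singleton, List.singleton_append, List.prod_cons]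
    by_cases hj : j = Fin.last n
    · subst hj
      rcases n with _ | n
      · exact i.elim0
      have hi : i = Fin.last n := by
        ext; simpa using hij
      subst hi
      rw [List.ofFn_succ', List.concat_eq_append, List.reverse_append, List.reverse_singleton, List.singleton_append, List.prod_cons, ← mul_assoc]
      refine hp.mul_right (Commute.list_prod_right _ _ fun y hy => ?_)
      rw [List.mem_reverse, List.mem_ofFn] at hy
      obtain ⟨c, rfl⟩ := hy
      refine h _ ?_ ?_
      · exact fun e => (Fin.castSucc_lt_last c).ne (Fin.castSucc_injective _ e)
      · exact (Fin.castSucc_lt_last _).ne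
    · obtain ⟨j, rfl⟩ := Fin.exists_castSucc_eq.2 hj
      refine (h _ hne.symm (Ne.symm hj)).mul_right ?_
      refine List.commute_reverse_prod_ofFn x _ i j (by simpa using hij) (fun c hi hj' => ?_) hp
      exact h _ (fun e => hi (Fin.castSucc_injective _ e)) fun e => hj' (Fin.castSucc_injective _ e)

theorem pair_aux {R : Type*} [Ring R] (x z w P Q₁ Q₂ : R)
    (xz : x * z = z * x) (xw : x * w = w * x) (xP : x * P = P * x)
    (x1 : x * Q₁ = Q₁ * x) (x2 : x * Q₂ = Q₂ * x)
    (zw : z * w = w * z) (zP : z * P = P * z) (wP : w * P = P * w)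
    (z1 : z * Q₁ = Q₁ * z) (z2 : z * Q₂ = Q₂ * z) (w1 : w * Q₁ = Q₁ * w) (w2 : w * Q₂ = Q₂ * w)
    (P1 : P * Q₁ = Q₂ * P) (P2 : P * Q₂ = Q₁ * P)
    (h12 : Q₁ * Q₂ - Q₂ * Q₁ = (Q₂ - Q₁) * P) :
    P * ((1 + x * (Q₁ - z)) * (1 + x * (Q₂ - w))) - (1 + x * (Q₂ - w)) * (1 + x * (Q₁ - z)) * P
      = (z - w) * ((1 + x * (Q₁ - z)) * (1 + x * (Q₂ - w))
        - (1 + x * (Q₂ - w)) * (1 + x * (Q₁ - z))) := by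
  have e1 : (1 + x * (Q₁ - z)) * (1 + x * (Q₂ - w)) - (1 + x * (Q₂ - w)) * (1 + x * (Q₁ - z))
      = x * x * ((Q₂ - Q₁) * P) := by
    rw [← h12]
    simp only [mul_add, add_mul, mul_sub, sub_mul, mul_one, one_mul]
    have a1 : x * Q₁ * (x * Q₂) = x * x * (Q₁ * Q₂) := by rw [mul_assoc, ← mul_assoc Q₁, ← x1]; simp only [mul_assoc]
    have a2 : x * Q₂ * (x * Q₁) = x * x * (Q₂ * Q₁) := by rw [mul_assoc, ← mul_assoc Q₂, ← x2]; simp only [mul_assoc]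
    have a3 : x * z * (x * Q₂) = x * Q₂ * (x * z) := by
      rw [mul_assoc, ← mul_assoc z, ← xz, mul_assoc x Q₂, ← mul_assoc Q₂, ← x2, mul_assoc x z,
        mul_assoc x Q₂, z2]
    have a4 : x * w * (x * Q₁) = x * Q₁ * (x * w) := by
      rw [mul_assoc, ← mul_assoc w, ← xw, mul_assoc x Q₁, ← mul_assoc Q₁, ← x1, mul_assoc x w,
        mul_assoc x Q₁, w1]
    have a5 : x * w * (x * z) = x * z * (x * w) := by
      rw [mul_assoc, ← mul_assoc w, ← xw, mul_assoc x z, ← mul_assoc z, ← xz, mul_assoc x w,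
        mul_assoc x z, zw]
    rw [a1, a2, a3, a4, a5]
    abel
  have e2 : P * ((1 + x * (Q₁ - z)) * (1 + x * (Q₂ - w)))
      = (1 + x * (Q₂ - z)) * (1 + x * (Q₁ - w)) * P := by
    have b1 : P * (1 + x * (Q₁ - z)) = (1 + x * (Q₂ - z)) * P := by
      rw [mul_add, add_mul, mul_one, one_mul, ← mul_assoc, ← xP, mul_assoc, mul_assoc, mul_sub,
        sub_mul, P1, zP]
    have b2 : P * (1 + x * (Q₂ - w)) = (1 + x * (Q₁ - w)) * P := by
      rw [mul_add, add_mul, mul_one, one_mul, ← mul_assoc, ← xP, mul_assoc, mul_assoc, mul_sub,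
        sub_mul, P2, wP]
    rw [← mul_assoc, b1, mul_assoc, b2, ← mul_assoc]
  have e3 : (1 + x * (Q₂ - z)) * (1 + x * (Q₁ - w)) - (1 + x * (Q₂ - w)) * (1 + x * (Q₁ - z))
      = x * x * ((z - w) * (Q₂ - Q₁)) := by
    have c : ∀ p q : R, x * p = p * x → x * p * (x * q) = x * x * (p * q) := fun p q hp => by
      rw [mul_assoc, ← mul_assoc p, ← hp]; simp only [mul_assoc]
    simp only [mul_add, add_mul, mul_sub, sub_mul, mul_one, one_mul, c _ _ xz, c _ _ xw, c _ _ x2, zw, z1, z2, w1, w2]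
    abel
  have e4 : (z - w) * (x * x) = x * x * (z - w) := by
    rw [← mul_assoc, sub_mul, ← xz, ← xw, ← mul_sub, mul_assoc, sub_mul, ← xz, ← xw, ← mul_sub,
      mul_assoc]
  rw [e1, e2, ← sub_mul, e3, ← mul_assoc (z - w), e4]
  simp only [mul_assoc]

namespace PolTPow

variable {N n : ℕ}

theorem flip_pure (i j : Fin n) (p : Pol n) (v : Fin n → Fin N → ℂ) :
    flip N n i j (pure p v) = pure p (fun a => v (Equiv.swap i j a)) := by
  rw [flip, ofEnd_tmul, LinearMap.lTensor_tmul, LinearEquiv.coe_coe, PiTensorProduct.reindex_tprod]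
  rfl

theorem swapVars_pure (i j : Fin n) (p : Pol n) (v : Fin n → Fin N → ℂ) :
    swapVars N n i j (pure p v) = pure (MvPolynomial.rename (Equiv.swap i j) p) v := rfl

theorem flip_flip (i j : Fin n) : flip N n i j * flip N n i j = 1 :=
  end_ext fun p v => by simp only [Module.End.mul_apply, flip_pure, Equiv.swap_apply_self]; rfl

theorem flip_swapVars (i j : Fin n) :
    flip N n i j * swapVars N n i j = swapVars N n i j * flip N n i j :=
  end_ext fun p v => by simp only [Module.End.mul_apply, flip_pure, swapVars_pure]

theorem flip_polOp (i j : Fin n) (q : Pol n) :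
    flip N n i j * polOp N n q = polOp N n q * flip N n i j :=
  end_ext fun p v => by simp only [Module.End.mul_apply, flip_pure, polOp_pure]

theorem swapVars_polOp (i j : Fin n) (q : Pol n) :
    swapVars N n i j * polOp N n q
      = polOp N n (MvPolynomial.rename (Equiv.swap i j) q) * swapVars N n i j :=
  end_ext fun p v => by simp only [Module.End.mul_apply, swapVars_pure, polOp_pure, map_mul]

theorem swapVars_slot (i j a : Fin n) (g : Matrix (Fin N) (Fin N) ℂ) :
    swapVars N n i j * slot N n a g = slot N n a g * swapVars N n i j :=
  end_ext fun p v => by simp only [Module.End.mul_apply, swapVars_pure, slot_pure]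

theorem flip_slot (i j a : Fin n) (g : Matrix (Fin N) (Fin N) ℂ) :
    flip N n i j * slot N n a g = slot N n (Equiv.swap i j a) g * flip N n i j :=
  end_ext fun p v => by
    simp only [Module.End.mul_apply, flip_pure, slot_pure, Equiv.swap_apply_self]
    congr 1
    funext c
    by_cases h : c = Equiv.swap i j a
    · subst h; simp
    · rw [Function.update_of_ne h, Function.update_of_ne]
      rintro rfl
      exact h (by simp)

theorem auxFlip_mul {i j : Fin n} (h : i ≠ j) :
    auxFlip N n i * auxFlip N n j
      = Matrix.of fun k l => auxFlip N n j k l * flip N n i j := by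
  refine Matrix.ext fun k l => end_ext fun p v => ?_
  rw [Matrix.mul_apply, LinearMap.sum_apply, Matrix.of_apply, Module.End.mul_apply, flip_pure,
    auxFlip_apply]
  simp only [Module.End.mul_apply, auxFlip_apply, map_smul, Function.update_of_ne h, smul_smul]
  have hf : Function.update (fun a => v (Equiv.swap i j a)) j (Pi.single l (1 : ℂ))
      = Function.update (Function.update v j (Pi.single l 1)) i (v j) := by
    funext c
    by_cases hj : c = j
    · subst hj; rw [Function.update_self, Function.update_of_ne h.symm, Function.update_self]
    · rw [Function.update_of_ne hj]
      by_cases hi : c = i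
      · subst hi; simp
      · rw [Function.update_of_ne hi, Function.update_of_ne hj,
          Equiv.swap_apply_of_ne_of_ne hi hj]
  rw [hf, Equiv.swap_apply_right]
  set w := Function.update v j (Pi.single l (1 : ℂ)) with hw
  have hs : ∀ u : Fin N → ℂ, (pure p (Function.update w i u) : PolTPow N n)
      = ∑ m, u m • pure p (Function.update w i (Pi.single m (1 : ℂ))) := fun u => by
    let L : (Fin N → ℂ) →ₗ[ℂ] PolTPow N n :=
      (ofTensor N n).toLinearMap ∘ₗ TensorProduct.mk ℂ (Pol n) (TPow N n) p ∘ₗ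
        (PiTensorProduct.tprod ℂ (s := fun _ : Fin n => Fin N → ℂ)).toLinearMap w i
    have hL : ∀ u, (pure p (Function.update w i u) : PolTPow N n) = L u := fun u => rfl
    simp only [hL]
    rw [LinearMap.pi_apply_eq_sum_univ L u]
    refine Finset.sum_congr rfl fun m _ => ?_
    congr 2
    ext c
    simp [Pi.single_apply, eq_comm]
  rw [hs, Finset.smul_sum]
  refine Finset.sum_congr rfl fun m _ => ?_
  rw [smul_smul, mul_comm]

theorem smul_comm_sAct {i j : Fin n} (h : i ≠ j) :
    polOp N n (MvPolynomial.X i - MvPolynomial.X j) * sAct N n h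
      = polOp N n (MvPolynomial.X i - MvPolynomial.X j) * (flip N n i j * swapVars N n i j)
        + 1 - swapVars N n i j := by
  refine LinearMap.ext fun f => ?_
  have := smul_sAct N n h f
  rw [LinearMap.sub_apply, LinearMap.add_apply]
  change (MvPolynomial.X i - MvPolynomial.X j : Pol n) • sAct N n h f
    = (MvPolynomial.X i - MvPolynomial.X j : Pol n) • flip N n i j (swapVars N n i j f) + f - _
  rw [this]
  abel

theorem eq_of_polOp_mul {q : Pol n} (hq : q ≠ 0) {f g : Module.End ℂ (PolTPow N n)}
    (h : polOp N n q * f = polOp N n q * g) : f = g :=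
  LinearMap.ext fun v => smul_injective N n hq (congrArg (fun F => F v) h)


theorem coeff_auxFlipMap (M : Matrix (Fin N) (Fin N) (Module.End ℂ (PolTPow N n))) (i j : Fin N) :
    M.map PowerSeries.C i j = PowerSeries.C (M i j) := rfl

theorem C_sub {A : Type*} [Ring A] (x y : A) :
    (PowerSeries.C (x - y) : PowerSeries A) = PowerSeries.C x - PowerSeries.C y := map_sub _ _ _

theorem C_sub_zero {A : Type*} [Ring A] (x : A) :
    (PowerSeries.C (x - 0) : PowerSeries A) = PowerSeries.C x - 0 := by
  rw [sub_zero, sub_zero]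

theorem factor_eq (a : Fin n) : factor N n a
    = 1 + Matrix.scalar (Fin N) PowerSeries.X * ((auxFlip N n a).map PowerSeries.C
      - kap N (polOp N n (MvPolynomial.X a))) := by
  rw [factor]
  congr 1
  refine Matrix.ext fun i j => ?_
  rw [Matrix.of_apply, Matrix.scalar_apply, Matrix.diagonal_mul, Matrix.sub_apply]
  congr 1
  by_cases h : i = j
  · subst h
    rw [if_pos rfl]
    have : kap N (polOp N n (MvPolynomial.X a)) i i
        = PowerSeries.C (polOp N n (MvPolynomial.X a)) := by simp [kap]
    rw [this]
    exact C_sub (A := Module.End ℂ (PolTPow N n)) _ _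
  · rw [if_neg h]
    have : kap N (polOp N n (MvPolynomial.X a)) i j = 0 := by simp [kap, h]
    rw [this]
    exact C_sub_zero (A := Module.End ℂ (PolTPow N n)) (auxFlip N n a i j)

theorem kap_mul_map (x : Module.End ℂ (PolTPow N n))
    (M : Matrix (Fin N) (Fin N) (Module.End ℂ (PolTPow N n))) :
    kap N x * M.map PowerSeries.C = (Matrix.of fun i j => x * M i j).map PowerSeries.C := by
  refine Matrix.ext fun i j => ?_
  simp [kap]

theorem map_mul_kap (x : Module.End ℂ (PolTPow N n))
    (M : Matrix (Fin N) (Fin N) (Module.End ℂ (PolTPow N n))) :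
    M.map PowerSeries.C * kap N x = (Matrix.of fun i j => M i j * x).map PowerSeries.C := by
  refine Matrix.ext fun i j => ?_
  simp [kap]

theorem scalar_X_comm (M : Matrix (Fin N) (Fin N) (PowerSeries (Module.End ℂ (PolTPow N n)))) :
    Matrix.scalar (Fin N) PowerSeries.X * M = M * Matrix.scalar (Fin N) PowerSeries.X := by
  refine Matrix.ext fun i j => ?_
  rw [Matrix.scalar_apply, Matrix.diagonal_mul, Matrix.mul_diagonal]
  exact (PowerSeries.commute_X _).symm.eq

theorem pair_commute {R : Type*} [Ring R] (D P t F₁ F₂ : R) (h1 : t * F₁ = F₂ * t)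
    (h2 : t * F₂ = F₁ * t) (d1 : D * F₁ = F₁ * D) (d2 : D * F₂ = F₂ * D)
    (h : P * (F₁ * F₂) - F₂ * F₁ * P = D * (F₁ * F₂ - F₂ * F₁)) :
    Commute (D * t + 1 - P * t) (F₂ * F₁) := by
  have ht : t * (F₂ * F₁) = F₁ * F₂ * t := by rw [← mul_assoc, h2, mul_assoc, h1, ← mul_assoc]
  have hD : F₂ * F₁ * D = D * (F₂ * F₁) := by rw [mul_assoc, ← d1, ← mul_assoc, ← d2, mul_assoc]
  have e : (D * t + 1 - P * t) * (F₂ * F₁) - F₂ * F₁ * (D * t + 1 - P * t)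
      = (D * (F₁ * F₂ - F₂ * F₁) - (P * (F₁ * F₂) - F₂ * F₁ * P)) * t := by
    simp only [sub_mul, add_mul, mul_sub, mul_add, one_mul, mul_one]
    rw [mul_assoc D t, ht, mul_assoc P t, ht, ← mul_assoc _ D t, hD, ← mul_assoc _ P t,
      ← mul_assoc D _ t, ← mul_assoc P _ t]
    abel
  rw [h, sub_self, zero_mul, sub_eq_zero] at e
  exact e

theorem factor_aux {R : Type*} [Ring R] (t x q q' z z' : R) (hx : x * t = t * x)
    (hq : t * q = q' * t) (hz : t * z = z' * t) :
    t * (1 + x * (q - z)) = (1 + x * (q' - z')) * t := by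
  rw [mul_add, add_mul, mul_one, one_mul, ← mul_assoc, ← hx, mul_assoc, mul_assoc, mul_sub, sub_mul,
    hq, hz]

theorem comm_aux {R : Type*} [Ring R] (D t P y : R) (e1 : t * y = y * t) (e2 : P * y = y * P)
    (e3 : D * y = y * D) : Commute (D * t + 1 - P * t) y := by
  have h1 : Commute t y := e1
  have h2 : Commute P y := e2
  have h3 : Commute D y := e3
  exact ((h3.mul_left h1).add_left (Commute.one_left y)).sub_left (h2.mul_left h1)

theorem kap_lin {A : Type*} [Ring A] (N : ℕ) (D t P : A) :
    kap N (D * t + 1 - P * t) = kap N D * kap N t + 1 - kap N P * kap N t := by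
  rw [map_sub, map_add, map_mul, map_mul, map_one]

theorem sub_kap {A : Type*} [Ring A] (N : ℕ) (x y : A) : kap N (x - y) = kap N x - kap N y :=
  map_sub _ _ _

theorem symm_aux {R : Type*} [Ring R] (D F S Y s : R) (hs : D * s = D * (F * S) + 1 - S)
    (e1 : S * Y = Y * S) (e2 : F * Y = Y * F) (e3 : D * Y = Y * D) : D * (s * Y) = D * (Y * s) := by
  have h1 : Commute S Y := e1
  have h2 : Commute F Y := e2
  have h3 : Commute D Y := e3
  have h : Commute (D * s) Y := by
    rw [hs]
    exact ((h3.mul_left (h2.mul_left h1)).add_left (Commute.one_left Y)).sub_left h1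
  rw [← mul_assoc, h.eq, ← mul_assoc, ← mul_assoc, e3]

theorem kap_commute_lMatrix {i j : Fin n} (h : i ≠ j) (hij : (i : ℕ) + 1 = j) :
    Commute (kap N (polOp N n (MvPolynomial.X i - MvPolynomial.X j) * sAct N n h))
      (lMatrix N n) := by
  set P := flip N n i j with hP
  set t := flip N n i j * swapVars N n i j with ht
  set D := polOp N n (MvPolynomial.X i - MvPolynomial.X j) with hD
  have hPt : P * t = swapVars N n i j := by
    rw [ht, ← mul_assoc, flip_flip, one_mul]
  have hx : D * sAct N n h = D * t + 1 - P * t := by rw [hPt, smul_comm_sAct]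
  have tpol : ∀ a, t * polOp N n (MvPolynomial.X a)
      = polOp N n (MvPolynomial.X (Equiv.swap i j a)) * t := fun a => by
    rw [ht, mul_assoc, swapVars_polOp, ← mul_assoc, flip_polOp, mul_assoc, MvPolynomial.rename_X]
  have tslot : ∀ a g, t * slot N n a g = slot N n (Equiv.swap i j a) g * t := fun a g => by
    rw [ht, mul_assoc, swapVars_slot, ← mul_assoc, flip_slot, mul_assoc]
  have tfactor : ∀ a, kap N t * factor N n a = factor N n (Equiv.swap i j a) * kap N t :=
    fun a => by
      rw [factor_eq, factor_eq]
      refine factor_aux (R := Matrix (Fin N) (Fin N) (PowerSeries (Module.End ℂ (PolTPow N n))))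
        _ _ _ _ _ _ ?_ ?_ ?_
      · exact scalar_X_comm _
      · rw [kap_mul_map, map_mul_kap]
        congr 1
        exact congrArg _ (funext fun k => funext fun l => tslot _ _)
      · rw [← map_mul, ← map_mul, tpol]
  rw [hx, lMatrix]
  refine List.commute_reverse_prod_ofFn _ _ i j hij (fun c hi hj => ?_) ?_
  · have hc : Equiv.swap i j c = c := Equiv.swap_apply_of_ne_of_ne hi hj
    refine kap_commute_factor _ _ (fun g => ?_) ?_
    · refine comm_aux D t P _ ?_ ?_ ?_
      · rw [tslot, hc]
      · rw [hP, flip_slot, hc]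
      · exact polOp_comm_slot N n c _ g
    · refine comm_aux D t P _ ?_ ?_ ?_
      · rw [tpol, hc]
      · rw [hP, flip_polOp]
      · rw [hD, ← map_mul, mul_comm, map_mul]
  · rw [show kap N (D * t + 1 - P * t) = _ from kap_lin N D t P]
    have kD : ∀ a, kap N D * factor N n a = factor N n a * kap N D := fun a =>
      kap_commute_factor _ _ (fun g => polOp_comm_slot N n a _ g)
        (by rw [Commute, SemiconjBy, hD, ← map_mul, mul_comm, map_mul])
    refine pair_commute (R := Matrix (Fin N) (Fin N) (PowerSeries (Module.End ℂ (PolTPow N n))))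
      _ _ _ _ _ ?_ ?_ ?_ ?_ ?_
    · rw [tfactor, Equiv.swap_apply_left]
    · rw [tfactor, Equiv.swap_apply_right]
    · exact kD i
    · exact kD j
    · have hDk : kap N D = kap N (polOp N n (MvPolynomial.X i)) - kap N (polOp N n (MvPolynomial.X j)) := by
        rw [hD, map_sub]; exact sub_kap N _ _
      have polQ : ∀ a c, kap N (polOp N n (MvPolynomial.X a)) * (auxFlip N n c).map PowerSeries.C
          = (auxFlip N n c).map PowerSeries.C * kap N (polOp N n (MvPolynomial.X a)) := fun a c => by
        rw [kap_mul_map, map_mul_kap]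
        congr 1
        refine congrArg _ (funext fun k => funext fun l => polOp_comm_slot N n c _ _)
      have PQ : ∀ c, kap N P * (auxFlip N n c).map PowerSeries.C
          = (auxFlip N n (Equiv.swap i j c)).map PowerSeries.C * kap N P := fun c => by
        rw [kap_mul_map, map_mul_kap]
        congr 1
        refine congrArg _ (funext fun k => funext fun l => flip_slot _ _ _ _)
      have QQ : ∀ {a c : Fin n}, a ≠ c →
          (auxFlip N n a).map PowerSeries.C * (auxFlip N n c).map PowerSeries.C
          = (auxFlip N n c).map PowerSeries.C * kap N (flip N n a c) := fun {a c} hac => by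
        rw [map_mul_kap, ← auxFlip_mul hac, Matrix.map_mul]
      have hsymm : flip N n j i = flip N n i j := by rw [flip, flip, Equiv.swap_comm]
      rw [hDk, factor_eq, factor_eq]
      refine pair_aux (R := Matrix (Fin N) (Fin N) (PowerSeries (Module.End ℂ (PolTPow N n))))
        _ _ _ _ _ _ ?_ ?_ ?_ ?_ ?_ ?_ ?_ ?_ ?_ ?_ ?_ ?_ ?_ ?_ ?_
      · exact scalar_X_comm _
      · exact scalar_X_comm _
      · exact scalar_X_comm _
      · exact scalar_X_comm _
      · exact scalar_X_comm _
      · rw [← map_mul, ← map_mul, mul_comm (MvPolynomial.X i), map_mul, map_mul]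
      · rw [← map_mul, ← map_mul, flip_polOp]
      · rw [← map_mul, ← map_mul, flip_polOp]
      · exact polQ _ _
      · exact polQ _ _
      · exact polQ _ _
      · exact polQ _ _
      · rw [PQ, Equiv.swap_apply_left]
      · rw [PQ, Equiv.swap_apply_right]
      · rw [QQ h, QQ h.symm, hsymm]
        exact (sub_mul (α := Matrix (Fin N) (Fin N) (PowerSeries (Module.End ℂ (PolTPow N n))))
          _ _ _).symm

theorem rename_invSeries (e : Equiv.Perm (Fin n)) (r : ℕ) :
    MvPolynomial.rename e (PowerSeries.coeff r (invSeries n)) = PowerSeries.coeff r (invSeries n) := by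
  have : PowerSeries.map (MvPolynomial.rename (R := ℂ) e).toRingHom (invSeries n) = invSeries n := by
    rw [invSeries, map_prod]
    refine Fintype.prod_equiv e _ _ fun a => ?_
    ext m : 1
    simp
  conv_rhs => rw [← this]
  rw [PowerSeries.coeff_map]; rfl

theorem sAct_symm_smul {i j : Fin n} (h : i ≠ j) {q : Pol n}
    (hq : MvPolynomial.rename (Equiv.swap i j) q = q) :
    sAct N n h * polOp N n q = polOp N n q * sAct N n h := by
  refine eq_of_polOp_mul (X_sub_X_ne_zero h) ?_
  refine symm_aux _ (flip N n i j) (swapVars N n i j) _ _ (smul_comm_sAct h) ?_ ?_ ?_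
  · rw [swapVars_polOp, hq]
  · rw [flip_polOp]
  · rw [← map_mul, mul_comm, map_mul]

theorem sAct_commute_tMatrix {i j : Fin n} (h : i ≠ j) (hij : (i : ℕ) + 1 = j)
    (k l : Fin N) (r : ℕ) :
    sAct N n h * PowerSeries.coeff r (tMatrix N n k l)
      = PowerSeries.coeff r (tMatrix N n k l) * sAct N n h := by
  refine eq_of_polOp_mul (X_sub_X_ne_zero h) ?_
  have e1 := (commute_tMatrix (N := N)
    (polOp N n (MvPolynomial.X i - MvPolynomial.X j) * sAct N n h) (fun s => ?_)
    (kap_commute_lMatrix h hij) k l r).eq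
  · have e2 := (commute_tMatrix (N := N)
      (polOp N n (MvPolynomial.X i - MvPolynomial.X j)) (fun s => by
        rw [Commute, SemiconjBy, ← map_mul, mul_comm, map_mul])
      (kap_polOp_commute_lMatrix _) k l r).eq
    rw [← mul_assoc, e1, ← mul_assoc, ← mul_assoc, e2]
  · change _ * _ = _ * _
    rw [mul_assoc, sAct_symm_smul h (rename_invSeries _ _), ← mul_assoc, ← mul_assoc, ← map_mul,
      mul_comm, map_mul]

end PolTPow

namespace PolTPow

variable (N n : ℕ)

/-- The `Y(gl_N)`-module structure `T_{ij}(u) ↦ L_{ij}(u) ∏_a (u - z_a)⁻¹` on `𝒱`. -/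
noncomputable def rep : Yangian N →ₐ[ℂ] Module.End ℂ (PolTPow N n) :=
  Yangian.lift (tMatrix N n) isRTT_tMatrix

variable {N n}

theorem rep_commute (x : Module.End ℂ (PolTPow N n))
    (h : ∀ k l r, x * PowerSeries.coeff r (tMatrix N n k l)
      = PowerSeries.coeff r (tMatrix N n k l) * x) (y : Yangian N) :
    x * rep N n y = rep N n y * x := by
  have := Yangian.mem_of_coeff_mem ((Subalgebra.centralizer ℂ {x}).comap (rep N n))
    (fun i j s => by
      rw [Subalgebra.mem_comap, Subalgebra.mem_centralizer_iff]
      rintro _ rfl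
      rw [rep, Yangian.lift_T]
      exact h i j s) y
  exact (Subalgebra.mem_centralizer_iff ℂ).1 this x rfl

theorem rep_smul (y : Yangian N) (q : Pol n) (f : PolTPow N n) :
    rep N n y (q • f) = q • rep N n y f :=
  (congrArg (fun F => F f) (rep_commute (polOp N n q) (fun k l r =>
    commute_tMatrix _ (fun s => by rw [Commute, SemiconjBy, ← map_mul, mul_comm, map_mul])
      (kap_polOp_commute_lMatrix _) k l r) y)).symm

theorem sAct_rep {i j : Fin n} (h : i ≠ j) (hij : (i : ℕ) + 1 = j) (y : Yangian N)
    (f : PolTPow N n) : sAct N n h (rep N n y f) = rep N n y (sAct N n h f) :=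
  congrArg (fun F => F f) (rep_commute (sAct N n h) (fun k l r =>
    sAct_commute_tMatrix h hij k l r) y)

variable (N n)

end PolTPow

/-- The algebra of symmetric polynomials in `z_1, …, z_n`. -/
def SymPol (n : ℕ) : Type := MvPolynomial.symmetricSubalgebra (Fin n) ℂ

namespace SymPol

noncomputable instance (n : ℕ) : CommRing (SymPol n) :=
  inferInstanceAs (CommRing (MvPolynomial.symmetricSubalgebra (Fin n) ℂ))

noncomputable instance (n : ℕ) : Algebra ℂ (SymPol n) :=
  inferInstanceAs (Algebra ℂ (MvPolynomial.symmetricSubalgebra (Fin n) ℂ))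

/-- The inclusion into the algebra of polynomials. -/
noncomputable def val (n : ℕ) : SymPol n →ₐ[ℂ] Pol n :=
  (MvPolynomial.symmetricSubalgebra (Fin n) ℂ).val

theorem isSymmetric_val {n : ℕ} (q : SymPol n) : (val n q).IsSymmetric :=
  (MvPolynomial.mem_symmetricSubalgebra _).1 q.2

noncomputable instance (N n : ℕ) : Module (SymPol n) (PolTPow N n) :=
  Module.compHom _ (SymPol.val n).toRingHom

theorem smul_def {N n : ℕ} (q : SymPol n) (f : PolTPow N n) : q • f = val n q • f := rfl

instance (N n : ℕ) : IsScalarTower ℂ (SymPol n) (PolTPow N n) := ⟨fun c q f => by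
  rw [smul_def, smul_def, map_smul, smul_assoc]⟩

/-- The elementary symmetric polynomial `σ_k`. -/
noncomputable def esymm (n k : ℕ) : SymPol n :=
  ⟨MvPolynomial.esymm (Fin n) ℂ k, MvPolynomial.esymm_isSymmetric _ _ _⟩

end SymPol

/-- The ideal `I_a` generated by `σ_i(z) - a_i`, `i = 1, …, n` (here `a i` is the number `a_{i+1}`). -/
noncomputable def symIdeal (n : ℕ) (a : Fin n → ℂ) : Ideal (SymPol n) :=
  Ideal.span (Set.range fun i : Fin n =>
    SymPol.esymm n (i + 1) - algebraMap ℂ (SymPol n) (a i))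

namespace PolTPow

variable (N n : ℕ)

/-- `𝒱^S`, the space of `S_n`-invariants in `𝒱` (the elements fixed by the elementary transpositions,
which generate `S_n`), as a module over the symmetric polynomials. -/
noncomputable def invariants : Submodule (SymPol n) (PolTPow N n) where
  carrier := {f | ∀ (i j : Fin n) (h : i ≠ j), (i : ℕ) + 1 = j → sAct N n h f = f}
  zero_mem' := fun i j h _ => map_zero _
  add_mem' := fun {f g} hf hg i j h hij => by rw [map_add, hf i j h hij, hg i j h hij]
  smul_mem' := fun q f hf i j h hij => by
    have := congrArg (fun F => F f) (sAct_symm_smul (N := N) h (q := SymPol.val n q)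
      (SymPol.isSymmetric_val q _))
    rw [SymPol.smul_def]
    refine this.trans ?_
    change SymPol.val n q • sAct N n h f = _
    rw [hf i j h hij]

/-- The `Y(gl_N)`-module `𝒱^S`. -/
noncomputable def invRep : Yangian N →ₐ[ℂ] Module.End (SymPol n) (invariants N n) where
  toFun y :=
    { toFun := fun f => ⟨rep N n y f, fun i j h hij => by
        rw [sAct_rep h hij, f.2 i j h hij]⟩
      map_add' := fun f g => Subtype.ext (map_add _ _ _)
      map_smul' := fun q f => Subtype.ext (rep_smul y (SymPol.val n q) f) }
  map_one' := by ext f; simp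
  map_mul' y y' := by ext f; simp
  map_zero' := by ext f; simp
  map_add' y y' := by ext f; simp
  commutes' c := by
    ext f
    change rep N n (algebraMap ℂ _ c) f = _
    rw [AlgHom.commutes]
    rfl

/-- The quotient `𝒱^S / I_a 𝒱^S`. -/
abbrev Fiber (a : Fin n → ℂ) : Type :=
  invariants N n ⧸ (symIdeal n a • ⊤ : Submodule (SymPol n) (invariants N n))

/-- The `Y(gl_N)`-module `𝒱^S / I_a 𝒱^S`. -/
noncomputable def fiberRep (a : Fin n → ℂ) : Yangian N →ₐ[ℂ] Module.End (SymPol n) (Fiber N n a) where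
  toFun y := Submodule.mapQ _ _ (invRep N n y) (Submodule.smul_top_le_comap_smul_top _ _)
  map_one' := by ext f; simp
  map_mul' y y' := by ext f; simp
  map_zero' := by ext f; simp
  map_add' y y' := by ext f; simp
  commutes' c := by
    ext f
    simp only [AlgHom.commutes]
    rfl

/-- Evaluation at `z = b`, from `𝒱` to `V`. -/
noncomputable def evalAt (b : Fin n → ℂ) : PolTPow N n →ₗ[ℂ] TPow N n :=
  (TensorProduct.lid ℂ (TPow N n)).toLinearMap ∘ₗ
    LinearMap.rTensor (TPow N n) (MvPolynomial.aeval b : Pol n →ₐ[ℂ] ℂ).toLinearMap ∘ₗ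
    (ofTensor N n).symm.toLinearMap

theorem evalAt_tmul (b : Fin n → ℂ) (p : Pol n) (v : TPow N n) :
    evalAt N n b (tmul p v) = MvPolynomial.eval b p • v := by
  change TensorProduct.lid ℂ (TPow N n) (MvPolynomial.aeval b p ⊗ₜ[ℂ] v) = _
  rw [TensorProduct.lid_tmul, MvPolynomial.aeval_eq_eval]

end PolTPow

/-!
Write `s` for the exchange of two neighbouring variables and `∂` for the corresponding divided
difference. The operators `s - ∂` satisfy the relations of the adjacent transpositions, so they define
a deformed action `w ↦ ŵ` of the symmetric group on `ℂ[z_1, …, z_n]`, linear over the symmetric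
polynomials (`deformedAction`). An element of `𝒱` is invariant in the sense of the statement if and
only if it is invariant under all `ŵ ⊗ w`, where `w` permutes the tensor factors
(`PolTPow.mem_invariants_iff`). Hence `f ↦ ∑ w, (ŵ ⊗ w) f` maps `𝒱` to `𝒱^S`, and the statement is
reduced to one about the linear forms `p ↦ (ŵ p)(b)` on polynomials.

The key is the polynomial `Δ = ∏ (z_i - b_j)` over `i + j ≤ n` (`staircase`). The value `(ŵ Δ)(b)` is
`0` unless `w` is the longest permutation, for which it is `∏_{j < k} (b_k - b_j - 1)`
(`eval_deformedAction_staircase`). For distinct `b_j` this follows by expanding `ŵ` in terms of the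
values at the points with permuted coordinates, of which `Δ` vanishes at all but one; the general case
follows because both sides are polynomials in `b`. The order of the `b_j` is exactly what makes the
product nonzero.

* Surjectivity: the symmetrization of `Δ ⊗ v` has at `b` the value `v` with the factors reversed, up
  to this nonzero product.
* Injectivity: the `n!` linear forms `p ↦ (ŵ p)(b)` are linearly independent, since they can be
  evaluated on the polynomials `ŵ Δ`. They vanish on the ideal of `ℂ[z_1, …, z_n]` generated by `I_a`,
  whose codimension is at most `n!` (`finrank_quotient_le_factorial`), so their common kernel is this
  ideal (`mem_map_symIdeal_of_eval_eq_zero`). If an invariant `f` vanishes at `b`, then these forms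
  vanish on all coordinates of `f`, so that `f` lies in `I_a 𝒱`, and in `I_a 𝒱^S` by symmetrization.

Evaluation at `b` commutes with the Yangian because the value at `z = b` of the matrix defining the
action on `𝒱` is the matrix of the tensor product of evaluation modules, by induction on the number of
factors (`Yangian.evalTensorRep_T`, `PolTPow.evalAt_rep`).
-/

/-! ### Monoid homomorphisms out of the symmetric group -/

namespace AdjacentTransposition

variable {M : Type*} [Monoid M]

/-- The relations of the adjacent transpositions of `n` letters, for a sequence of elements of a
monoid. Only the elements `σ i` with `i + 1 < n` matter. -/
structure Relations (n : ℕ) (σ : ℕ → M) : Prop where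
  mul_self : ∀ i, i + 1 < n → σ i * σ i = 1
  braid : ∀ i, i + 2 < n → σ i * σ (i + 1) * σ i = σ (i + 1) * σ i * σ (i + 1)
  comm : ∀ i j, i + 1 < j → j + 1 < n → σ i * σ j = σ j * σ i

/-- The product `σ j * σ (j + 1) * ⋯ * σ (j + d - 1)`. -/
def run (σ : ℕ → M) : ℕ → ℕ → M
  | _, 0 => 1
  | j, d + 1 => σ j * run σ (j + 1) d

/-- The normal forms of words in `σ 0, …, σ (k - 2)`: the products of runs ending at `σ (k - 2)`,
`σ (k - 3)`, …, `σ 0`, in this order, each of them possibly empty. -/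
def normalForms (σ : ℕ → M) : ℕ → Set M
  | 0 => {1}
  | k + 1 => Set.image2 (fun d g => run σ (k - d) d * g) (Set.Iio (k + 1)) (normalForms σ k)

theorem one_mem_normalForms (σ : ℕ → M) (k : ℕ) : 1 ∈ normalForms σ k := by
  induction k with
  | zero => exact rfl
  | succ k ih => exact ⟨0, Nat.succ_pos k, 1, ih, by simp [run]⟩

theorem finite_normalForms (σ : ℕ → M) (k : ℕ) : (normalForms σ k).Finite := by
  induction k with
  | zero => exact Set.finite_singleton 1
  | succ k ih => exact (Set.finite_Iio _).image2 _ ih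

theorem ncard_normalForms_le (σ : ℕ → M) (k : ℕ) : (normalForms σ k).ncard ≤ k.factorial := by
  induction k with
  | zero => simp [normalForms]
  | succ k ih =>
    rw [normalForms, ← Set.image_prod]
    refine (Set.ncard_image_le ((Set.finite_Iio _).prod (finite_normalForms σ k))).trans ?_
    rw [Set.ncard_prod, Nat.factorial_succ]
    refine Nat.mul_le_mul (le_of_eq ?_) ih
    rw [← Finset.coe_Iio, Set.ncard_coe_finset, Nat.card_Iio]

variable {n : ℕ} {σ : ℕ → M}

theorem Relations.mul_run_of_lt (h : Relations n σ) {i j d : ℕ} (hij : i + 1 < j)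
    (hd : j + d < n) : σ i * run σ j d = run σ j d * σ i := by
  induction d generalizing j with
  | zero => simp [run]
  | succ d ih =>
    rw [run, ← mul_assoc, h.comm i j hij (by omega), mul_assoc, ih (by omega) (by omega), mul_assoc]

theorem Relations.mul_run_of_gt (h : Relations n σ) {i j d : ℕ} (hij : j ≤ i)
    (hd : i + 1 < j + d) (hn : j + d < n) : σ (i + 1) * run σ j d = run σ j d * σ i := by
  induction d generalizing j with
  | zero => omega
  | succ d ih =>
    rcases hij.eq_or_lt with rfl | hlt
    · obtain ⟨d, rfl⟩ : ∃ e, d = e + 1 := ⟨d - 1, by omega⟩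
      rw [run, run, ← mul_assoc, ← mul_assoc, ← h.braid j (by omega), mul_assoc,
        h.mul_run_of_lt (by omega) (by omega)]
      simp only [mul_assoc]
    · rw [run, ← mul_assoc, ← h.comm j (i + 1) (by omega) (by omega), mul_assoc,
        ih (by omega) (by omega) (by omega), mul_assoc]

theorem Relations.mul_mem_normalForms (h : Relations n σ) {k : ℕ} (hk : k ≤ n) {i : ℕ}
    (hi : i + 1 < k) {g : M} (hg : g ∈ normalForms σ k) : σ i * g ∈ normalForms σ k := by
  induction k generalizing i g with
  | zero => omega
  | succ k ih =>
    obtain ⟨d, hd, g, hg, rfl⟩ := hg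
    have hd : d < k + 1 := hd
    simp only
    rcases lt_trichotomy i (k - d) with hlt | heq | hgt
    · rcases Nat.lt_or_ge (i + 1) (k - d) with h1 | h1
      · refine ⟨d, hd, σ i * g, ih (by omega) (by omega) hg, ?_⟩
        simp only
        rw [← mul_assoc, ← h.mul_run_of_lt h1 (by omega), mul_assoc]
      · refine ⟨d + 1, show d + 1 < k + 1 by omega, g, hg, ?_⟩
        simp only
        rw [show k - (d + 1) = i by omega, run, show i + 1 = k - d by omega, mul_assoc]
    · obtain ⟨d, rfl⟩ : ∃ e, d = e + 1 := ⟨d - 1, by omega⟩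
      refine ⟨d, show d < k + 1 by omega, g, hg, ?_⟩
      simp only
      rw [run, ← heq, ← mul_assoc, ← mul_assoc, h.mul_self i (by omega), one_mul,
        show i + 1 = k - d by omega]
    · obtain ⟨i, rfl⟩ : ∃ e, i = e + 1 := ⟨i - 1, by omega⟩
      refine ⟨d, hd, σ i * g, ih (by omega) (by omega) hg, ?_⟩
      simp only
      rw [← mul_assoc, ← h.mul_run_of_gt (by omega) (by omega) (by omega), mul_assoc]

/-- The symmetric group is generated by the adjacent transpositions. -/
theorem mclosure_swap_eq_top (n : ℕ) :
    Submonoid.closure {w : Equiv.Perm (Fin n) | ∃ i j : Fin n, (i : ℕ) + 1 = j ∧ w = Equiv.swap i j}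
      = ⊤ := by
  rcases n with _ | n
  · exact Subsingleton.elim _ _
  · rw [eq_top_iff, ← Equiv.Perm.mclosure_swap_castSucc_succ n]
    refine Submonoid.closure_mono ?_
    rintro _ ⟨i, rfl⟩
    exact ⟨i.castSucc, i.succ, by simp, rfl⟩

theorem swap_braid {α : Type*} [DecidableEq α] {a b c : α} (hab : a ≠ b) (hac : a ≠ c)
    (hbc : b ≠ c) : Equiv.swap a b * Equiv.swap b c * Equiv.swap a b
      = Equiv.swap b c * Equiv.swap a b * Equiv.swap b c := by
  rw [Equiv.swap_mul_swap_mul_swap hab hac, Equiv.swap_comm a b, Equiv.swap_comm b c,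
    Equiv.swap_mul_swap_mul_swap hbc.symm hac.symm, Equiv.swap_comm]

/-- Elements of a monoid satisfying the relations of the adjacent transpositions are the images of
these transpositions under a homomorphism of the symmetric group. In the submonoid of
`Perm (Fin n) × M` generated by the pairs `(s_i, σ i)` every element is a normal form, so that it has
at most `n!` elements and its projection to `Perm (Fin n)`, being onto, is bijective. -/
theorem Relations.exists_hom (h : Relations n σ) : ∃ ρ : Equiv.Perm (Fin n) →* M,
    ∀ i j : Fin n, (i : ℕ) + 1 = j → ρ (Equiv.swap i j) = σ i := by
  classical
  set τ : ℕ → Equiv.Perm (Fin n) × M := fun i =>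
    if hi : i + 1 < n then (Equiv.swap ⟨i, by omega⟩ ⟨i + 1, hi⟩, σ i) else 1 with hτ
  have τ_eq : ∀ (i : ℕ) (hi : i + 1 < n), τ i = (Equiv.swap ⟨i, by omega⟩ ⟨i + 1, hi⟩, σ i) :=
    fun i hi => by simp [hτ, hi]
  have hrel : Relations n τ := by
    refine ⟨fun i hi => ?_, fun i hi => ?_, fun i j hij hj => ?_⟩
    · rw [τ_eq i hi, Prod.mk_mul_mk, h.mul_self i hi, Equiv.swap_mul_self]; rfl
    · rw [τ_eq i (by omega), τ_eq (i + 1) (by omega)]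
      simp only [Prod.mk_mul_mk, h.braid i hi]
      rw [swap_braid] <;> (rw [ne_eq, Fin.mk.injEq]; omega)
    · rw [τ_eq i (by omega), τ_eq j (by omega)]
      simp only [Prod.mk_mul_mk, h.comm i j hij hj]
      rw [(Equiv.Perm.disjoint_swap_swap _).commute.eq]
      simp only [List.nodup_cons, List.mem_cons, Fin.ext_iff, List.not_mem_nil, or_false,
        not_or, not_false_eq_true, List.nodup_nil, and_true]
      omega
  set S : Submonoid (Equiv.Perm (Fin n) × M) :=
    Submonoid.closure {g | ∃ i, i + 1 < n ∧ g = τ i} with hS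
  have hle : (S : Set (Equiv.Perm (Fin n) × M)) ⊆ normalForms τ n := by
    intro g hg
    induction hg using Submonoid.closure_induction_left with
    | one => exact one_mem_normalForms τ n
    | mul_left x hx y hy ih =>
      obtain ⟨i, hi, rfl⟩ := hx
      exact hrel.mul_mem_normalForms le_rfl hi ih
  have hfin : (S : Set (Equiv.Perm (Fin n) × M)).Finite := (finite_normalForms τ n).subset hle
  have hfinite : Finite S := hfin
  have hcard : Nat.card S ≤ Nat.card (Equiv.Perm (Fin n)) := by
    rw [Nat.card_eq_fintype_card (α := Equiv.Perm (Fin n)), Fintype.card_perm, Fintype.card_fin]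
    exact (Set.ncard_le_ncard hle (finite_normalForms τ n)).trans (ncard_normalForms_le τ n)
  let π : S →* Equiv.Perm (Fin n) := (MonoidHom.fst _ _).comp S.subtype
  have hτS : ∀ i, i + 1 < n → τ i ∈ S := fun i hi => Submonoid.subset_closure ⟨i, hi, rfl⟩
  have hsurj : Function.Surjective π := by
    rw [← MonoidHom.mrange_eq_top, eq_top_iff, ← mclosure_swap_eq_top n, Submonoid.closure_le]
    rintro _ ⟨i, j, hij, rfl⟩
    have hi : (i : ℕ) + 1 < n := hij ▸ j.2
    refine ⟨⟨τ i, hτS i hi⟩, ?_⟩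
    change (τ i).1 = _
    rw [τ_eq i hi]
    simp only [hij]
  have hbij : Function.Bijective π :=
    hsurj.bijective_of_nat_card_le hcard
  let e : S ≃* Equiv.Perm (Fin n) := MulEquiv.ofBijective π hbij
  refine ⟨((MonoidHom.snd _ _).comp S.subtype).comp e.symm.toMonoidHom, fun i j hij => ?_⟩
  have hi : (i : ℕ) + 1 < n := hij ▸ j.2
  have : e.symm (Equiv.swap i j) = ⟨τ i, hτS i hi⟩ := by
    rw [MulEquiv.symm_apply_eq]
    change _ = (τ i).1
    rw [τ_eq i hi]
    simp only [hij]
  change (e.symm (Equiv.swap i j)).1.2 = σ i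
  rw [this]
  change (τ i).2 = σ i
  rw [τ_eq i hi]

end AdjacentTransposition

/-! ### The deformed action of the symmetric group on polynomials -/

/-- Polynomials agreeing at all points with pairwise distinct coordinates are equal. -/
theorem Pol.ext_of_injective {n : ℕ} {p q : Pol n}
    (h : ∀ x : Fin n → ℂ, Function.Injective x → MvPolynomial.eval x p = MvPolynomial.eval x q) :
    p = q := by
  set D : Pol n := ∏ t ∈ Finset.univ.filter (fun t : Fin n × Fin n => t.1 ≠ t.2),
    (MvPolynomial.X t.1 - MvPolynomial.X t.2) with hD
  have hD0 : D ≠ 0 := Finset.prod_ne_zero_iff.2 fun t ht =>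
    X_sub_X_ne_zero (Finset.mem_filter.1 ht).2
  refine mul_left_cancel₀ hD0 (MvPolynomial.funext fun x => ?_)
  rw [map_mul, map_mul]
  by_cases hx : Function.Injective x
  · rw [h x hx]
  · have : MvPolynomial.eval x D = 0 := by
      simp only [Function.Injective, not_forall] at hx
      obtain ⟨i, j, hij, hne⟩ := hx
      rw [hD, map_prod]
      exact Finset.prod_eq_zero (i := (i, j)) (by simpa using hne) (by simp [hij])
    rw [this, zero_mul, zero_mul]

/-- The operator `p ↦ s p - ∂ p` on polynomials, where `s` exchanges the variables `z_i`, `z_j` and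
`∂` is the divided difference. Together with the multiplication by the variables, these operators for
`j = i + 1` give a module over the degenerate affine Hecke algebra. -/
noncomputable def deformedSwap {n : ℕ} {i j : Fin n} (h : i ≠ j) : Module.End ℂ (Pol n) :=
  (MvPolynomial.rename (R := ℂ) (Equiv.swap i j)).toLinearMap - dividedDiff h

theorem eval_deformedSwap {n : ℕ} {i j : Fin n} (h : i ≠ j) (p : Pol n) {x : Fin n → ℂ}
    (hx : x i ≠ x j) : MvPolynomial.eval x (deformedSwap h p)
      = (1 + (x i - x j)⁻¹) * MvPolynomial.eval (x ∘ Equiv.swap i j) p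
        - (x i - x j)⁻¹ * MvPolynomial.eval x p := by
  have h1 := congrArg (MvPolynomial.eval x) (mul_dividedDiff h p)
  simp only [map_mul, map_sub, MvPolynomial.eval_X, MvPolynomial.eval_rename] at h1
  have h2 : x i - x j ≠ 0 := sub_ne_zero.2 hx
  rw [deformedSwap, LinearMap.sub_apply, map_sub, AlgHom.toLinearMap_apply,
    MvPolynomial.eval_rename]
  refine mul_left_cancel₀ h2 ?_
  rw [mul_sub, h1]
  field_simp
  ring

theorem deformedSwap_mul_self {n : ℕ} {i j : Fin n} (h : i ≠ j) :
    deformedSwap h * deformedSwap h = 1 := by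
  refine LinearMap.ext fun p => Pol.ext_of_injective fun x hx => ?_
  have hij : x i ≠ x j := hx.ne h
  have hji : (x ∘ Equiv.swap i j) i ≠ (x ∘ Equiv.swap i j) j := by simpa using hij.symm
  rw [Module.End.mul_apply, eval_deformedSwap h _ hij, eval_deformedSwap h _ hij,
    eval_deformedSwap h _ hji]
  have e : (x ∘ Equiv.swap i j) ∘ Equiv.swap i j = x := by ext a; simp
  simp only [e, Function.comp_apply, Equiv.swap_apply_left, Equiv.swap_apply_right,
    Module.End.one_apply]
  have h1 : x i - x j ≠ 0 := sub_ne_zero.2 hij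
  have h2 : x j - x i ≠ 0 := sub_ne_zero.2 hij.symm
  have h3 : x j - x i = -(x i - x j) := by ring
  rw [h3]
  field_simp
  ring

theorem deformedSwap_comm {n : ℕ} {i j k l : Fin n} (h : i ≠ j) (h' : k ≠ l) (hik : i ≠ k)
    (hil : i ≠ l) (hjk : j ≠ k) (hjl : j ≠ l) :
    deformedSwap h * deformedSwap h' = deformedSwap h' * deformedSwap h := by
  refine LinearMap.ext fun p => Pol.ext_of_injective fun x hx => ?_
  have e : (x ∘ Equiv.swap i j) ∘ Equiv.swap k l = (x ∘ Equiv.swap k l) ∘ Equiv.swap i j := by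
    have hd : Equiv.swap i j * Equiv.swap k l = Equiv.swap k l * Equiv.swap i j :=
      (Equiv.Perm.disjoint_swap_swap (by simp [*])).commute.eq
    rw [Function.comp_assoc, Function.comp_assoc, ← Equiv.Perm.coe_mul, ← Equiv.Perm.coe_mul, hd]
  have s1 : Equiv.swap i j k = k := Equiv.swap_apply_of_ne_of_ne hik.symm hjk.symm
  have s2 : Equiv.swap i j l = l := Equiv.swap_apply_of_ne_of_ne hil.symm hjl.symm
  have s3 : Equiv.swap k l i = i := Equiv.swap_apply_of_ne_of_ne hik hil
  have s4 : Equiv.swap k l j = j := Equiv.swap_apply_of_ne_of_ne hjk hjl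
  have hij : x i ≠ x j := hx.ne h
  have hkl : x k ≠ x l := hx.ne h'
  simp only [Module.End.mul_apply]
  rw [eval_deformedSwap h _ hij, eval_deformedSwap h' _ hkl, eval_deformedSwap h' _ hkl,
    eval_deformedSwap h _ hij, eval_deformedSwap h' _ (by simpa [s1, s2] using hkl),
    eval_deformedSwap h _ (by simpa [s3, s4] using hij), e]
  simp only [Function.comp_apply, s1, s2, s3, s4]
  ring

theorem deformedSwap_braid {n : ℕ} {i j k : Fin n} (hij : i ≠ j) (hik : i ≠ k) (hjk : j ≠ k) :
    deformedSwap hij * deformedSwap hjk * deformedSwap hij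
      = deformedSwap hjk * deformedSwap hij * deformedSwap hjk := by
  refine LinearMap.ext fun p => Pol.ext_of_injective fun x hx => ?_
  have e : ((x ∘ Equiv.swap j k) ∘ Equiv.swap i j) ∘ Equiv.swap j k
      = ((x ∘ Equiv.swap i j) ∘ Equiv.swap j k) ∘ Equiv.swap i j := by
    simp only [Function.comp_assoc, ← Equiv.Perm.coe_mul]
    rw [AdjacentTransposition.swap_braid hij hik hjk]
  have e1 : (x ∘ Equiv.swap i j) ∘ Equiv.swap i j = x := by ext a; simp
  have e2 : (x ∘ Equiv.swap j k) ∘ Equiv.swap j k = x := by ext a; simp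
  have s1 : Equiv.swap i j k = k := Equiv.swap_apply_of_ne_of_ne hik.symm hjk.symm
  have s2 : Equiv.swap j k i = i := Equiv.swap_apply_of_ne_of_ne hij hik
  have nij : x i ≠ x j := hx.ne hij
  have nik : x i ≠ x k := hx.ne hik
  have njk : x j ≠ x k := hx.ne hjk
  simp only [Module.End.mul_apply]
  have E1 : ∀ (q : Pol n) (y : Fin n → ℂ), Function.Injective y → MvPolynomial.eval y
      (deformedSwap hij q) = (1 + (y i - y j)⁻¹) * MvPolynomial.eval (y ∘ Equiv.swap i j) q
        - (y i - y j)⁻¹ * MvPolynomial.eval y q := fun q y hy =>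
    eval_deformedSwap hij q (hy.ne hij)
  have E2 : ∀ (q : Pol n) (y : Fin n → ℂ), Function.Injective y → MvPolynomial.eval y
      (deformedSwap hjk q) = (1 + (y j - y k)⁻¹) * MvPolynomial.eval (y ∘ Equiv.swap j k) q
        - (y j - y k)⁻¹ * MvPolynomial.eval y q := fun q y hy =>
    eval_deformedSwap hjk q (hy.ne hjk)
  have i1 := hx.comp (Equiv.swap i j).injective
  have i2 := hx.comp (Equiv.swap j k).injective
  have i12 := i1.comp (Equiv.swap j k).injective
  have i21 := i2.comp (Equiv.swap i j).injective
  simp only [E1 _ _ hx, E1 _ _ i1, E1 _ _ i2, E1 _ _ i12, E2 _ _ hx, E2 _ _ i1, E2 _ _ i2,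
    E2 _ _ i21, e, e1, e2]
  simp only [Function.comp_apply, s1, s2, Equiv.swap_apply_left, Equiv.swap_apply_right]
  generalize MvPolynomial.eval _ p = A1
  generalize MvPolynomial.eval _ p = A2
  generalize MvPolynomial.eval _ p = A3
  generalize MvPolynomial.eval _ p = A4
  generalize MvPolynomial.eval _ p = A5
  generalize MvPolynomial.eval _ p = A6
  have h1 : x i - x j ≠ 0 := sub_ne_zero.2 nij
  have h2 : x i - x k ≠ 0 := sub_ne_zero.2 nik
  have h3 : x j - x k ≠ 0 := sub_ne_zero.2 njk
  have h4 : x j - x i = -(x i - x j) := by ring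
  have h5 : x k - x j = -(x j - x k) := by ring
  rw [h4, h5]
  have h6 : x i - x k = (x i - x j) + (x j - x k) := by ring
  rw [h6] at h2 ⊢
  generalize x i - x j = a at *
  generalize x j - x k = b at *
  field_simp
  ring

namespace AdjacentTransposition

/-- The operator `deformedSwap` for the `i`-th and `i + 1`-st variables, and the identity if there are
no such variables. -/
noncomputable def deformed (n i : ℕ) : Module.End ℂ (Pol n) :=
  if hi : i + 1 < n then
    deformedSwap (i := (⟨i, by omega⟩ : Fin n)) (j := ⟨i + 1, hi⟩) (by simp [Fin.ext_iff]) else 1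

theorem relations_deformed (n : ℕ) : Relations n (deformed n) := by
  refine ⟨fun i hi => ?_, fun i hi => ?_, fun i j hij hj => ?_⟩
  · rw [deformed, dif_pos hi, deformedSwap_mul_self]
  · rw [deformed, deformed, dif_pos (by omega), dif_pos (by omega), deformedSwap_braid]
    rw [ne_eq, Fin.mk.injEq]; omega
  · rw [deformed, deformed, dif_pos (by omega), dif_pos (by omega), deformedSwap_comm] <;>
      (rw [ne_eq, Fin.mk.injEq]; omega)

end AdjacentTransposition

/-- The action of the symmetric group on polynomials in which the adjacent transpositions act by
`p ↦ s p - ∂ p`. -/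
noncomputable def deformedAction (n : ℕ) : Equiv.Perm (Fin n) →* Module.End ℂ (Pol n) :=
  (AdjacentTransposition.relations_deformed n).exists_hom.choose

theorem deformedAction_swap {n : ℕ} {i j : Fin n} (h : i ≠ j) (hij : (i : ℕ) + 1 = j) :
    deformedAction n (Equiv.swap i j) = deformedSwap h := by
  have := (AdjacentTransposition.relations_deformed n).exists_hom.choose_spec i j hij
  obtain ⟨i, hi⟩ := i
  obtain ⟨j, hj⟩ := j
  obtain rfl : i + 1 = j := hij
  exact this.trans (dif_pos hj)

/-- Induction along left multiplication by adjacent transpositions. -/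
theorem AdjacentTransposition.perm_induction {n : ℕ} {C : Equiv.Perm (Fin n) → Prop} (one : C 1)
    (mul : ∀ (i j : Fin n) (w : Equiv.Perm (Fin n)), (i : ℕ) + 1 = j → C w → C (Equiv.swap i j * w))
    (w : Equiv.Perm (Fin n)) : C w := by
  have hw : w ∈ Submonoid.closure {w : Equiv.Perm (Fin n) |
      ∃ i j : Fin n, (i : ℕ) + 1 = j ∧ w = Equiv.swap i j} := by
    rw [mclosure_swap_eq_top]; trivial
  induction hw using Submonoid.closure_induction_left with
  | one => exact one
  | mul_left x hx y hy ih =>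
    obtain ⟨i, j, hij, rfl⟩ := hx
    exact mul i j y hij ih

theorem ne_of_val_add_one_eq {n : ℕ} {i j : Fin n} (hij : (i : ℕ) + 1 = j) : i ≠ j := by
  rintro rfl; omega

theorem eval_comp_swap_of_isSymmetric {n : ℕ} {q : Pol n} (hq : q.IsSymmetric) (x : Fin n → ℂ)
    (e : Equiv.Perm (Fin n)) : MvPolynomial.eval (x ∘ e) q = MvPolynomial.eval x q := by
  rw [← MvPolynomial.eval_rename, hq e]

theorem deformedAction_symm_mul {n : ℕ} {q : Pol n} (hq : q.IsSymmetric)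
    (w : Equiv.Perm (Fin n)) (p : Pol n) :
    deformedAction n w (q * p) = q * deformedAction n w p := by
  induction w using AdjacentTransposition.perm_induction generalizing p with
  | one => simp
  | mul i j w hij ih =>
    have h := ne_of_val_add_one_eq hij
    rw [map_mul (deformedAction n), Module.End.mul_apply, Module.End.mul_apply, ih,
      deformedAction_swap h hij]
    refine Pol.ext_of_injective fun x hx => ?_
    rw [map_mul (MvPolynomial.eval x), eval_deformedSwap h _ (hx.ne h),
      eval_deformedSwap h _ (hx.ne h), map_mul (MvPolynomial.eval x),
      map_mul (MvPolynomial.eval (x ∘ Equiv.swap i j)), eval_comp_swap_of_isSymmetric hq]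
    ring

/-! ### A cyclic vector for the deformed action -/

namespace AdjacentTransposition

variable {n : ℕ}

/-- The pairs of letters whose order is preserved by a permutation. -/
def orderedPairs (u : Equiv.Perm (Fin n)) : Finset (Fin n × Fin n) :=
  Finset.univ.filter fun t => t.1 < t.2 ∧ u t.1 < u t.2

theorem mem_orderedPairs {u : Equiv.Perm (Fin n)} {a b : Fin n} :
    (a, b) ∈ orderedPairs u ↔ a < b ∧ u a < u b := by simp [orderedPairs]

theorem swap_lt_swap_iff {i j : Fin n} (hij : (i : ℕ) + 1 = j) {a b : Fin n}
    (h1 : ¬(a = i ∧ b = j)) (h2 : ¬(a = j ∧ b = i)) :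
    Equiv.swap i j a < Equiv.swap i j b ↔ a < b := by
  simp only [Equiv.swap_apply_def, Fin.lt_def, Fin.ext_iff] at *
  split_ifs <;> omega

theorem orderedPairs_swap_mul (u : Equiv.Perm (Fin n)) {i j : Fin n} (hij : (i : ℕ) + 1 = j)
    (h : u⁻¹ i < u⁻¹ j) :
    orderedPairs (Equiv.swap i j * u) = (orderedPairs u).erase (u⁻¹ i, u⁻¹ j) := by
  ext ⟨a, b⟩
  simp only [Finset.mem_erase, mem_orderedPairs, ne_eq, Prod.mk.injEq, Equiv.Perm.mul_apply,
    Equiv.Perm.eq_inv_iff_eq]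
  by_cases h1 : u a = i ∧ u b = j
  · have : i < j := Fin.lt_def.2 (by omega)
    simp [h1.1, h1.2, this.le]
  · by_cases h2 : u a = j ∧ u b = i
    · have : ¬a < b := by
        rw [← h2.1, ← h2.2] at h
        simpa using h.le
      simp [this]
    · rw [swap_lt_swap_iff hij h1 h2]
      simp [h1]

theorem card_orderedPairs_swap_mul (u : Equiv.Perm (Fin n)) {i j : Fin n}
    (hij : (i : ℕ) + 1 = j) (h : u⁻¹ i < u⁻¹ j) :
    (orderedPairs (Equiv.swap i j * u)).card + 1 = (orderedPairs u).card := by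
  rw [orderedPairs_swap_mul u hij h]
  refine Finset.card_erase_add_one ?_
  have : i < j := Fin.lt_def.2 (by omega)
  simpa [orderedPairs, this] using h

theorem card_orderedPairs_le (u : Equiv.Perm (Fin n)) {i j : Fin n} (hij : (i : ℕ) + 1 = j) :
    (orderedPairs u).card ≤ (orderedPairs (Equiv.swap i j * u)).card + 1 := by
  rcases lt_or_ge (u⁻¹ i) (u⁻¹ j) with h | h
  · exact (card_orderedPairs_swap_mul u hij h).ge
  · have hne : u⁻¹ j ≠ u⁻¹ i := (u⁻¹).injective.ne (ne_of_val_add_one_eq hij).symm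
    have := card_orderedPairs_swap_mul (Equiv.swap i j * u) hij (by
      simpa [mul_inv_rev] using lt_of_le_of_ne h hne)
    rw [Equiv.swap_mul_self_mul] at this
    omega

theorem orderedPairs_revPerm : orderedPairs (Fin.revPerm : Equiv.Perm (Fin n)) = ∅ := by
  refine Finset.filter_eq_empty_iff.2 fun t _ ht => ?_
  have := ht.2
  rw [Fin.revPerm_apply, Fin.revPerm_apply, Fin.rev_lt_rev] at this
  exact lt_asymm ht.1 this

/-- A permutation of `Fin n` with `x ≤ w x` for all `x` is the identity. -/
theorem perm_eq_one_of_le {w : Equiv.Perm (Fin n)} (h : ∀ x, x ≤ w x) : w = 1 := by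
  have hs : ∑ x, ((w x : Fin n) : ℕ) = ∑ x : Fin n, (x : ℕ) :=
    Equiv.sum_comp w fun x : Fin n => (x : ℕ)
  ext x
  by_contra hne
  have hlt : (x : ℕ) < w x := lt_of_le_of_ne (h x) fun e => hne e.symm
  exact (Finset.sum_lt_sum (fun (y : Fin n) _ => Fin.le_def.1 (h y)) ⟨x, Finset.mem_univ x, hlt⟩).ne' hs

theorem eq_revPerm_of_antitone {u : Equiv.Perm (Fin n)}
    (h : ∀ i j : Fin n, (i : ℕ) + 1 = j → u⁻¹ j ≤ u⁻¹ i) : u = Fin.revPerm := by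
  have hle : ∀ x : Fin n, x ≤ (u⁻¹ * Fin.revPerm : Equiv.Perm (Fin n)) x := by
    have : ∀ (k : ℕ) (hk : k < n), k ≤ u⁻¹ (Fin.rev ⟨k, hk⟩) := by
      intro k hk
      induction k with
      | zero => exact Nat.zero_le _
      | succ k ih =>
        have h1 := ih (by omega)
        have hval : (Fin.rev ⟨k + 1, hk⟩ : ℕ) + 1 = Fin.rev (⟨k, by omega⟩ : Fin n) := by
          simp only [Fin.val_rev]; omega
        have h2 := h _ _ hval
        have h3 := (u⁻¹).injective.ne (ne_of_val_add_one_eq hval).symm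
        have h4 := Fin.lt_def.1 (lt_of_le_of_ne h2 h3)
        omega
    exact fun x => Fin.le_def.2 (this x x.2)
  have h1 := perm_eq_one_of_le hle
  rw [inv_mul_eq_one] at h1
  exact h1

theorem revPerm_mul_revPerm : (Fin.revPerm * Fin.revPerm : Equiv.Perm (Fin n)) = 1 := by
  ext x; simp

theorem card_orderedPairs_lt {u : Equiv.Perm (Fin n)} (hu : u ≠ 1) :
    (orderedPairs u).card < (orderedPairs (1 : Equiv.Perm (Fin n))).card := by
  obtain ⟨i, j, hij, h⟩ : ∃ i j : Fin n, (i : ℕ) + 1 = j ∧ u⁻¹ j < u⁻¹ i := by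
    by_contra! hc
    refine hu ?_
    have : Fin.revPerm * u = Fin.revPerm := by
      refine eq_revPerm_of_antitone fun i j hij => ?_
      have := hc (Fin.rev j) (Fin.rev i) (by simp only [Fin.val_rev]; omega)
      simpa [mul_inv_rev] using this
    simpa using this
  refine Finset.card_lt_card ⟨fun t ht => ?_, fun hs => ?_⟩
  · simp only [orderedPairs, Finset.mem_filter, Finset.mem_univ, true_and] at ht ⊢
    exact ⟨ht.1, ht.1⟩
  · have : (u⁻¹ j, u⁻¹ i) ∈ orderedPairs u := hs (by simpa [orderedPairs] using h)
    have h1 := (mem_orderedPairs.1 this).2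
    rw [show u (u⁻¹ j) = j by simp, show u (u⁻¹ i) = i by simp] at h1
    have := Fin.lt_def.1 h1
    omega

end AdjacentTransposition

section

open AdjacentTransposition

variable {n : ℕ}

theorem eval_swap_mul (x : Fin n → ℂ) (hx : Function.Injective x) (p : Pol n)
    (u w : Equiv.Perm (Fin n)) {i j : Fin n} (hij : (i : ℕ) + 1 = j) :
    MvPolynomial.eval (x ∘ ⇑u⁻¹) (deformedAction n (Equiv.swap i j * w) p)
      = (1 + (x (u⁻¹ i) - x (u⁻¹ j))⁻¹) *
          MvPolynomial.eval (x ∘ ⇑(Equiv.swap i j * u)⁻¹) (deformedAction n w p)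
        - (x (u⁻¹ i) - x (u⁻¹ j))⁻¹ * MvPolynomial.eval (x ∘ ⇑u⁻¹) (deformedAction n w p) := by
  have h := ne_of_val_add_one_eq hij
  rw [map_mul (deformedAction n), Module.End.mul_apply, deformedAction_swap h hij,
    eval_deformedSwap h _ ((hx.comp (u⁻¹).injective).ne h), mul_inv_rev, Equiv.swap_inv]
  rfl

/-- If, among the points obtained from `x` by permuting the coordinates, `p` vanishes at all but
the one with the coordinates in reverse order, then the values of `deformedAction n w p` at these
points form a triangular matrix: the values vanish in the range below. -/
theorem eval_deformedAction_eq_zero {x : Fin n → ℂ} (hx : Function.Injective x) {p : Pol n}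
    (hp : ∀ u : Equiv.Perm (Fin n), u ≠ Fin.revPerm → MvPolynomial.eval (x ∘ ⇑u⁻¹) p = 0)
    (y u : Equiv.Perm (Fin n)) (h : (orderedPairs y).card < (orderedPairs u).card) :
    MvPolynomial.eval (x ∘ ⇑u⁻¹) (deformedAction n (y * Fin.revPerm) p) = 0 := by
  induction hm : (orderedPairs y).card generalizing y u with
  | zero =>
    have hy : y = Fin.revPerm := by
      by_contra hne
      obtain ⟨i, j, hij, hlt⟩ : ∃ i j : Fin n, (i : ℕ) + 1 = j ∧ y⁻¹ i < y⁻¹ j := by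
        by_contra! hc
        exact hne (eq_revPerm_of_antitone hc)
      have := card_orderedPairs_swap_mul y hij hlt
      omega
    rw [hy, revPerm_mul_revPerm, map_one, Module.End.one_apply]
    refine hp u ?_
    rintro rfl
    simp [orderedPairs_revPerm] at h
  | succ m ih =>
    obtain ⟨i, j, hij, hlt⟩ : ∃ i j : Fin n, (i : ℕ) + 1 = j ∧ y⁻¹ i < y⁻¹ j := by
      by_contra! hc
      rw [eq_revPerm_of_antitone hc, orderedPairs_revPerm] at hm
      simp at hm
    have hc := card_orderedPairs_swap_mul y hij hlt
    have hu := card_orderedPairs_le u hij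
    have e : y * Fin.revPerm = Equiv.swap i j * (Equiv.swap i j * y * Fin.revPerm) := by
      rw [mul_assoc, Equiv.swap_mul_self_mul]
    rw [e, eval_swap_mul x hx p u _ hij, ih _ _ (by omega) (by omega), ih _ _ (by omega) (by omega)]
    ring

/-- The diagonal entries of the triangular matrix of `eval_deformedAction_eq_zero`. -/
theorem eval_deformedAction_diag {x : Fin n → ℂ} (hx : Function.Injective x) {p : Pol n}
    (hp : ∀ u : Equiv.Perm (Fin n), u ≠ Fin.revPerm → MvPolynomial.eval (x ∘ ⇑u⁻¹) p = 0)
    (u : Equiv.Perm (Fin n)) :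
    MvPolynomial.eval (x ∘ ⇑u⁻¹) (deformedAction n (u * Fin.revPerm) p)
      = (∏ t ∈ orderedPairs u, (1 + (x t.1 - x t.2)⁻¹)) * MvPolynomial.eval (x ∘ Fin.rev) p := by
  induction hm : (orderedPairs u).card generalizing u with
  | zero =>
    have hy : u = Fin.revPerm := by
      by_contra hne
      obtain ⟨i, j, hij, hlt⟩ : ∃ i j : Fin n, (i : ℕ) + 1 = j ∧ u⁻¹ i < u⁻¹ j := by
        by_contra! hc
        exact hne (eq_revPerm_of_antitone hc)
      have := card_orderedPairs_swap_mul u hij hlt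
      omega
    rw [hy, revPerm_mul_revPerm, map_one, Module.End.one_apply, orderedPairs_revPerm,
      Finset.prod_empty, one_mul]
    rfl
  | succ m ih =>
    obtain ⟨i, j, hij, hlt⟩ : ∃ i j : Fin n, (i : ℕ) + 1 = j ∧ u⁻¹ i < u⁻¹ j := by
      by_contra! hc
      rw [eq_revPerm_of_antitone hc, orderedPairs_revPerm] at hm
      simp at hm
    have hc := card_orderedPairs_swap_mul u hij hlt
    have e : u * Fin.revPerm = Equiv.swap i j * (Equiv.swap i j * u * Fin.revPerm) := by
      rw [mul_assoc, Equiv.swap_mul_self_mul]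
    have hmem : (u⁻¹ i, u⁻¹ j) ∈ orderedPairs u := by
      have : i < j := Fin.lt_def.2 (by omega)
      simpa [orderedPairs, this] using hlt
    rw [e, eval_swap_mul x hx p u _ hij, eval_deformedAction_eq_zero hx hp _ u (by omega),
      ih _ (by omega), orderedPairs_swap_mul u hij hlt, mul_zero, sub_zero, ← mul_assoc,
      Finset.mul_prod_erase (orderedPairs u) (fun t => 1 + (x t.1 - x t.2)⁻¹) hmem]

/-- The polynomial `∏ (z_i - b_j)` over the pairs with `i + j + 1 < n` (numbering from `0`). If the
`b_j` are pairwise distinct, it vanishes at all points obtained from `b` by permuting the coordinates,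
except for the one with the coordinates in reverse order. -/
noncomputable def staircase (b : Fin n → ℂ) : Pol n :=
  ∏ t ∈ Finset.univ.filter (fun t : Fin n × Fin n => t.2 < Fin.rev t.1),
    (MvPolynomial.X t.1 - MvPolynomial.C (b t.2))

theorem eval_staircase_eq_zero (x : Fin n → ℂ) {u : Equiv.Perm (Fin n)} (hu : u ≠ Fin.revPerm) :
    MvPolynomial.eval (x ∘ ⇑u⁻¹) (staircase x) = 0 := by
  obtain ⟨i, hi⟩ : ∃ i, u⁻¹ i < Fin.rev i := by
    by_contra! hc
    refine hu ?_
    have : u⁻¹ * Fin.revPerm = 1 := perm_eq_one_of_le fun y => by simpa using hc (Fin.rev y)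
    rwa [inv_mul_eq_one] at this
  rw [staircase, map_prod]
  exact Finset.prod_eq_zero (i := (i, u⁻¹ i)) (by simpa using hi) (by simp)

theorem eval_staircase_rev (x : Fin n → ℂ) :
    MvPolynomial.eval (x ∘ Fin.rev) (staircase x)
      = ∏ t ∈ orderedPairs (1 : Equiv.Perm (Fin n)), (x t.2 - x t.1) := by
  rw [staircase, map_prod]
  refine Finset.prod_nbij' (fun t => (t.2, Fin.rev t.1)) (fun t => (Fin.rev t.2, t.1))
    ?_ ?_ ?_ ?_ ?_ <;> simp [orderedPairs]

theorem eval_deformedAction_staircase_of_injective {x : Fin n → ℂ} (hx : Function.Injective x)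
    (w : Equiv.Perm (Fin n)) :
    MvPolynomial.eval x (deformedAction n w (staircase x)) = if w = Fin.revPerm then
      ∏ t ∈ orderedPairs (1 : Equiv.Perm (Fin n)), (x t.2 - x t.1 - 1) else 0 := by
  have hp : ∀ u : Equiv.Perm (Fin n), u ≠ Fin.revPerm →
      MvPolynomial.eval (x ∘ ⇑u⁻¹) (staircase x) = 0 := fun u hu => eval_staircase_eq_zero x hu
  have hx1 : x ∘ ⇑(1 : Equiv.Perm (Fin n))⁻¹ = x := by ext; simp
  split_ifs with hw
  · have := eval_deformedAction_diag hx hp 1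
    rw [one_mul, hx1, eval_staircase_rev, ← Finset.prod_mul_distrib] at this
    rw [hw, this]
    refine Finset.prod_congr rfl fun t ht => ?_
    have ht' : t.1 ≠ t.2 := (Finset.mem_filter.1 ht).2.1.ne
    have h1 : x t.1 - x t.2 ≠ 0 := sub_ne_zero.2 (hx.ne ht')
    field_simp
    ring
  · have hy : w * Fin.revPerm ≠ 1 := by
      intro h
      refine hw ?_
      have := congrArg (· * Fin.revPerm) h
      simpa [mul_assoc, revPerm_mul_revPerm] using this
    have := eval_deformedAction_eq_zero hx hp _ 1 (card_orderedPairs_lt hy)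
    rwa [mul_assoc, revPerm_mul_revPerm, mul_one, hx1] at this

/-- The values at `b` of the translates of `staircase b` under the deformed action. If `b_k ≠ b_j + 1`
for `j < k`, the value for `w = Fin.revPerm` is nonzero, and then the translates form a basis dual, up
to a scalar and an enumeration, to the linear forms `p ↦ eval b (deformedAction n w p)`. -/
theorem eval_deformedAction_staircase (b : Fin n → ℂ) (w : Equiv.Perm (Fin n)) :
    MvPolynomial.eval b (deformedAction n w (staircase b)) = if w = Fin.revPerm then
      ∏ t ∈ orderedPairs (1 : Equiv.Perm (Fin n)), (b t.2 - b t.1 - 1) else 0 := by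
  -- Both sides are polynomials in `b`, so that it is enough to compare them for distinct `b_j`.
  set S := Finset.univ.filter (fun t : Fin n × Fin n => t.2 < Fin.rev t.1) with hS
  set K : Pol n := ∑ T ∈ S.powerset, (∏ t ∈ S \ T, -MvPolynomial.X t.2) *
    deformedAction n w (∏ t ∈ T, MvPolynomial.X t.1) with hK
  set K' : Pol n := if w = Fin.revPerm then ∏ t ∈ orderedPairs (1 : Equiv.Perm (Fin n)),
    (MvPolynomial.X t.2 - MvPolynomial.X t.1 - 1) else 0 with hK'
  have h1 : ∀ x : Fin n → ℂ,
      MvPolynomial.eval x (deformedAction n w (staircase x)) = MvPolynomial.eval x K := fun x => by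
    have : staircase x = ∑ T ∈ S.powerset, (∏ t ∈ S \ T, -x t.2) • ∏ t ∈ T, MvPolynomial.X t.1 := by
      rw [staircase, ← hS]
      simp only [sub_eq_add_neg]
      rw [Finset.prod_add]
      refine Finset.sum_congr rfl fun T _ => ?_
      rw [MvPolynomial.smul_eq_C_mul, map_prod, mul_comm]
      simp only [map_neg]
    rw [this, hK]
    simp only [map_sum, map_smul, map_mul, map_prod, map_neg, MvPolynomial.eval_X,
      MvPolynomial.smul_eval]
  have h2 : ∀ x : Fin n → ℂ, MvPolynomial.eval x K' = if w = Fin.revPerm then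
      ∏ t ∈ orderedPairs (1 : Equiv.Perm (Fin n)), (x t.2 - x t.1 - 1) else 0 := fun x => by
    rw [hK']
    split_ifs <;> simp [map_prod]
  rw [h1, ← h2, Pol.ext_of_injective (p := K) (q := K') fun x hx => by
    rw [← h1, h2, eval_deformedAction_staircase_of_injective hx]]

end

/-! ### The dimension of the algebra of polynomials modulo symmetric relations -/

section

universe u

open Polynomial in
/-- An algebra generated over `R` by the roots of a monic polynomial of degree `n` that splits is
spanned by `n!` elements: adjoining one root gives an algebra spanned by `n` powers of this root, over
which the other roots are roots of a monic polynomial of degree `n - 1`. -/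
theorem exists_card_le_factorial_adjoin_le_span {A : Type u} [CommRing A] (n : ℕ) :
    ∀ {R : Type u} [CommRing R] [Algebra R A] (z : Fin n → A) (χ : R[X]), χ.Monic →
      χ.natDegree = n → χ.map (algebraMap R A) = ∏ i, (X - C (z i)) →
      ∃ s : Finset A, s.card ≤ n.factorial ∧
        Subalgebra.toSubmodule (Algebra.adjoin R (Set.range z)) ≤ Submodule.span R (s : Set A) := by
  classical
  induction n with
  | zero =>
    intro R _ _ z χ _ _ _
    refine ⟨{1}, by simp, ?_⟩
    rw [Set.range_eq_empty, Algebra.adjoin_empty, Finset.coe_singleton,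
      ← Submodule.one_eq_span, Algebra.toSubmodule_bot]
  | succ n ih =>
    intro R _ _ z χ hχ hd hz
    rcases subsingleton_or_nontrivial A with hA | hA
    · refine ⟨∅, by simp, fun a _ => ?_⟩
      rw [Subsingleton.elim a 0]
      exact Submodule.zero_mem _
    set R' := Algebra.adjoin R {z 0} with hR'
    let z₀ : R' := ⟨z 0, Algebra.subset_adjoin rfl⟩
    have hroot : aeval (z 0) χ = 0 := by
      rw [aeval_def, ← eval_map, hz, eval_prod]
      exact Finset.prod_eq_zero (Finset.mem_univ 0) (by simp)
    have hroot' : (χ.map (algebraMap R R')).IsRoot z₀ := by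
      rw [IsRoot, eval_map, ← aeval_def]
      refine Subtype.ext ?_
      exact (aeval_algebraMap_apply A z₀ χ).symm.trans hroot
    set χ' := χ.map (algebraMap R R') /ₘ (X - C z₀) with hχ'
    have hmul : (X - C z₀) * χ' = χ.map (algebraMap R R') := mul_divByMonic_eq_iff_isRoot.2 hroot'
    have hχ'm : χ'.Monic := by
      refine (monic_X_sub_C z₀).of_mul_monic_left ?_
      rw [hmul]; exact hχ.map _
    have hχ'z : χ'.map (algebraMap R' A) = ∏ i : Fin n, (X - C (z i.succ)) := by
      refine (monic_X_sub_C (z 0)).isRegular.left ?_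
      have := congrArg (Polynomial.map (algebraMap R' A)) hmul
      rw [Polynomial.map_mul, Polynomial.map_map, ← IsScalarTower.algebraMap_eq, hz,
        Fin.prod_univ_succ] at this
      simpa using this
    have hχ'd : χ'.natDegree = n := by
      have h1 := congrArg natDegree hχ'z
      rwa [hχ'm.natDegree_map, natDegree_prod_of_monic _ _ fun i _ => monic_X_sub_C _,
        Finset.sum_congr rfl fun i _ => natDegree_X_sub_C (z i.succ), Finset.sum_const,
        Finset.card_univ, Fintype.card_fin, smul_eq_mul, mul_one] at h1
    obtain ⟨s, hs, hle⟩ := ih (fun i => z i.succ) χ' hχ'm hχ'd hχ'z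
    set t := (Finset.range χ.natDegree).image (z 0 ^ ·) with ht
    have hspan : Submodule.span R (t : Set A) = Subalgebra.toSubmodule R' := by
      exact Submodule.span_range_natDegree_eq_adjoin hχ hroot
    refine ⟨Finset.image₂ (· * ·) t s, ?_, fun a ha => ?_⟩
    · refine (Finset.card_image₂_le _ _ _).trans ?_
      rw [Nat.factorial_succ]
      exact Nat.mul_le_mul (Finset.card_image_le.trans (by simp [hd])) hs
    · have ha' : a ∈ Algebra.adjoin R' (Set.range fun i : Fin n => z i.succ) := by
        have : Algebra.adjoin R (Set.range z) ≤ (Algebra.adjoin R'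
            (Set.range fun i : Fin n => z i.succ)).restrictScalars R := by
          refine Algebra.adjoin_le ?_
          rintro _ ⟨i, rfl⟩
          refine Fin.cases ?_ (fun i => ?_) i
          · exact (Subalgebra.mem_restrictScalars R).2 (Subalgebra.algebraMap_mem _ z₀)
          · exact (Subalgebra.mem_restrictScalars R).2
              (Algebra.subset_adjoin (Set.mem_range_self (f := fun i : Fin n => z i.succ) i))
        exact this ha
      have hmem : ∀ x ∈ Submodule.span R' (s : Set A),
          x ∈ Submodule.span R (t : Set A) * Submodule.span R (s : Set A) := by
        intro x hx
        induction hx using Submodule.span_induction with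
        | zero => exact Submodule.zero_mem _
        | add x y _ _ hx hy => exact Submodule.add_mem _ hx hy
        | mem x hx =>
          rw [← one_mul x]
          refine Submodule.mul_mem_mul ?_ (Submodule.subset_span hx)
          rw [hspan]
          exact R'.one_mem
        | smul r x _ hx =>
          have : (r : A) ∈ Submodule.span R (t : Set A) := by rw [hspan]; exact r.2
          have h2 := Submodule.mul_mem_mul this hx
          rw [← mul_assoc, hspan, R'.isIdempotentElem_toSubmodule.eq, ← hspan] at h2
          exact h2
      have := hmem a (hle ha')
      rw [Submodule.span_mul_span] at this
      rwa [Finset.coe_image₂]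

end

/-- The algebra `ℂ[z_1, …, z_n] / I` has dimension at most `n!` if `I` contains the coefficients of
`∏ (u - z_s) - ∏ (u - b_s)`. -/
theorem finrank_quotient_le_factorial {n : ℕ} (b : Fin n → ℂ) (I : Ideal (Pol n))
    (hI : ∏ i, (Polynomial.X - Polynomial.C (algebraMap ℂ (Pol n ⧸ I) (b i)))
      = ∏ i, (Polynomial.X - Polynomial.C (Ideal.Quotient.mk I (MvPolynomial.X i)))) :
    Module.Finite ℂ (Pol n ⧸ I) ∧ Module.finrank ℂ (Pol n ⧸ I) ≤ n.factorial := by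
  obtain ⟨s, hs, hle⟩ := exists_card_le_factorial_adjoin_le_span (R := ℂ) n
    (fun i => Ideal.Quotient.mk I (MvPolynomial.X i)) (∏ i, (Polynomial.X - Polynomial.C (b i)))
    (Polynomial.monic_prod_of_monic _ _ fun i _ => Polynomial.monic_X_sub_C _)
    (by rw [Polynomial.natDegree_prod_of_monic _ _ fun i _ => Polynomial.monic_X_sub_C _]; simp)
    (by rw [← hI, Polynomial.map_prod]; simp)
  have htop : Submodule.span ℂ (s : Set (Pol n ⧸ I)) = ⊤ := by
    refine top_le_iff.1 fun x _ => hle ?_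
    obtain ⟨p, rfl⟩ := Ideal.Quotient.mk_surjective x
    have hp : p ∈ Algebra.adjoin ℂ (Set.range (MvPolynomial.X : Fin n → Pol n)) := by
      rw [MvPolynomial.adjoin_range_X]; trivial
    have := Subalgebra.mem_map.2 ⟨p, hp, (rfl : Ideal.Quotient.mkₐ ℂ I p = _)⟩
    rw [AlgHom.map_adjoin (Ideal.Quotient.mkₐ ℂ I), ← Set.range_comp] at this
    exact this
  refine ⟨⟨⟨s, htop⟩⟩, le_trans ?_ hs⟩
  rw [← finrank_top ℂ (Pol n ⧸ I), ← htop]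
  exact finrank_span_finset_le_card s

/-! ### Polynomials modulo symmetric relations -/

section

open AdjacentTransposition

open Polynomial in
theorem prod_X_sub_C_eq_sum_aeval_esymm {n : ℕ} {B : Type*} [CommRing B] [Algebra ℂ B]
    (f : Fin n → B) :
    ∏ s : Fin n, (X - C (f s)) = X ^ n + ∑ j : Fin n,
      C ((-1) ^ (j.val + 1) * MvPolynomial.aeval f (MvPolynomial.esymm (Fin n) ℂ (j.val + 1)))
        * X ^ (n - (j.val + 1)) := by
  have h := Multiset.prod_X_sub_X_eq_sum_esymm (Finset.univ.val.map f)
  rw [Multiset.map_map, Multiset.card_map, Finset.card_val, Finset.card_univ, Fintype.card_fin] at h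
  refine Eq.trans h ?_
  rw [Finset.sum_range_succ', add_comm, Finset.sum_range]
  congr 1
  · simp [Multiset.esymm]
  · refine Finset.sum_congr rfl fun j _ => ?_
    rw [MvPolynomial.aeval_esymm_eq_multiset_esymm]
    simp [mul_assoc]

open Polynomial in
theorem coeff_X_pow_add_sum {n : ℕ} {B : Type*} [CommRing B] (c : Fin n → B) (k : Fin n) :
    (X ^ n + ∑ j : Fin n, C (c j) * X ^ (n - (j.val + 1)) : B[X]).coeff (n - (k.val + 1)) = c k := by
  have h1 : n - (k.val + 1) ≠ n := by have := k.2; omega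
  rw [coeff_add, coeff_X_pow, if_neg h1, zero_add, finsetSum_coeff, Finset.sum_eq_single k]
  · simp
  · intro j _ hj
    have : n - (k.val + 1) ≠ n - (j.val + 1) := by
      have := k.2; have := j.2; have : (j : ℕ) ≠ k := fun e => hj (Fin.ext e); omega
    simp [coeff_X_pow, this]
  · simp

variable {n : ℕ} {a b : Fin n → ℂ}

theorem eval_esymm_eq
    (hab : ∏ s : Fin n, (Polynomial.X - Polynomial.C (b s))
      = Polynomial.X ^ n + ∑ j : Fin n,
          Polynomial.C ((-1) ^ (j.val + 1) * a j) * Polynomial.X ^ (n - (j.val + 1))) (k : Fin n) :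
    MvPolynomial.eval b (MvPolynomial.esymm (Fin n) ℂ (k + 1)) = a k := by
  have h1 := congrArg (fun p => Polynomial.coeff p (n - (k.val + 1))) hab
  beta_reduce at h1
  rw [prod_X_sub_C_eq_sum_aeval_esymm, coeff_X_pow_add_sum, coeff_X_pow_add_sum,
    MvPolynomial.aeval_eq_eval] at h1
  exact mul_left_cancel₀ (pow_ne_zero _ (neg_ne_zero.2 one_ne_zero)) h1

theorem eval_val_eq_zero_of_mem
    (hab : ∏ s : Fin n, (Polynomial.X - Polynomial.C (b s))
      = Polynomial.X ^ n + ∑ j : Fin n,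
          Polynomial.C ((-1) ^ (j.val + 1) * a j) * Polynomial.X ^ (n - (j.val + 1))) {q : SymPol n} (hq : q ∈ symIdeal n a) :
    MvPolynomial.eval b (SymPol.val n q) = 0 := by
  have : symIdeal n a ≤ RingHom.ker ((MvPolynomial.eval b).comp (SymPol.val n).toRingHom) := by
    rw [symIdeal, Ideal.span_le]
    rintro _ ⟨i, rfl⟩
    change MvPolynomial.eval b (SymPol.val n (SymPol.esymm n (i + 1)
      - algebraMap ℂ (SymPol n) (a i))) = 0
    rw [map_sub (SymPol.val n), AlgHom.commutes, map_sub, MvPolynomial.algebraMap_eq,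
      MvPolynomial.eval_C, sub_eq_zero]
    exact eval_esymm_eq hab i
  exact this hq

theorem eval_deformedAction_eq_zero_of_mem
    (hab : ∏ s : Fin n, (Polynomial.X - Polynomial.C (b s))
      = Polynomial.X ^ n + ∑ j : Fin n,
          Polynomial.C ((-1) ^ (j.val + 1) * a j) * Polynomial.X ^ (n - (j.val + 1))) {p : Pol n}
    (hp : p ∈ (symIdeal n a).map (SymPol.val n)) (w : Equiv.Perm (Fin n)) :
    MvPolynomial.eval b (deformedAction n w p) = 0 := by
  suffices h : ∀ r, MvPolynomial.eval b (deformedAction n w (r * p)) = 0 by simpa using h 1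
  induction hp using Submodule.span_induction with
  | zero => simp
  | add x y _ _ hx hy => intro r; rw [mul_add, map_add, map_add, hx, hy, add_zero]
  | mem x hx =>
    intro r
    obtain ⟨q, hq, rfl⟩ := hx
    rw [mul_comm]
    refine (congrArg _ (deformedAction_symm_mul (SymPol.isSymmetric_val q) w r)).trans ?_
    rw [map_mul, eval_val_eq_zero_of_mem hab hq, zero_mul]
  | smul r' x hx ih => intro r; rw [smul_eq_mul, ← mul_assoc]; exact ih _

theorem esymm_sub_C_mem (k : Fin n) : MvPolynomial.esymm (Fin n) ℂ (k + 1) - MvPolynomial.C (a k)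
    ∈ (symIdeal n a).map (SymPol.val n) := by
  have h := Ideal.mem_map_of_mem (SymPol.val n)
    (Ideal.subset_span (s := Set.range fun i : Fin n =>
      SymPol.esymm n (i + 1) - algebraMap ℂ (SymPol n) (a i)) ⟨k, rfl⟩)
  rw [map_sub, AlgHom.commutes] at h
  exact h

theorem prod_X_sub_C_algebraMap_eq
    (hab : ∏ s : Fin n, (Polynomial.X - Polynomial.C (b s))
      = Polynomial.X ^ n + ∑ j : Fin n,
          Polynomial.C ((-1) ^ (j.val + 1) * a j) * Polynomial.X ^ (n - (j.val + 1)))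
    {I : Ideal (Pol n)}
    (hI : ∀ k : Fin n, MvPolynomial.esymm (Fin n) ℂ (k + 1) - MvPolynomial.C (a k) ∈ I) :
    ∏ i, (Polynomial.X - Polynomial.C (algebraMap ℂ (Pol n ⧸ I) (b i)))
      = ∏ i, (Polynomial.X - Polynomial.C (Ideal.Quotient.mk I (MvPolynomial.X i))) := by
  have h2 : MvPolynomial.aeval (R := ℂ) (fun i => Ideal.Quotient.mk I (MvPolynomial.X i))
      = Ideal.Quotient.mkₐ ℂ I := MvPolynomial.algHom_ext fun i => by
    rw [MvPolynomial.aeval_X]; rfl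
  have h3 : ∀ k : Fin n, MvPolynomial.aeval (R := ℂ)
      (fun i => Ideal.Quotient.mk I (MvPolynomial.X i)) (MvPolynomial.esymm (Fin n) ℂ (k + 1))
      = algebraMap ℂ (Pol n ⧸ I) (a k) := fun k => by
    rw [h2]
    exact Ideal.Quotient.eq.2 (hI k)
  have h1 := congrArg (Polynomial.map (algebraMap ℂ (Pol n ⧸ I))) hab
  rw [Polynomial.map_prod] at h1
  simp only [Polynomial.map_sub, Polynomial.map_X, Polynomial.map_C, Polynomial.map_add,
    Polynomial.map_pow, Polynomial.map_sum, Polynomial.map_mul, Polynomial.map_neg,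
    Polynomial.map_one, map_mul, map_pow, map_neg, map_one] at h1
  have h4 := prod_X_sub_C_eq_sum_aeval_esymm fun i => Ideal.Quotient.mk I (MvPolynomial.X i)
  simp only [h3, map_mul, map_pow, map_neg, map_one] at h4
  exact h1.trans h4.symm

theorem prod_sub_sub_one_ne_zero (hb : ∀ i j : Fin n, j < i → b i ≠ b j + 1) :
    ∏ t ∈ orderedPairs (1 : Equiv.Perm (Fin n)), (b t.2 - b t.1 - 1) ≠ 0 := by
  refine Finset.prod_ne_zero_iff.2 fun t ht => ?_
  rw [sub_sub, sub_ne_zero]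
  exact hb _ _ (mem_orderedPairs.1 ht).1

/-- A polynomial `p` lies in the ideal generated by `I_a` if `deformedAction n w p` vanishes at `b`
for all permutations `w`. By `eval_deformedAction_staircase` the values at `b` can be
prescribed arbitrarily, so that the polynomials with vanishing values form a subspace of codimension
`n!`. It contains the ideal, whose codimension is at most `n!`. -/
theorem mem_map_symIdeal_of_eval_eq_zero
    (hab : ∏ s : Fin n, (Polynomial.X - Polynomial.C (b s))
      = Polynomial.X ^ n + ∑ j : Fin n,
          Polynomial.C ((-1) ^ (j.val + 1) * a j) * Polynomial.X ^ (n - (j.val + 1)))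
    (hb : ∀ i j : Fin n, j < i → b i ≠ b j + 1) {p : Pol n}
    (hp : ∀ w, MvPolynomial.eval b (deformedAction n w p) = 0) :
    p ∈ (symIdeal n a).map (SymPol.val n) := by
  obtain ⟨hfin, hrank⟩ :=
    finrank_quotient_le_factorial b _ (prod_X_sub_C_algebraMap_eq hab esymm_sub_C_mem)
  have hzero : ∀ {p : Pol n}, p ∈ (symIdeal n a).map (SymPol.val n) → ∀ w,
      MvPolynomial.eval b (deformedAction n w p) = 0 := eval_deformedAction_eq_zero_of_mem hab
  set I := (symIdeal n a).map (SymPol.val n)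
  set κ := ∏ t ∈ orderedPairs (1 : Equiv.Perm (Fin n)), (b t.2 - b t.1 - 1) with hκ
  have hκ0 : κ ≠ 0 := prod_sub_sub_one_ne_zero hb
  let Ψ : Pol n →ₗ[ℂ] (Equiv.Perm (Fin n) → ℂ) :=
    LinearMap.pi fun w => (MvPolynomial.aeval b).toLinearMap ∘ₗ deformedAction n w
  have hΨ : ∀ p w, Ψ p w = MvPolynomial.eval b (deformedAction n w p) := fun p w => by
    rw [← MvPolynomial.aeval_eq_eval]; rfl
  let Φ : (Pol n ⧸ I) →ₗ[ℂ] (Equiv.Perm (Fin n) → ℂ) :=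
    ((I.restrictScalars ℂ).liftQ Ψ fun q hq => LinearMap.mem_ker.2 (funext fun w => by
      rw [hΨ]; exact hzero hq w)) ∘ₗ (Submodule.Quotient.restrictScalarsEquiv ℂ I).symm.toLinearMap
  have hΦ : ∀ q : Pol n, Φ (Ideal.Quotient.mk I q) = Ψ q := fun q => rfl
  have hsurj : Function.Surjective Φ := by
    intro g
    refine ⟨Ideal.Quotient.mk I (∑ w, (g w / κ) •
      deformedAction n (w⁻¹ * Fin.revPerm) (staircase b)), ?_⟩
    rw [hΦ]
    funext v
    rw [hΨ, map_sum, map_sum, Finset.sum_eq_single v]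
    · rw [map_smul, MvPolynomial.smul_eval, ← Module.End.mul_apply, ← map_mul,
        eval_deformedAction_staircase, mul_inv_cancel_left, if_pos rfl, div_mul_cancel₀ _ hκ0]
    · intro w _ hw
      rw [map_smul, MvPolynomial.smul_eval, ← Module.End.mul_apply, ← map_mul,
        eval_deformedAction_staircase, if_neg, mul_zero]
      rw [← mul_assoc, mul_eq_right, mul_inv_eq_one]
      exact hw.symm
    · simp
  have hdim : Module.finrank ℂ (Pol n ⧸ I) = Module.finrank ℂ (Equiv.Perm (Fin n) → ℂ) := by
    refine le_antisymm ?_ (LinearMap.finrank_le_finrank_of_surjective hsurj)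
    rwa [Module.finrank_fintype_fun_eq_card, Fintype.card_perm, Fintype.card_fin]
  have hinj := (LinearMap.injective_iff_surjective_of_finrank_eq_finrank hdim).2 hsurj
  refine Ideal.Quotient.eq_zero_iff_mem.1 (hinj ?_)
  rw [hΦ, map_zero]
  exact funext fun w => (hΨ p w).trans (hp w)

end

/-! ### The twisted action of the symmetric group and the invariants -/

section

open AdjacentTransposition

/-- The action of the symmetric group on `V = (ℂ^N)^{⊗ n}` by permutations of the factors. -/
noncomputable def TPow.permAction (N n : ℕ) : Equiv.Perm (Fin n) →* Module.End ℂ (TPow N n) where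
  toFun w := (PiTensorProduct.reindex ℂ (fun _ : Fin n => (Fin N → ℂ)) w).toLinearMap
  map_one' := by
    refine PiTensorProduct.ext (MultilinearMap.ext fun v => ?_)
    exact PiTensorProduct.reindex_tprod _ _
  map_mul' w w' := by
    have h : ∀ (u : Equiv.Perm (Fin n)) (v : Fin n → Fin N → ℂ),
        (PiTensorProduct.reindex ℂ (fun _ : Fin n => (Fin N → ℂ)) u).toLinearMap
          (PiTensorProduct.tprod ℂ v) = PiTensorProduct.tprod ℂ fun i => v (u.symm i) :=
      fun u v => PiTensorProduct.reindex_tprod _ _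
    refine PiTensorProduct.ext (MultilinearMap.ext fun v => ?_)
    rw [LinearMap.compMultilinearMap_apply, LinearMap.compMultilinearMap_apply,
      Module.End.mul_apply, h, h, h]
    rfl

namespace PolTPow

variable {N n : ℕ}

theorem add_tmul (p q : Pol n) (v : TPow N n) : tmul (p + q) v = tmul p v + tmul q v :=
  congrArg (ofTensor N n) (TensorProduct.add_tmul p q v)

theorem sub_tmul (p q : Pol n) (v : TPow N n) : tmul (p - q) v = tmul p v - tmul q v :=
  congrArg (ofTensor N n) (TensorProduct.sub_tmul p q v)

theorem zero_tmul (v : TPow N n) : (tmul 0 v : PolTPow N n) = 0 :=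
  congrArg (ofTensor N n) (TensorProduct.zero_tmul _ v)

theorem tmul_smul (c : ℂ) (p : Pol n) (v : TPow N n) :
    (tmul p (c • v) : PolTPow N n) = tmul (c • p) v :=
  congrArg (ofTensor N n) (TensorProduct.smul_tmul c p v).symm

variable (N n) in
/-- The action of the symmetric group on `𝒱` by the deformed action on polynomials and permutations
of the tensor factors. Its invariants are those of the action by the operators `sAct`, see
`mem_invariants_iff`. -/
noncomputable def twistedAction : Equiv.Perm (Fin n) →* Module.End ℂ (PolTPow N n) where
  toFun w := ofEnd N n (TensorProduct.map (deformedAction n w) (TPow.permAction N n w))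
  map_one' := by rw [map_one, map_one, TensorProduct.map_one, map_one]
  map_mul' w w' := by rw [map_mul, map_mul, TensorProduct.map_mul, map_mul]

theorem twistedAction_tmul (w : Equiv.Perm (Fin n)) (p : Pol n) (v : TPow N n) :
    twistedAction N n w (tmul p v) = tmul (deformedAction n w p) (TPow.permAction N n w v) := rfl

theorem twistedAction_smul {q : Pol n} (hq : q.IsSymmetric) (w : Equiv.Perm (Fin n))
    (f : PolTPow N n) : twistedAction N n w (q • f) = q • twistedAction N n w f := by
  induction f using induction_on with
  | h p v =>
    rw [smul_tmul, twistedAction_tmul, twistedAction_tmul, smul_tmul, deformedAction_symm_mul hq]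
  | hadd f g hf hg => rw [smul_add, map_add, map_add, smul_add, hf, hg]

theorem swapVars_divDiffOp {i j : Fin n} (h : i ≠ j) :
    swapVars N n i j * divDiffOp N n h = divDiffOp N n h := by
  refine end_ext fun p v => ?_
  change tmul (MvPolynomial.rename (Equiv.swap i j) (dividedDiff h p)) _ = tmul (dividedDiff h p) _
  congr 1
  refine mul_left_cancel₀ (X_sub_X_ne_zero h) ?_
  have h1 := mul_dividedDiff h p
  have h2 := congrArg (MvPolynomial.rename (Equiv.swap i j)) h1
  rw [map_mul, map_sub, map_sub, MvPolynomial.rename_X, MvPolynomial.rename_X,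
    Equiv.swap_apply_left, Equiv.swap_apply_right, MvPolynomial.rename_rename,
    show (⇑(Equiv.swap i j) ∘ ⇑(Equiv.swap i j)) = id by ext; simp, MvPolynomial.rename_id_apply]
    at h2
  rw [h1]
  linear_combination -h2

theorem swapVars_swapVars (i j : Fin n) : swapVars N n i j * swapVars N n i j = 1 :=
  end_ext fun p v => by
    simp only [Module.End.mul_apply, swapVars_pure, MvPolynomial.rename_rename]
    rw [show (⇑(Equiv.swap i j) ∘ ⇑(Equiv.swap i j)) = id by ext; simp,
      MvPolynomial.rename_id_apply]
    rfl

theorem twistedAction_swap {i j : Fin n} (h : i ≠ j) (hij : (i : ℕ) + 1 = j) :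
    twistedAction N n (Equiv.swap i j)
      = flip N n i j * (swapVars N n i j - divDiffOp N n h) := by
  refine end_ext fun p v => ?_
  rw [twistedAction_tmul, deformedAction_swap h hij]
  change tmul (_ - _) _ = flip N n i j (tmul _ _ - tmul _ _)
  rw [sub_tmul, map_sub]
  rfl

/-- With `P` the flip, `s` the exchange of variables and `∂` the divided difference, the equation
`P s f + ∂ f = f` becomes `P f = s f - ∂ f` upon applying `s`, since `s ∂ = ∂`. -/
theorem sAct_eq_self_iff {i j : Fin n} (h : i ≠ j) (hij : (i : ℕ) + 1 = j) (f : PolTPow N n) :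
    sAct N n h f = f ↔ twistedAction N n (Equiv.swap i j) f = f := by
  set S := swapVars N n i j with hS
  set P := flip N n i j with hP
  set D := divDiffOp N n h with hD
  have SS : ∀ g, S (S g) = g := fun g => congrArg (fun F => F g) (swapVars_swapVars i j)
  have PP : ∀ g, P (P g) = g := fun g => congrArg (fun F => F g) (flip_flip i j)
  have PS : ∀ g, P (S g) = S (P g) := fun g => congrArg (fun F => F g) (flip_swapVars i j)
  have SD : ∀ g, S (D g) = D g := fun g => congrArg (fun F => F g) (swapVars_divDiffOp h)
  rw [twistedAction_swap h hij]
  change P (S f) + D f = f ↔ P (S f - D f) = f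
  constructor
  · intro e
    have e1 := congrArg S e
    rw [map_add, SD, ← PS, SS] at e1
    rw [← e1, add_sub_cancel_right, PP]
  · intro e
    have e1 := congrArg P e
    rw [PP] at e1
    have e2 := congrArg S e1
    rw [map_sub, SS, SD, ← PS] at e2
    rw [← e2, sub_add_cancel]

theorem mem_invariants_iff {f : PolTPow N n} :
    f ∈ invariants N n ↔ ∀ w, twistedAction N n w f = f := by
  constructor
  · intro hf w
    induction w using AdjacentTransposition.perm_induction with
    | one => rw [map_one]; rfl
    | mul i j w hij ih =>
      have h := ne_of_val_add_one_eq hij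
      rw [map_mul, Module.End.mul_apply, ih]
      exact (sAct_eq_self_iff h hij f).1 (hf i j h hij)
  · exact fun hf i j h hij => (sAct_eq_self_iff h hij f).2 (hf _)

variable (N n) in
/-- The sum over the symmetric group, as a map from `𝒱` to the invariants. -/
noncomputable def symmetrize : PolTPow N n →ₗ[SymPol n] invariants N n where
  toFun f := ⟨∑ w, twistedAction N n w f, mem_invariants_iff.2 fun u => by
    rw [map_sum]
    refine Fintype.sum_equiv (Equiv.mulLeft u) _ _ fun w => ?_
    rw [Equiv.coe_mulLeft, map_mul, Module.End.mul_apply]⟩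
  map_add' f g := Subtype.ext (by
    change ∑ w, twistedAction N n w (f + g) = ∑ w, twistedAction N n w f + ∑ w, _
    simp only [map_add, Finset.sum_add_distrib])
  map_smul' q f := Subtype.ext (by
    change ∑ w, twistedAction N n w (SymPol.val n q • f)
      = SymPol.val n q • ∑ w, twistedAction N n w f
    simp only [twistedAction_smul (SymPol.isSymmetric_val q), Finset.smul_sum])

theorem coe_symmetrize (f : PolTPow N n) :
    (symmetrize N n f : PolTPow N n) = ∑ w, twistedAction N n w f := rfl

theorem symmetrize_coe (f : invariants N n) :
    symmetrize N n (f : PolTPow N n) = n.factorial • f := by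
  refine Subtype.ext ?_
  rw [coe_symmetrize, Finset.sum_congr rfl fun w _ => mem_invariants_iff.1 f.2 w, Finset.sum_const,
    Finset.card_univ, Fintype.card_perm, Fintype.card_fin]
  rfl

/-! ### Evaluation of invariants -/

/-- The invariants obtained by symmetrization from `staircase b ⊗ v` have the values
`∏ (b_k - b_j - 1) w v`, where `w` reverses the order of the tensor factors. -/
theorem evalAt_symmetrize_staircase (b : Fin n → ℂ) (v : TPow N n) :
    evalAt N n b (symmetrize N n (tmul (staircase b) v))
      = (∏ t ∈ orderedPairs (1 : Equiv.Perm (Fin n)), (b t.2 - b t.1 - 1))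
          • TPow.permAction N n Fin.revPerm v := by
  rw [coe_symmetrize, map_sum, Finset.sum_eq_single Fin.revPerm]
  · rw [twistedAction_tmul, evalAt_tmul, eval_deformedAction_staircase, if_pos rfl]
  · intro w _ hw
    rw [twistedAction_tmul, evalAt_tmul, eval_deformedAction_staircase, if_neg hw, zero_smul]
  · simp

variable {a b : Fin n → ℂ}

theorem exists_evalAt_eq (hb : ∀ i j : Fin n, j < i → b i ≠ b j + 1) (v : TPow N n) :
    ∃ f : invariants N n, evalAt N n b f = v := by
  refine ⟨symmetrize N n (tmul (staircase b) (TPow.permAction N n Fin.revPerm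
    ((∏ t ∈ orderedPairs (1 : Equiv.Perm (Fin n)), (b t.2 - b t.1 - 1))⁻¹ • v))), ?_⟩
  rw [evalAt_symmetrize_staircase, ← Module.End.mul_apply, ← map_mul, revPerm_mul_revPerm, map_one,
    Module.End.one_apply, smul_smul, mul_inv_cancel₀ (prod_sub_sub_one_ne_zero hb), one_smul]

variable (N n) in
/-- The polynomial obtained by applying a linear form on `V` to an element of `𝒱`. -/
noncomputable def coord (ξ : TPow N n →ₗ[ℂ] ℂ) : PolTPow N n →ₗ[ℂ] Pol n :=
  (TensorProduct.rid ℂ (Pol n)).toLinearMap ∘ₗ LinearMap.lTensor (Pol n) ξ ∘ₗ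
    (ofTensor N n).symm.toLinearMap

theorem coord_tmul (ξ : TPow N n →ₗ[ℂ] ℂ) (p : Pol n) (v : TPow N n) :
    coord N n ξ (tmul p v) = ξ v • p := rfl

theorem eval_coord (ξ : TPow N n →ₗ[ℂ] ℂ) (b : Fin n → ℂ) (f : PolTPow N n) :
    MvPolynomial.eval b (coord N n ξ f) = ξ (evalAt N n b f) := by
  induction f using induction_on with
  | h p v =>
    rw [coord_tmul, evalAt_tmul, MvPolynomial.smul_eval, map_smul, smul_eq_mul, mul_comm]
  | hadd f g hf hg => rw [map_add, map_add, map_add, map_add, hf, hg]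

theorem coord_twistedAction (ξ : TPow N n →ₗ[ℂ] ℂ) (w : Equiv.Perm (Fin n)) (f : PolTPow N n) :
    coord N n ξ (twistedAction N n w f)
      = deformedAction n w (coord N n (ξ ∘ₗ TPow.permAction N n w) f) := by
  induction f using induction_on with
  | h p v => rw [twistedAction_tmul, coord_tmul, coord_tmul, map_smul]; rfl
  | hadd f g hf hg => simp only [map_add, hf, hg]

theorem sum_tmul_coord {ι : Type*} [Fintype ι] (B : Module.Basis ι ℂ (TPow N n)) (f : PolTPow N n) :
    ∑ i, tmul (coord N n (B.coord i) f) (B i) = f := by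
  induction f using induction_on with
  | h p v =>
    simp only [coord_tmul, ← tmul_smul]
    have h1 : ∀ s : ι → TPow N n, ∑ i, (tmul p (s i) : PolTPow N n) = tmul p (∑ i, s i) := fun s =>
      (map_sum ((ofTensor N n).toLinearMap ∘ₗ TensorProduct.mk ℂ (Pol n) (TPow N n) p) s
        Finset.univ).symm
    rw [h1]
    exact congrArg _ (B.sum_repr _)
  | hadd f g hf hg =>
    simp only [map_add, add_tmul, Finset.sum_add_distrib, hf, hg]

theorem symmetrize_tmul_mem {p : Pol n} (hp : p ∈ (symIdeal n a).map (SymPol.val n))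
    (v : TPow N n) : symmetrize N n (tmul p v)
      ∈ (symIdeal n a • ⊤ : Submodule (SymPol n) (invariants N n)) := by
  suffices h : ∀ r, symmetrize N n (tmul (r * p) v)
      ∈ (symIdeal n a • ⊤ : Submodule (SymPol n) (invariants N n)) by simpa using h 1
  induction hp using Submodule.span_induction with
  | zero => intro r; rw [mul_zero, zero_tmul, map_zero]; exact Submodule.zero_mem _
  | add x y _ _ hx hy =>
    intro r; rw [mul_add, add_tmul, map_add]; exact Submodule.add_mem _ (hx r) (hy r)
  | mem x hx =>
    intro r
    obtain ⟨q, hq, rfl⟩ := hx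
    rw [mul_comm]
    have : symmetrize N n (tmul (SymPol.val n q * r) v) = q • symmetrize N n (tmul r v) :=
      map_smul (symmetrize N n) q (tmul r v)
    exact this ▸ Submodule.smul_mem_smul hq trivial
  | smul r' x hx ih => intro r; rw [smul_eq_mul, ← mul_assoc]; exact ih _

/-- Invariants vanishing at `b` belong to `I_a 𝒱^S`: all coordinates of such an element lie in the
ideal of polynomials generated by `I_a`, and symmetrization turns this into the claim. -/
theorem mem_smul_top_of_evalAt_eq_zero
    (hab : ∏ s : Fin n, (Polynomial.X - Polynomial.C (b s))
      = Polynomial.X ^ n + ∑ j : Fin n,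
          Polynomial.C ((-1) ^ (j.val + 1) * a j) * Polynomial.X ^ (n - (j.val + 1)))
    (hb : ∀ i j : Fin n, j < i → b i ≠ b j + 1) {f : invariants N n}
    (hf : evalAt N n b f = 0) :
    f ∈ (symIdeal n a • ⊤ : Submodule (SymPol n) (invariants N n)) := by
  have hcoord : ∀ ξ : TPow N n →ₗ[ℂ] ℂ,
      coord N n ξ f ∈ (symIdeal n a).map (SymPol.val n) := fun ξ => by
    refine mem_map_symIdeal_of_eval_eq_zero hab hb fun w => ?_
    have h1 := coord_twistedAction (ξ ∘ₗ TPow.permAction N n w⁻¹) w (f : PolTPow N n)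
    rw [mem_invariants_iff.1 f.2 w, LinearMap.comp_assoc, ← Module.End.mul_eq_comp, ← map_mul,
      inv_mul_cancel, map_one, Module.End.one_eq_id, LinearMap.comp_id] at h1
    rw [← h1, eval_coord, hf, map_zero]
  let B := Basis.piTensorProduct (fun _ : Fin n => Pi.basisFun ℂ (Fin N))
  have h1 : symmetrize N n (f : PolTPow N n)
      ∈ (symIdeal n a • ⊤ : Submodule (SymPol n) (invariants N n)) := by
    rw [← sum_tmul_coord B (f : PolTPow N n), map_sum]
    exact Submodule.sum_mem _ fun i _ => symmetrize_tmul_mem (hcoord _) _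
  rw [symmetrize_coe] at h1
  have h2 := Submodule.smul_mem _ (algebraMap ℂ (SymPol n) (n.factorial : ℂ)⁻¹) h1
  rwa [← Nat.cast_smul_eq_nsmul (SymPol n), smul_smul, ← map_natCast (algebraMap ℂ (SymPol n)),
    ← map_mul, inv_mul_cancel₀ (Nat.cast_ne_zero.2 n.factorial_ne_zero), map_one, one_smul] at h2

end PolTPow

end

/-! ### The tensor product of evaluation modules -/

namespace Yangian

variable {N : ℕ}

theorem vecRep_glGen_eq (i j : Fin N) :
    vecRep N (glGen N i j) = Matrix.toLin' (Matrix.single i j (1 : ℂ)) := by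
  rw [vecRep, glGen, UniversalEnvelopingAlgebra.lift_ι_apply]
  rfl

theorem evalRep_T_zero (b : ℂ) (i j : Fin N) :
    evalRep N b (PowerSeries.coeff 0 (T N i j)) = if i = j then 1 else 0 := by
  rw [(isRTT_T N).coeff_zero]
  split_ifs <;> simp

theorem evalRep_T_succ (b : ℂ) (i j : Fin N) (s : ℕ) :
    evalRep N b (PowerSeries.coeff (s + 1) (T N i j))
      = b ^ s • Matrix.toLin' (Matrix.single j i (1 : ℂ)) := by
  rw [evalRep, AlgHom.comp_apply, AlgHom.comp_apply, translate, lift_T, Matrix.map_apply,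
    IsRTT.shift, PowerSeries.coeff_mk, map_sum, map_sum]
  rw [Finset.sum_eq_single 1]
  · rw [map_smul, map_smul, eval_T_one, vecRep_glGen_eq]
    simp
  · intro q hq hq1
    rcases q with _ | _ | q
    · simp
    · exact absurd rfl hq1
    · rw [map_smul, map_smul, eval_T_ge, map_zero, smul_zero]
  · intro h
    exact absurd (Finset.mem_range.2 (by omega)) h

end Yangian

namespace TPow

variable {N n : ℕ}

variable (N n) in
/-- Operators on the product of the first `n` factors as operators on the product of all factors. -/
noncomputable def leftEnd : Module.End ℂ (TPow N n) →ₐ[ℂ] Module.End ℂ (TPow N (n + 1)) :=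
  ((snocEquiv N n).conjAlgEquiv ℂ).toAlgHom.comp
    (Module.End.rTensorAlgHom ℂ (TPow N n) (Fin N → ℂ))

variable (N n) in
/-- Operators on the last factor as operators on the product of all factors. -/
noncomputable def rightEnd : Module.End ℂ (Fin N → ℂ) →ₐ[ℂ] Module.End ℂ (TPow N (n + 1)) :=
  ((snocEquiv N n).conjAlgEquiv ℂ).toAlgHom.comp
    (Module.End.lTensorAlgHom ℂ (Fin N → ℂ) (TPow N n))

theorem leftEnd_apply (x : Module.End ℂ (TPow N n)) (u : TPow N (n + 1)) :
    leftEnd N n x u = snocEquiv N n (LinearMap.rTensor (Fin N → ℂ) x ((snocEquiv N n).symm u)) :=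
  rfl

theorem rightEnd_apply (y : Module.End ℂ (Fin N → ℂ)) (u : TPow N (n + 1)) :
    rightEnd N n y u = snocEquiv N n (LinearMap.lTensor (TPow N n) y ((snocEquiv N n).symm u)) :=
  rfl

theorem conj_map_eq (x : Module.End ℂ (TPow N n)) (y : Module.End ℂ (Fin N → ℂ)) :
    (snocEquiv N n).conjAlgEquiv ℂ (TensorProduct.map x y) = rightEnd N n y * leftEnd N n x := by
  have : TensorProduct.map x y = LinearMap.lTensor _ y * LinearMap.rTensor _ x := by
    rw [Module.End.mul_eq_comp, LinearMap.lTensor_comp_rTensor]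
  rw [this, map_mul]
  rfl

theorem end_ext_snoc {F G : Module.End ℂ (TPow N (n + 1))}
    (h : ∀ (v : Fin n → Fin N → ℂ) (w : Fin N → ℂ),
      F (snocEquiv N n (PiTensorProduct.tprod ℂ v ⊗ₜ[ℂ] w))
        = G (snocEquiv N n (PiTensorProduct.tprod ℂ v ⊗ₜ[ℂ] w))) : F = G := by
  refine PiTensorProduct.ext (MultilinearMap.ext fun v => ?_)
  have := h (Fin.init v) (v (Fin.last n))
  rwa [snocEquiv_tprod, Fin.snoc_init_self] at this

theorem leftEnd_slotV (a : Fin n) (g : Module.End ℂ (Fin N → ℂ)) :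
    leftEnd N n (PolTPow.slotV N n a g) = PolTPow.slotV N (n + 1) a.castSucc g := by
  refine end_ext_snoc fun v w => ?_
  have : leftEnd N n (PolTPow.slotV N n a g) (snocEquiv N n (PiTensorProduct.tprod ℂ v ⊗ₜ[ℂ] w))
      = snocEquiv N n (PolTPow.slotV N n a g (PiTensorProduct.tprod ℂ v) ⊗ₜ[ℂ] w) := by
    rw [leftEnd_apply, LinearEquiv.symm_apply_apply, LinearMap.rTensor_tmul]
  rw [this, PolTPow.slotV_tprod, snocEquiv_tprod, snocEquiv_tprod, PolTPow.slotV_tprod,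
    Fin.snoc_update, Fin.snoc_castSucc]

theorem rightEnd_eq_slotV (g : Module.End ℂ (Fin N → ℂ)) :
    rightEnd N n g = PolTPow.slotV N (n + 1) (Fin.last n) g := by
  refine end_ext_snoc fun v w => ?_
  have : rightEnd N n g (snocEquiv N n (PiTensorProduct.tprod ℂ v ⊗ₜ[ℂ] w))
      = snocEquiv N n (PiTensorProduct.tprod ℂ v ⊗ₜ[ℂ] g w) := by
    rw [rightEnd_apply, LinearEquiv.symm_apply_apply, LinearMap.lTensor_tmul]
  rw [this, snocEquiv_tprod, snocEquiv_tprod, PolTPow.slotV_tprod, Fin.update_snoc_last,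
    Fin.snoc_last]

variable (N) in
/-- The value at `z = b` of `PolTPow.factor`: the matrix `1 + u⁻¹ (P^{(0,a)} - b_a)`. -/
noncomputable def factor (b : Fin n → ℂ) (a : Fin n) :
    Matrix (Fin N) (Fin N) (PowerSeries (Module.End ℂ (TPow N n))) :=
  1 + Matrix.of fun i j => PowerSeries.X * PowerSeries.C
    (PolTPow.slotV N n a (Matrix.toLin' (Matrix.single j i 1))
      - if i = j then algebraMap ℂ _ (b a) else 0)

/-- The series `∑ m, b_a ^ m u ^ (-m)`, multiplied over all `a`. -/
noncomputable def invSeries (b : Fin n → ℂ) : PowerSeries ℂ :=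
  ∏ a : Fin n, PowerSeries.mk fun m => b a ^ m

variable (N) in
/-- The value at `z = b` of `PolTPow.tMatrix`. -/
noncomputable def tMatrix (b : Fin n → ℂ) :
    Matrix (Fin N) (Fin N) (PowerSeries (Module.End ℂ (TPow N n))) :=
  Matrix.of fun i j => PowerSeries.map (algebraMap ℂ _) (invSeries b)
    * (List.ofFn (factor N b)).reverse.prod i j

theorem factor_castSucc (b : Fin (n + 1) → ℂ) (a : Fin n) : factor N b a.castSucc
    = (PowerSeries.map (leftEnd N n).toRingHom).mapMatrix
      (factor N (fun c => b c.castSucc) a) := by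
  rw [factor, factor, map_add, map_one]
  congr 1
  refine Matrix.ext fun i j => ?_
  rw [RingHom.mapMatrix_apply, Matrix.map_apply, Matrix.of_apply, Matrix.of_apply, map_mul,
    PowerSeries.map_X, PowerSeries.map_C, ← leftEnd_slotV]
  congr 2
  refine Eq.trans ?_ (map_sub (leftEnd N n) _ _).symm
  split_ifs
  · rw [AlgHom.commutes]
  · rw [map_zero]

theorem mul_add_mul_sub {R : Type*} [Ring R] (x y z : R) : x * y + x * (z - y) = x * z := by
  rw [← mul_add, add_sub_cancel]

/-- The matrix of the evaluation module, on the last factor. -/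
theorem mk_pow_mul_factor_last (b : Fin (n + 1) → ℂ) (i j : Fin N) (s : ℕ) :
    PowerSeries.coeff s (PowerSeries.map (algebraMap ℂ _)
        (PowerSeries.mk fun m => b (Fin.last n) ^ m) * factor N b (Fin.last n) i j)
      = rightEnd N n (Yangian.evalRep N (b (Fin.last n))
          (PowerSeries.coeff s (Yangian.T N i j))) := by
  set β := b (Fin.last n) with hβ
  set P := PolTPow.slotV N (n + 1) (Fin.last n) (Matrix.toLin' (Matrix.single j i 1)) with hP
  have hf : factor N b (Fin.last n) i j = (if i = j then 1 else 0) + PowerSeries.X * PowerSeries.C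
      (P - if i = j then algebraMap ℂ _ β else 0) := by
    rw [factor, Matrix.add_apply, Matrix.one_apply, Matrix.of_apply]
  rw [hf, mul_add, map_add, ← mul_assoc, PowerSeries.coeff_mul_C]
  rcases s with _ | s
  · rw [Yangian.evalRep_T_zero]
    split_ifs <;> simp
  · rw [Yangian.evalRep_T_succ, map_smul, rightEnd_eq_slotV, PowerSeries.coeff_succ_mul_X]
    split_ifs
    · simp only [PowerSeries.coeff_map, PowerSeries.coeff_mk, mul_one, pow_succ, map_mul,
        Algebra.smul_def, ← hP]
      exact mul_add_mul_sub _ _ P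
    · simp only [PowerSeries.coeff_map, PowerSeries.coeff_mk, mul_zero, map_zero, zero_add,
        Algebra.smul_def, ← hP]
      exact congrArg _ (sub_zero P)

theorem reverse_prod_factor_succ (b : Fin (n + 1) → ℂ) :
    (List.ofFn (factor N b)).reverse.prod = factor N b (Fin.last n)
      * (PowerSeries.map (leftEnd N n).toRingHom).mapMatrix
        (List.ofFn (factor N fun c => b c.castSucc)).reverse.prod := by
  have e : (fun a : Fin n => factor N b a.castSucc)
      = (PowerSeries.map (leftEnd N n).toRingHom).mapMatrix ∘ factor N fun c => b c.castSucc :=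
    funext fun a => factor_castSucc b a
  rw [List.ofFn_succ', List.concat_eq_append, List.reverse_append, List.reverse_singleton,
    List.singleton_append, List.prod_cons, e, ← List.map_ofFn, ← List.map_reverse,
    ← map_list_prod]

theorem commute_map_algebraMap {B : Type*} [Ring B] [Algebra ℂ B] (f : PowerSeries ℂ)
    (g : PowerSeries B) : Commute (PowerSeries.map (algebraMap ℂ B) f) g :=
  IsRTT.commute_of_coeff fun r s => by
    rw [PowerSeries.coeff_map]
    exact Algebra.commutes _ _

theorem map_map_algebraMap {A B : Type*} [Ring A] [Algebra ℂ A] [Ring B] [Algebra ℂ B]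
    (φ : A →ₐ[ℂ] B) (f : PowerSeries ℂ) :
    PowerSeries.map φ.toRingHom (PowerSeries.map (algebraMap ℂ A) f)
      = PowerSeries.map (algebraMap ℂ B) f := by
  ext r : 1
  simp only [PowerSeries.coeff_map]
  exact φ.commutes _

theorem mul_mul_matrix_mul_apply {B : Type*} [Ring B] (x y : B) (hy : ∀ z, y * z = z * y)
    (F L : Matrix (Fin N) (Fin N) B) (i j : Fin N) :
    x * y * (F * L) i j = ∑ k, (x * F i k) * (y * L k j) := by
  rw [Matrix.mul_apply, Finset.mul_sum]
  exact Finset.sum_congr rfl fun k _ => Commute.mul_mul_mul_comm (hy _) _ _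

theorem tMatrix_succ (b : Fin (n + 1) → ℂ) (i j : Fin N) : tMatrix N b i j
    = ∑ k, (PowerSeries.map (algebraMap ℂ _)
        (PowerSeries.mk fun m => b (Fin.last n) ^ m) * factor N b (Fin.last n) i k)
      * PowerSeries.map (leftEnd N n).toRingHom (tMatrix N (fun c => b c.castSucc) k j) := by
  have hS : PowerSeries.map (algebraMap ℂ (Module.End ℂ (TPow N (n + 1)))) (invSeries b)
      = PowerSeries.map (algebraMap ℂ _) (PowerSeries.mk fun m => b (Fin.last n) ^ m)
        * PowerSeries.map (algebraMap ℂ _) (invSeries fun c => b c.castSucc) := by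
    rw [invSeries, Fin.prod_univ_castSucc, mul_comm, map_mul]
    rfl
  rw [tMatrix, Matrix.of_apply, reverse_prod_factor_succ, hS]
  refine (mul_mul_matrix_mul_apply (B := PowerSeries (Module.End ℂ (TPow N (n + 1)))) _ _
    (fun z => (commute_map_algebraMap _ z).eq) _ _ i j).trans ?_
  refine Finset.sum_congr rfl fun k _ => congrArg _ ?_
  have h := map_mul (PowerSeries.map (leftEnd N n).toRingHom)
    (PowerSeries.map (algebraMap ℂ _) (invSeries fun c => b c.castSucc))
    ((List.ofFn (factor N fun c => b c.castSucc)).reverse.prod k j)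
  refine Eq.trans ?_ h.symm
  exact congrArg (· * _) (map_map_algebraMap (A := Module.End ℂ (TPow N n))
    (B := Module.End ℂ (TPow N (n + 1))) (leftEnd N n) _).symm

end TPow

theorem Yangian.evalTensorRep_T (N n : ℕ) (b : Fin n → ℂ) (i j : Fin N) (s : ℕ) :
    Yangian.evalTensorRep N n b (PowerSeries.coeff s (Yangian.T N i j))
      = PowerSeries.coeff s (TPow.tMatrix N b i j) := by
  induction n generalizing i j s with
  | zero =>
    have h1 : TPow.tMatrix N b i j = (1 : Matrix (Fin N) (Fin N) (PowerSeries _)) i j := by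
      simp [TPow.tMatrix, TPow.invSeries]
    have h2 : ∀ c : ℂ, Yangian.counit N (PowerSeries.coeff s (Yangian.T N i j)) = c →
        Yangian.evalTensorRep N 0 b (PowerSeries.coeff s (Yangian.T N i j))
          = algebraMap ℂ _ c := fun c hc => by
      rw [Yangian.evalTensorRep, AlgHom.comp_apply, Yangian.trivRep, AlgHom.comp_apply, hc]
      exact AlgHom.commutes (LinearEquiv.conjAlgEquiv ℂ _).toAlgHom c
    rw [h2 _ (Yangian.lift_T _ _ i j s), h1, Matrix.one_apply, Matrix.one_apply]
    split_ifs
    · rw [PowerSeries.coeff_one, PowerSeries.coeff_one]; split_ifs <;> simp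
    · simp
  | succ n ih =>
    have h1 : Yangian.evalTensorRep N (n + 1) b (PowerSeries.coeff s (Yangian.T N i j))
        = ∑ k, ∑ p ∈ Finset.HasAntidiagonal.antidiagonal s,
          TPow.rightEnd N n (Yangian.evalRep N (b (Fin.last n))
            (PowerSeries.coeff p.2 (Yangian.T N i k)))
          * TPow.leftEnd N n (Yangian.evalTensorRep N n (fun c => b c.castSucc)
            (PowerSeries.coeff p.1 (Yangian.T N k j))) := by
      rw [Yangian.evalTensorRep, AlgHom.comp_apply, Yangian.tensorRep, AlgHom.comp_apply,
        AlgHom.comp_apply, Yangian.comul_T]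
      simp only [map_sum, Algebra.TensorProduct.map_tmul]
      refine Finset.sum_congr rfl fun k _ => Finset.sum_congr rfl fun p _ => ?_
      rw [← TPow.conj_map_eq]
      rfl
    rw [h1, TPow.tMatrix_succ, map_sum]
    refine Finset.sum_congr rfl fun k _ => ?_
    rw [PowerSeries.coeff_mul, ← Finset.Nat.sum_antidiagonal_swap]
    refine Finset.sum_congr rfl fun p _ => ?_
    rw [Prod.fst_swap, Prod.snd_swap, TPow.mk_pow_mul_factor_last, PowerSeries.coeff_map, ← ih]
    rfl

/-! ### The evaluation map intertwines the actions of the Yangian -/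

namespace PolTPow

variable {N n : ℕ}

/-- Evaluation at `z = b` intertwines `x` and `y`. -/
def Intertwines (b : Fin n → ℂ) (x : Module.End ℂ (PolTPow N n)) (y : Module.End ℂ (TPow N n)) :
    Prop :=
  ∀ f, evalAt N n b (x f) = y (evalAt N n b f)

namespace Intertwines

variable {b : Fin n → ℂ} {x x' : Module.End ℂ (PolTPow N n)} {y y' : Module.End ℂ (TPow N n)}

theorem add (h : Intertwines b x y) (h' : Intertwines b x' y') :
    Intertwines b (x + x') (y + y') := fun f => by
  rw [LinearMap.add_apply, map_add, h, h', LinearMap.add_apply]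

theorem sub (h : Intertwines b x y) (h' : Intertwines b x' y') :
    Intertwines b (x - x') (y - y') := fun f => by
  rw [LinearMap.sub_apply, map_sub, h, h', LinearMap.sub_apply]

theorem mul (h : Intertwines b x y) (h' : Intertwines b x' y') :
    Intertwines b (x * x') (y * y') := fun f => by
  rw [Module.End.mul_apply, h, h', Module.End.mul_apply]

theorem zero : Intertwines (N := N) b 0 0 := fun _ => map_zero _

theorem one : Intertwines (N := N) b 1 1 := fun _ => rfl

theorem sum {ι : Type*} (s : Finset ι) {x : ι → Module.End ℂ (PolTPow N n)}
    {y : ι → Module.End ℂ (TPow N n)} (h : ∀ i ∈ s, Intertwines b (x i) (y i)) :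
    Intertwines b (∑ i ∈ s, x i) (∑ i ∈ s, y i) := fun f => by
  rw [LinearMap.sum_apply, map_sum, LinearMap.sum_apply]
  exact Finset.sum_congr rfl fun i hi => h i hi f

theorem scalar (c : ℂ) : Intertwines (N := N) b (algebraMap ℂ _ c) (algebraMap ℂ _ c) :=
  fun f => by rw [Module.algebraMap_end_apply, map_smul, Module.algebraMap_end_apply]

theorem polOp (q : Pol n) :
    Intertwines b (polOp N n q) (algebraMap ℂ _ (MvPolynomial.eval b q)) := fun f => by
  induction f using induction_on with
  | h p v =>
    rw [polOp_pure, evalAt_tmul, evalAt_tmul, Module.algebraMap_end_apply, map_mul, mul_smul]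
  | hadd f g hf hg => simp only [map_add, hf, hg]

theorem slot (a : Fin n) (g : Matrix (Fin N) (Fin N) ℂ) :
    Intertwines b (slot N n a g) (slotV N n a (Matrix.toLin' g)) := fun f => by
  induction f using induction_on with
  | h p v =>
    rw [slot_pure, evalAt_tmul, evalAt_tmul, map_smul, slotV_tprod, Matrix.toLin'_apply]
  | hadd f g hf hg => simp only [map_add, hf, hg]

end Intertwines

/-- Evaluation at `z = b` intertwines the coefficients of two series. -/
def IntertwinesSeries (b : Fin n → ℂ) (F : PowerSeries (Module.End ℂ (PolTPow N n)))
    (G : PowerSeries (Module.End ℂ (TPow N n))) : Prop :=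
  ∀ r, Intertwines b (PowerSeries.coeff r F) (PowerSeries.coeff r G)

theorem IntertwinesSeries.mul {b : Fin n → ℂ} {F F' : PowerSeries (Module.End ℂ (PolTPow N n))}
    {G G' : PowerSeries (Module.End ℂ (TPow N n))} (h : IntertwinesSeries b F G)
    (h' : IntertwinesSeries b F' G') : IntertwinesSeries b (F * F') (G * G') := fun r => by
  rw [PowerSeries.coeff_mul, PowerSeries.coeff_mul]
  exact Intertwines.sum _ fun p _ => (h _).mul (h' _)

theorem intertwines_factor (b : Fin n → ℂ) (a : Fin n) (i j : Fin N) :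
    IntertwinesSeries b (factor N n a i j) (TPow.factor N b a i j) := by
  have h : Intertwines b (auxFlip N n a i j - if i = j then polOp N n (MvPolynomial.X a) else 0)
      (slotV N n a (Matrix.toLin' (Matrix.single j i 1))
        - if i = j then algebraMap ℂ _ (b a) else 0) := by
    refine (Intertwines.slot a _).sub ?_
    split_ifs
    · simpa using Intertwines.polOp (N := N) (b := b) (MvPolynomial.X a)
    · exact Intertwines.zero
  rintro (_ | _ | r)
  · rw [coeff_factor_zero, TPow.factor, Matrix.add_apply, map_add, Matrix.of_apply,
      PowerSeries.coeff_zero_X_mul, Matrix.one_apply]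
    split_ifs
    · simpa using Intertwines.one
    · simpa using Intertwines.zero
  · rw [coeff_factor_one, TPow.factor, Matrix.add_apply, map_add, Matrix.of_apply,
      PowerSeries.coeff_succ_X_mul (n := 0), Matrix.one_apply, PowerSeries.coeff_zero_C]
    have e : PowerSeries.coeff 1 (if i = j then (1 : PowerSeries (Module.End ℂ (TPow N n))) else 0)
        = 0 := by split_ifs <;> simp [PowerSeries.coeff_one]
    rw [e, zero_add]
    exact h
  · have e : PowerSeries.coeff (r + 2) (TPow.factor N b a i j) = 0 := by
      rw [TPow.factor, Matrix.add_apply, map_add, Matrix.of_apply, PowerSeries.coeff_succ_X_mul,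
        Matrix.one_apply, PowerSeries.coeff_C]
      split_ifs <;> simp_all [PowerSeries.coeff_one]
    rw [coeff_factor_ge, e]
    exact Intertwines.zero

theorem intertwines_list_prod (b : Fin n → ℂ) (l : List (Fin n)) (i j : Fin N) :
    IntertwinesSeries b ((l.map (factor N n)).prod i j) ((l.map (TPow.factor N b)).prod i j) := by
  induction l generalizing i j with
  | nil =>
    intro r
    rw [List.map_nil, List.map_nil, List.prod_nil, List.prod_nil, Matrix.one_apply,
      Matrix.one_apply]
    split_ifs
    · rw [PowerSeries.coeff_one, PowerSeries.coeff_one]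
      split_ifs
      · exact Intertwines.one
      · exact Intertwines.zero
    · simpa using Intertwines.zero
  | cons a l ih =>
    intro r
    rw [List.map_cons, List.map_cons, List.prod_cons, List.prod_cons, Matrix.mul_apply,
      Matrix.mul_apply, map_sum, map_sum]
    exact Intertwines.sum _ fun k _ => (intertwines_factor b a i k).mul (ih k j) r

theorem intertwines_tMatrix (b : Fin n → ℂ) (i j : Fin N) :
    IntertwinesSeries b (tMatrix N n i j) (TPow.tMatrix N b i j) := by
  rw [tMatrix, TPow.tMatrix, Matrix.of_apply, Matrix.of_apply]
  refine IntertwinesSeries.mul (fun r => ?_) ?_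
  · have h : PowerSeries.map (MvPolynomial.eval b) (invSeries n) = TPow.invSeries b := by
      rw [invSeries, TPow.invSeries, map_prod]
      refine Finset.prod_congr rfl fun a _ => ?_
      ext m : 1
      simp
    rw [PowerSeries.coeff_map, PowerSeries.coeff_map, ← h, PowerSeries.coeff_map]
    exact Intertwines.polOp _
  · rw [lMatrix_eq, List.ofFn_eq_map, ← List.map_reverse]
    exact intertwines_list_prod b _ i j

/-- Evaluation at `z = b` is a homomorphism of `Y(gl_N)`-modules on the whole of `𝒱`. -/
theorem evalAt_rep (b : Fin n → ℂ) (y : Yangian N) :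
    Intertwines b (rep N n y) (Yangian.evalTensorRep N n b y) := by
  let A : Subalgebra ℂ (Yangian N) :=
    { carrier := {y | Intertwines b (rep N n y) (Yangian.evalTensorRep N n b y)}
      mul_mem' := fun {y y'} h h' => by
        rw [Set.mem_ofPred_eq, map_mul, map_mul]; exact Intertwines.mul h h'
      add_mem' := fun {y y'} h h' => by
        rw [Set.mem_ofPred_eq, map_add, map_add]; exact Intertwines.add h h'
      algebraMap_mem' := fun c => by
        rw [Set.mem_ofPred_eq, AlgHom.commutes, AlgHom.commutes]; exact Intertwines.scalar c }
  refine Yangian.mem_of_coeff_mem A (fun i j s => ?_) y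
  change Intertwines b _ _
  rw [rep, Yangian.lift_T, Yangian.evalTensorRep_T]
  exact intertwines_tMatrix b i j s

theorem evalAt_eq_zero_of_mem_smul_top {a b : Fin n → ℂ}
    (hab : ∏ s : Fin n, (Polynomial.X - Polynomial.C (b s))
      = Polynomial.X ^ n + ∑ j : Fin n,
          Polynomial.C ((-1) ^ (j.val + 1) * a j) * Polynomial.X ^ (n - (j.val + 1)))
    {f : invariants N n}
    (hf : f ∈ (symIdeal n a • ⊤ : Submodule (SymPol n) (invariants N n))) :
    evalAt N n b f = 0 := by
  induction hf using Submodule.smul_induction_on' with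
  | smul q hq g _ =>
    have := Intertwines.polOp (b := b) (SymPol.val n q) (g : PolTPow N n)
    rw [eval_val_eq_zero_of_mem hab hq, map_zero] at this
    exact this
  | add f _ g _ hf hg => rw [Submodule.coe_add, map_add, hf, hg, add_zero]

end PolTPow

theorem mainTheorem12 (N n : ℕ) (a b : Fin n → ℂ)
    (hab : ∏ s : Fin n, (Polynomial.X - Polynomial.C (b s))
      = Polynomial.X ^ n + ∑ j : Fin n,
          Polynomial.C ((-1) ^ (j.val + 1) * a j) * Polynomial.X ^ (n - (j.val + 1)))
    (hb : ∀ i j : Fin n, j < i → b i ≠ b j + 1) :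
    ∃ ψ : PolTPow.Fiber N n a ≃ₗ[ℂ] TPow N n,
      (∀ (y : Yangian N) (m : PolTPow.Fiber N n a),
        ψ (PolTPow.fiberRep N n a y m) = Yangian.evalTensorRep N n b y (ψ m)) ∧
      ∀ f : PolTPow.invariants N n, ψ (Submodule.Quotient.mk f) = PolTPow.evalAt N n b f := by
  let I := (symIdeal n a • ⊤ : Submodule (SymPol n) (PolTPow.invariants N n))
  let ev : PolTPow.invariants N n →ₗ[ℂ] TPow N n :=
    PolTPow.evalAt N n b ∘ₗ (PolTPow.invariants N n).subtype.restrictScalars ℂ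
  have hev : ∀ f, ev f = 0 ↔ f ∈ I := fun f =>
    ⟨fun h => PolTPow.mem_smul_top_of_evalAt_eq_zero hab hb h,
      fun h => PolTPow.evalAt_eq_zero_of_mem_smul_top hab h⟩
  let φ : PolTPow.Fiber N n a →ₗ[ℂ] TPow N n :=
    ((I.restrictScalars ℂ).liftQ ev fun f hf => (hev f).2 hf) ∘ₗ
      (Submodule.Quotient.restrictScalarsEquiv ℂ I).symm.toLinearMap
  have hφ : ∀ f : PolTPow.invariants N n,
      φ (Submodule.Quotient.mk f) = PolTPow.evalAt N n b f := fun f => rfl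
  have hinj : Function.Injective φ := by
    rw [injective_iff_map_eq_zero]
    intro m hm
    obtain ⟨f, rfl⟩ := Submodule.Quotient.mk_surjective _ m
    exact (Submodule.Quotient.mk_eq_zero _).2 ((hev f).1 hm)
  have hsurj : Function.Surjective φ := fun v => by
    obtain ⟨f, hf⟩ := PolTPow.exists_evalAt_eq hb v
    exact ⟨Submodule.Quotient.mk f, hf⟩
  refine ⟨LinearEquiv.ofBijective φ ⟨hinj, hsurj⟩, fun y m => ?_, hφ⟩
  obtain ⟨f, rfl⟩ := Submodule.Quotient.mk_surjective _ m
  exact PolTPow.evalAt_rep b y f
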